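/- Let $n\ge 1$. Let $\mathbb{H}^n=\{x\in\mathbb{R}^n:|x|<1\}$ with the metric $4(1-|x|^2)^{-2}|dx|^2$, let $\widehat M=\mathbb{H}^n\times\mathbb{R}$ with the product metric $\widehat g=4(1-|x|^2)^{-2}|dx|^2+dt^2$, and let $\partial_t$ be the vertical vector field. (1) Let $f:(M,g)\to\widehat M$ be a smooth isometric immersion of an $n$-dimensional Riemannian manifold (without boundary; Hausdorff and second countable), let $h_M=t\circ f$ be its height function, $\Delta_M$ the (non-positive) Laplacian of $(M,g)$, and $\overrightarrow H$ the normalized mean curvature vector of the immersion, i.e. $\frac1n$ times the trace of its second fundamental form. Then on $M$ $$\Delta_M h_M=n\,\widehat g(\overrightarrow H,\partial_t).$$ (2) In the situation of (1), let $\Omega\subset M$ be a compact domain with smooth boundary (not necessarily connected), with inner unit normal $\nu_{\partial\Omega}$ along $\partial\Omega$, and let $d\mu_M$, $d\sigma_{\partial\Omega}$ be the Riemannian measures of $M$ and $\partial\Omega$. Then the integrands below are integrable and $$\int_\Omega\Delta_M h_M\,d\mu_M=-\int_{\partial\Omega}dh_M(\nu_{\partial\Omega})\,d\sigma_{\partial\Omega}=n\int_\Omega\widehat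 g(\overrightarrow H,\partial_t)\,d\mu_M .$$ (3) Let $J\subset(0,\infty)$ be an open interval, $\lambda:J\to\mathbb{R}$ of class $C^2$, and consider the rotation hypersurface $X(\rho,\xi)=(\tanh(\rho/2)\,\xi,\lambda(\rho))$, $\rho\in J$, $\xi\in S^{n-1}$, in $\mathbb{H}^n\times\mathbb{R}$. At each point there is exactly one upward unit normal $N$ (that is, $\widehat g(N,\partial_t)>0$). Put $\Phi(\rho)=\sinh^{n-1}(\rho)\,\dot\lambda(\rho)\,(1+\dot\lambda(\rho)^2)^{-1/2}$. The mean curvature $H=\widehat g(\overrightarrow H,N)$ at the point $X(\rho,\xi)$ satisfies $$\Phi'(\rho)=n\,H\,\sinh^{n-1}(\rho).$$ If the mean curvature is a constant $H$, then for all $\rho_0,\rho\in J$ $$\Phi(\rho)=nH\int_{\rho_0}^{\rho}\sinh^{n-1}(t)\,dt+\Phi(\rho_0).$$ Moreover, for every $H\in\mathbb{R}$, the mean curvature is constant equal to $H$ if and only if there is a constant $d$ such that for all $\rho\in J$ $$\dot\lambda(\rho)\,(1+\dot\lambda(\rho)^2)^{-1/2}\sinh^{n-1}(\rho)=nH\int_0^{\rho}\sinh^{n-1}(t)\,dt+d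 .$$ -/

import Mathlib

open MeasureTheory
open scoped Manifold ContDiff

namespace VerticalFlux

noncomputable section

/-- Euclidean space of dimension `n`. -/
abbrev Euc (n : ℕ) : Type := EuclideanSpace ℝ (Fin n)

/-- The canonical basis of `ℝⁿ`. -/
def stdBasis (n : ℕ) : Module.Basis (Fin n) ℝ (Euc n) :=
  (EuclideanSpace.basisFun (Fin n) ℝ).toBasis

/-! ### Riemannian geometry in coordinates

A metric on an open part of a vector space `E` is given as a function
`g : E → E → E → ℝ`, where `g x v w` is the product of `v` and `w` at the point `x`. -/

section Coordinates

variable {ι : Type} [Fintype ι] [DecidableEq ι]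
variable {E : Type} [NormedAddCommGroup E] [NormedSpace ℝ E]

/-- The matrix `g_{ij}(x)` of the metric `g` in the basis `b`. Its inverse is `g^{ij}(x)`. -/
def gram (g : E → E → E → ℝ) (b : Module.Basis ι ℝ E) (x : E) : Matrix ι ι ℝ :=
  Matrix.of fun i j => g x (b i) (b j)

/-- Christoffel symbols of the first kind,
`(1/2) (∂_v g(w, u) + ∂_w g(v, u) - ∂_u g(v, w))` for constant vector fields `v, w, u`. -/
def christoffelFirst (g : E → E → E → ℝ) (x v w u : E) : ℝ :=
  (1 / 2) * (fderiv ℝ (fun y => g y w u) x v + fderiv ℝ (fun y => g y v u) x w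
    - fderiv ℝ (fun y => g y v w) x u)

/-- The Christoffel symbols of the Levi-Civita connection of `g`: `christoffel g b x v w` is the
covariant derivative at `x` of the constant vector field `w` in the direction `v`, that is
`Γ^k_{ij} v^i w^j b_k`. -/
def christoffel (g : E → E → E → ℝ) (b : Module.Basis ι ℝ E) (x v w : E) : E :=
  ∑ k, (∑ l, (gram g b x)⁻¹ k l * christoffelFirst g x v w (b l)) • b k

/-- The Laplacian of `u` (the trace of its Hessian) with respect to `g`, in coordinates:
`g^{ij} (∂_i ∂_j u - Γ^k_{ij} ∂_k u)`. -/
def coordLaplacian (g : E → E → E → ℝ) (b : Module.Basis ι ℝ E) (u : E → ℝ) (x : E) : ℝ :=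
  ∑ i, ∑ j, (gram g b x)⁻¹ i j *
    (fderiv ℝ (fun y => fderiv ℝ u y (b j)) x (b i) - fderiv ℝ u x (christoffel g b x (b i) (b j)))

end Coordinates

/-! ### The ambient space

The space `ℍⁿ × ℝ` is the set of `p = (x, t) ∈ ℝⁿ × ℝ` with `‖x‖ < 1` (ball model). -/

/-- The product metric `4 (1 - |x|²)⁻² |dx|² + dt²` on `ℍⁿ × ℝ`. -/
def ambientMetric {n : ℕ} (p v w : Euc n × ℝ) : ℝ :=
  4 / (1 - ‖p.1‖ ^ 2) ^ 2 * inner ℝ v.1 w.1 + v.2 * w.2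

/-- The canonical basis of `ℝⁿ × ℝ`. -/
def ambientBasis (n : ℕ) : Module.Basis (Fin n ⊕ Unit) ℝ (Euc n × ℝ) :=
  (stdBasis n).prod (Module.Basis.singleton Unit ℝ)

/-- The vertical vector field `∂_t`. -/
def verticalField (n : ℕ) : Euc n × ℝ := (0, 1)

/-! ### Extrinsic geometry of a parametrized hypersurface `X : ℝⁿ ⊇ U → ℍⁿ × ℝ` -/

section Parametrized

variable {n : ℕ}

/-- The metric induced by the parametrization `X`. -/
def pullbackMetric (X : Euc n → Euc n × ℝ) (x v w : Euc n) : ℝ :=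
  ambientMetric (X x) (fderiv ℝ X x v) (fderiv ℝ X x w)

/-- The component of `z` normal to the hypersurface at `X x`:
`z - g^{ij} ⟨z, ∂_i X⟩ ∂_j X`. -/
def normalPart (X : Euc n → Euc n × ℝ) (x : Euc n) (z : Euc n × ℝ) : Euc n × ℝ :=
  z - ∑ i, ∑ j, ((gram (pullbackMetric X) (stdBasis n) x)⁻¹ i j *
    ambientMetric (X x) z (fderiv ℝ X x (stdBasis n i))) • fderiv ℝ X x (stdBasis n j)

/-- The ambient (Levi-Civita) covariant derivative, in the direction `v`, of the vector field
`∂_w X` along `X`. -/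
def ambientCovDeriv (X : Euc n → Euc n × ℝ) (x v w : Euc n) : Euc n × ℝ :=
  fderiv ℝ (fun y => fderiv ℝ X y w) x v
    + christoffel ambientMetric (ambientBasis n) (X x) (fderiv ℝ X x v) (fderiv ℝ X x w)

/-- The second fundamental form: the normal part of the ambient covariant derivative. -/
def secondFundamentalForm (X : Euc n → Euc n × ℝ) (x v w : Euc n) : Euc n × ℝ :=
  normalPart X x (ambientCovDeriv X x v w)

/-- The normalized mean curvature vector: `1 / n` times the trace of the second fundamental form
with respect to the induced metric. -/
def paramMeanCurvatureVector (X : Euc n → Euc n × ℝ) (x : Euc n) : Euc n × ℝ :=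
  (1 / (n : ℝ)) • ∑ i, ∑ j, (gram (pullbackMetric X) (stdBasis n) x)⁻¹ i j •
    secondFundamentalForm X x (stdBasis n i) (stdBasis n j)

/-- `N` is the unit normal vector pointing upwards of the parametrized hypersurface `X` at `x`. -/
structure IsUpwardUnitNormal (X : Euc n → Euc n × ℝ) (x : Euc n) (N : Euc n × ℝ) : Prop where
  unit : ambientMetric (X x) N N = 1
  normal : ∀ v, ambientMetric (X x) N (fderiv ℝ X x v) = 0
  upward : 0 < ambientMetric (X x) N (verticalField n)

end Parametrized

/-! ### Riemannian manifolds -/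

section Manifold

variable {n : ℕ} {M : Type*} [TopologicalSpace M] [ChartedSpace (Euc n) M]
  [IsManifold (𝓡 n) ∞ M]

/-- Smooth Riemannian metrics on the `n`-manifold `M`. -/
abbrev SmoothMetric (n : ℕ) (M : Type*) [TopologicalSpace M] [ChartedSpace (Euc n) M]
    [IsManifold (𝓡 n) ∞ M] :=
  Bundle.ContMDiffRiemannianMetric (𝓡 n) ∞ (Euc n) (fun p : M => TangentSpace (𝓡 n) p)

/-- The expression of the metric `g` in the coordinates given by the chart `e`. -/
def metricInChart (g : SmoothMetric n M) (e : OpenPartialHomeomorph M (Euc n)) (x v w : Euc n) :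
    ℝ :=
  g.inner (e.symm x) (mfderiv (𝓡 n) (𝓡 n) e.symm x v) (mfderiv (𝓡 n) (𝓡 n) e.symm x w)

/-- The Laplacian of the Riemannian manifold `(M, g)` applied to `u`, at the point `p`. -/
def laplacian (g : SmoothMetric n M) (u : M → ℝ) (p : M) : ℝ :=
  coordLaplacian (metricInChart g (chartAt (Euc n) p)) (stdBasis n)
    (u ∘ (chartAt (Euc n) p).symm) (chartAt (Euc n) p p)

/-- The Riemannian measure of `(M, g)`: the smallest measure that dominates, for every smooth
chart, the measure `√(det g_{ij}) dx` on the domain of the chart. (On each chart domain these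
measures agree on overlaps, so that it restricts to `√(det g_{ij}) dx` there.) -/
def riemannianMeasure [MeasurableSpace M] (g : SmoothMetric n M) : Measure M :=
  ⨆ e ∈ IsManifold.maximalAtlas (𝓡 n) ∞ M,
    Measure.map e.symm ((volume.restrict e.target).withDensity fun x =>
      ENNReal.ofReal (Real.sqrt (gram (metricInChart g e) (stdBasis n) x).det))

section Domain

variable [NeZero n]

/-- `e` is a smooth chart of `M` in which the set `Ω` is the half-space `{x₀ ≥ 0}`. -/
structure IsDomainChart (Ω : Set M) (e : OpenPartialHomeomorph M (Euc n)) : Prop where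
  mem_maximalAtlas : e ∈ IsManifold.maximalAtlas (𝓡 n) ∞ M
  mem_iff : ∀ q ∈ e.source, q ∈ Ω ↔ 0 ≤ e q 0

/-- A compact domain (with smooth boundary) in the `n`-manifold `M`. -/
structure IsCompactDomain (n : ℕ) [NeZero n] {M : Type*} [TopologicalSpace M]
    [ChartedSpace (Euc n) M] [IsManifold (𝓡 n) ∞ M] (Ω : Set M) : Prop where
  isCompact : IsCompact Ω
  exists_chart : ∀ p ∈ frontier Ω,
    ∃ e : OpenPartialHomeomorph M (Euc n), p ∈ e.source ∧ IsDomainChart Ω e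

/-- The differential at `p` of the chart `e`: the components of a tangent vector in `e`. -/
def chartDifferential (e : OpenPartialHomeomorph M (Euc n)) (p : M) (v : TangentSpace (𝓡 n) p) :
    Euc n :=
  mfderiv (𝓡 n) (𝓡 n) e p v

/-- `v` is the inner unit normal at the boundary point `p` of the domain `Ω`: it has length one,
is orthogonal to the tangent space of the boundary, and points into `Ω`. -/
def IsInnerUnitNormal (g : SmoothMetric n M) (Ω : Set M) (p : M) (v : TangentSpace (𝓡 n) p) :
    Prop :=
  g.inner p v v = 1 ∧
    ∃ e : OpenPartialHomeomorph M (Euc n), p ∈ e.source ∧ IsDomainChart Ω e ∧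
      (∀ w : TangentSpace (𝓡 n) p, chartDifferential e p w 0 = 0 → g.inner p v w = 0) ∧
      0 < chartDifferential e p v 0

/-- The inclusion of the hyperplane `{x₀ = 0}` in `ℝⁿ`. -/
def hyperplaneIncl (y : {i : Fin n // i ≠ 0} → ℝ) : Euc n :=
  WithLp.toLp 2 fun i => if h : i ≠ 0 then y ⟨i, h⟩ else 0

/-- The Riemannian measure of the boundary of `Ω`, for the metric induced by `g`, as a measure on
`M`: the smallest measure that dominates, for every chart in which `Ω` is a half-space, the
measure `√(det (g_{ij})_{i, j ≠ 0}) dx` on the hyperplane `{x₀ = 0}`. -/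
def boundaryMeasure [MeasurableSpace M] (g : SmoothMetric n M) (Ω : Set M) : Measure M :=
  ⨆ (e : OpenPartialHomeomorph M (Euc n)) (_ : IsDomainChart Ω e),
    Measure.map (fun y => e.symm (hyperplaneIncl y))
      ((volume.restrict (hyperplaneIncl ⁻¹' e.target)).withDensity fun y =>
        ENNReal.ofReal (Real.sqrt
          ((gram (metricInChart g e) (stdBasis n) (hyperplaneIncl y)).submatrix
            (fun i : {i : Fin n // i ≠ 0} => (i : Fin n))
            (fun i : {i : Fin n // i ≠ 0} => (i : Fin n))).det))

end Domain

/-! ### Hypersurfaces of `ℍⁿ × ℝ` -/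

/-- `f` is a (smooth) isometric immersion of the Riemannian manifold `(M, g)` in `ℍⁿ × ℝ`.
(The differential of `f` is then injective at each point, `g` being positive definite.) -/
structure IsIsometricImmersion (g : SmoothMetric n M) (f : M → Euc n × ℝ) : Prop where
  contMDiff : ContMDiff (𝓡 n) 𝓘(ℝ, Euc n × ℝ) ∞ f
  mem_ball : ∀ p, ‖(f p).1‖ < 1
  isometric : ∀ (p : M) (v w : TangentSpace (𝓡 n) p),
    g.inner p v w = ambientMetric (f p) (mfderiv (𝓡 n) 𝓘(ℝ, Euc n × ℝ) f p v)
      (mfderiv (𝓡 n) 𝓘(ℝ, Euc n × ℝ) f p w)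

/-- The height function of the hypersurface. -/
def height (f : M → Euc n × ℝ) (p : M) : ℝ := (f p).2

/-- The normalized mean curvature vector of the immersed hypersurface at the point `p`. -/
def meanCurvatureVector (f : M → Euc n × ℝ) (p : M) : Euc n × ℝ :=
  paramMeanCurvatureVector (f ∘ (chartAt (Euc n) p).symm) (chartAt (Euc n) p p)

end Manifold

/-! ### Rotation hypersurfaces -/

/-- The rotation hypersurface about `{0} × ℝ` with generating curve `ρ ↦ (tanh (ρ / 2), λ(ρ))`,
written as a map of `y = ρ ξ`, where `ρ > 0` and `ξ` is a unit vector. -/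
def rotationParam {n : ℕ} (lam : ℝ → ℝ) (y : Euc n) : Euc n × ℝ :=
  ((Real.tanh (‖y‖ / 2) / ‖y‖) • y, lam ‖y‖)

theorem rotationParam_smul {n : ℕ} (lam : ℝ → ℝ) {ρ : ℝ} (hρ : 0 < ρ) {ξ : Euc n}
    (hξ : ‖ξ‖ = 1) : rotationParam lam (ρ • ξ) = (Real.tanh (ρ / 2) • ξ, lam ρ) := by
  have h : ‖ρ • ξ‖ = ρ := by rw [norm_smul, hξ, mul_one, Real.norm_of_nonneg hρ.le]
  unfold rotationParam
  rw [h, smul_smul, div_mul_cancel₀ _ hρ.ne']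

/-- The mean curvature, with respect to the unit normal pointing upwards, of the rotation
hypersurface with profile `lam` over the interval `J` is the constant `H`. -/
def HasConstantMeanCurvature (n : ℕ) (lam : ℝ → ℝ) (J : Set ℝ) (H : ℝ) : Prop :=
  ∀ ρ ∈ J, ∀ ξ : Euc n, ‖ξ‖ = 1 → ∀ N : Euc n × ℝ,
    IsUpwardUnitNormal (rotationParam lam) (ρ • ξ) N →
      ambientMetric (rotationParam lam (ρ • ξ))
        (paramMeanCurvatureVector (rotationParam lam) (ρ • ξ)) N = H

/-- The flux `sinh^{n-1}(ρ) λ'(ρ) (1 + λ'(ρ)²)^{-1/2}`. -/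
def profileFlux (n : ℕ) (lam : ℝ → ℝ) (ρ : ℝ) : ℝ :=
  Real.sinh ρ ^ (n - 1) * deriv lam ρ / Real.sqrt (1 + deriv lam ρ ^ 2)

end

end VerticalFlux

namespace VerticalFlux

noncomputable section

set_option maxSynthPendingDepth 3
set_option linter.unusedSectionVars false

section CoordinateCalculus

variable {ι : Type} [Fintype ι] [DecidableEq ι]
variable {E F : Type} [NormedAddCommGroup E] [NormedSpace ℝ E]
  [NormedAddCommGroup F] [NormedSpace ℝ F]

/-- A field of continuous bilinear forms, seen as a metric in coordinates. -/
def toMetric (B : E → E →L[ℝ] E →L[ℝ] ℝ) (y v w : E) : ℝ := B y v w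

/-- Symmetric and positive definite continuous bilinear forms. -/
structure IsInner (B : E →L[ℝ] E →L[ℝ] ℝ) : Prop where
  symm : ∀ v w, B v w = B w v
  pos : ∀ v, v ≠ 0 → 0 < B v v

lemma bilin_sum_smul (B : E →L[ℝ] E →L[ℝ] ℝ) (b : Module.Basis ι ℝ E) (c d : ι → ℝ) :
    B (∑ i, c i • b i) (∑ j, d j • b j) = ∑ i, ∑ j, c i * (B (b i) (b j) * d j) := by
  simp only [map_sum, sum_apply, map_smul, smul_apply,
    smul_eq_mul, Finset.mul_sum]
  rw [Finset.sum_comm]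
  exact Finset.sum_congr rfl fun i _ => Finset.sum_congr rfl fun j _ => by ring

lemma gram_toMetric_posDef {B : E → E →L[ℝ] E →L[ℝ] ℝ} {x : E} (h : IsInner (B x))
    (b : Module.Basis ι ℝ E) : (gram (toMetric B) b x).PosDef := by
  refine Matrix.PosDef.of_dotProduct_mulVec_pos ?_ ?_
  · ext i j
    simp [gram, toMetric, h.symm]
  · intro c hc
    have h0 : (∑ i, c i • b i) ≠ 0 := by
      intro h0
      exact hc (funext fun i => by
        simpa using (Fintype.linearIndependent_iff.1 b.linearIndependent) c h0 i)
    have := h.pos _ h0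
    rw [bilin_sum_smul] at this
    simpa [dotProduct, Matrix.mulVec, gram, toMetric, Finset.mul_sum] using this

lemma gram_toMetric_isUnit_det {B : E → E →L[ℝ] E →L[ℝ] ℝ} {x : E} (h : IsInner (B x))
    (b : Module.Basis ι ℝ E) : IsUnit (gram (toMetric B) b x).det :=
  (gram_toMetric_posDef h b).det_pos.ne'.isUnit

lemma gram_toMetric_transpose {B : E → E →L[ℝ] E →L[ℝ] ℝ} {x : E} (h : IsInner (B x))
    (b : Module.Basis ι ℝ E) : (gram (toMetric B) b x).transpose = gram (toMetric B) b x := by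
  ext i j
  simp [gram, toMetric, h.symm (b i)]

lemma gram_inv_symm {B : E → E →L[ℝ] E →L[ℝ] ℝ} {x : E} (h : IsInner (B x))
    (b : Module.Basis ι ℝ E) (i j : ι) :
    (gram (toMetric B) b x)⁻¹ i j = (gram (toMetric B) b x)⁻¹ j i := by
  conv_lhs => rw [← gram_toMetric_transpose h b, ← Matrix.transpose_nonsing_inv]
  rfl

/-- A vector is recovered from its products with a basis by raising indices. -/
lemma sum_inv_gram_smul {B : E → E →L[ℝ] E →L[ℝ] ℝ} {x : E} (h : IsInner (B x))
    (b : Module.Basis ι ℝ E) {z : E} {c : ι → ℝ} (hz : ∀ l, B x z (b l) = c l) :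
    ∑ k, (∑ l, (gram (toMetric B) b x)⁻¹ k l * c l) • b k = z := by
  have hc : c = (gram (toMetric B) b x).mulVec (b.repr z) := by
    ext l
    rw [← hz l]
    conv_lhs => rw [← b.sum_repr z]
    simp only [map_sum, sum_apply, map_smul, smul_apply,
      smul_eq_mul, Matrix.mulVec, dotProduct, gram, toMetric, Matrix.of_apply]
    exact Finset.sum_congr rfl fun i _ => by rw [h.symm (b i)]; ring
  have key : ∀ k, ∑ l, (gram (toMetric B) b x)⁻¹ k l * c l = b.repr z k := by
    intro k
    have : ((gram (toMetric B) b x)⁻¹.mulVec c) k = b.repr z k := by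
      rw [hc, Matrix.mulVec_mulVec, Matrix.nonsing_inv_mul _ (gram_toMetric_isUnit_det h b),
        Matrix.one_mulVec]
    exact this
  simp only [key]
  exact b.sum_repr z

lemma bilin_sum_inv_gram_smul {B : E → E →L[ℝ] E →L[ℝ] ℝ} {x : E} (h : IsInner (B x))
    (b : Module.Basis ι ℝ E) (c : ι → ℝ) (m : ι) :
    B x (∑ k, (∑ l, (gram (toMetric B) b x)⁻¹ k l * c l) • b k) (b m) = c m := by
  have : ((gram (toMetric B) b x).mulVec ((gram (toMetric B) b x)⁻¹.mulVec c)) m = c m := by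
    rw [Matrix.mulVec_mulVec, Matrix.mul_nonsing_inv _ (gram_toMetric_isUnit_det h b),
      Matrix.one_mulVec]
  rw [← this]
  simp only [map_sum, sum_apply, map_smul, smul_apply,
      smul_eq_mul, Matrix.mulVec, dotProduct]
  refine Finset.sum_congr rfl fun i _ => ?_
  rw [h.symm (b i)]
  simp only [gram, toMetric, Matrix.of_apply]
  ring

lemma hasFDerivAt_toMetric {B : E → E →L[ℝ] E →L[ℝ] ℝ} {x : E} (hB : DifferentiableAt ℝ B x)
    (v w : E) : HasFDerivAt (fun y => toMetric B y v w) (((fderiv ℝ B x).flip v).flip w) x := by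
  have := (hB.hasFDerivAt.clm_apply (hasFDerivAt_const v x)).clm_apply (hasFDerivAt_const w x)
  refine this.congr_fderiv ?_
  ext u
  simp

lemma christoffelFirst_toMetric {B : E → E →L[ℝ] E →L[ℝ] ℝ} {x : E}
    (hB : DifferentiableAt ℝ B x) (v w u : E) :
    christoffelFirst (toMetric B) x v w u =
      (1 / 2) * (fderiv ℝ B x v w u + fderiv ℝ B x w v u - fderiv ℝ B x u v w) := by
  simp only [christoffelFirst, (hasFDerivAt_toMetric hB _ _).fderiv,
    ContinuousLinearMap.flip_apply]

lemma bilin_christoffel_basis {B : E → E →L[ℝ] E →L[ℝ] ℝ} {x : E} (h : IsInner (B x))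
    (b : Module.Basis ι ℝ E) (v w : E) (m : ι) :
    B x (christoffel (toMetric B) b x v w) (b m) = christoffelFirst (toMetric B) x v w (b m) :=
  bilin_sum_inv_gram_smul h b _ m

lemma bilin_christoffel {B : E → E →L[ℝ] E →L[ℝ] ℝ} {x : E} (h : IsInner (B x))
    (hB : DifferentiableAt ℝ B x) (b : Module.Basis ι ℝ E) (v w u : E) :
    B x (christoffel (toMetric B) b x v w) u = christoffelFirst (toMetric B) x v w u := by
  have : (B x (christoffel (toMetric B) b x v w) : E →ₗ[ℝ] ℝ) =
      (1 / 2 : ℝ) • ((fderiv ℝ B x v w : E →ₗ[ℝ] ℝ) + (fderiv ℝ B x w v : E →ₗ[ℝ] ℝ)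
        - (((fderiv ℝ B x).flip v).flip w : E →ₗ[ℝ] ℝ)) := by
    refine b.ext fun m => ?_
    have := bilin_christoffel_basis h b v w m
    rw [christoffelFirst_toMetric hB] at this
    simpa using this
  have := congrArg (fun L => L u) this
  rw [christoffelFirst_toMetric hB]
  simpa using this

/-- The pull-back of a field of bilinear forms. -/
def pullForm (B : F → F →L[ℝ] F →L[ℝ] ℝ) (φ : E → F) (y : E) : E →L[ℝ] E →L[ℝ] ℝ :=
  ((ContinuousLinearMap.compL ℝ E F ℝ).flip (fderiv ℝ φ y)).comp ((B (φ y)).comp (fderiv ℝ φ y))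

lemma pullForm_apply (B : F → F →L[ℝ] F →L[ℝ] ℝ) (φ : E → F) (y v w : E) :
    pullForm B φ y v w = B (φ y) (fderiv ℝ φ y v) (fderiv ℝ φ y w) := by
  simp [pullForm]

lemma IsInner.pullForm {B : F → F →L[ℝ] F →L[ℝ] ℝ} {φ : E → F} {y : E} (h : IsInner (B (φ y)))
    (hφ : Function.Injective (fderiv ℝ φ y)) : IsInner (pullForm B φ y) where
  symm v w := by simp only [pullForm_apply, h.symm]
  pos v hv := by
    rw [pullForm_apply]
    exact h.pos _ ((map_ne_zero_iff _ hφ).2 hv)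

lemma contDiffAt_pullForm {k : ℕ∞ω} {B : F → F →L[ℝ] F →L[ℝ] ℝ} {φ : E → F} {x : E}
    (hB : ContDiffAt ℝ k B (φ x)) (hφ : ContDiffAt ℝ (k + 1) φ x) :
    ContDiffAt ℝ k (pullForm B φ) x := by
  have h1 : ContDiffAt ℝ k (fderiv ℝ φ) x := hφ.fderiv_right le_rfl
  have h2 : ContDiffAt ℝ k (fun y => B (φ y)) x := hB.comp x (hφ.of_le (by simp))
  exact ((ContinuousLinearMap.compL ℝ E F ℝ).flip.contDiff.contDiffAt.comp x h1).clm_comp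
    (h2.clm_comp h1)

lemma fderiv_fderiv_apply {φ : E → F} {x : E} (h : DifferentiableAt ℝ (fderiv ℝ φ) x) (v w : E) :
    fderiv ℝ (fun y => fderiv ℝ φ y w) x v = fderiv ℝ (fderiv ℝ φ) x v w := by
  have := (h.hasFDerivAt.clm_apply (hasFDerivAt_const w x)).fderiv
  rw [this]
  simp

lemma fderiv_toMetric_pullForm {B : F → F →L[ℝ] F →L[ℝ] ℝ} {φ : E → F} {x : E}
    (hB : DifferentiableAt ℝ B (φ x)) (hφ : ContDiffAt ℝ 2 φ x) (v w u : E) :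
    fderiv ℝ (fun y => toMetric (pullForm B φ) y w u) x v =
      fderiv ℝ B (φ x) (fderiv ℝ φ x v) (fderiv ℝ φ x w) (fderiv ℝ φ x u)
      + B (φ x) (fderiv ℝ (fderiv ℝ φ) x v w) (fderiv ℝ φ x u)
      + B (φ x) (fderiv ℝ φ x w) (fderiv ℝ (fderiv ℝ φ) x v u) := by
  have hd : DifferentiableAt ℝ (fderiv ℝ φ) x :=
    (hφ.fderiv_right (m := 1) (by norm_num)).differentiableAt one_ne_zero
  have h0 : DifferentiableAt ℝ φ x := hφ.differentiableAt two_ne_zero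
  have h1 : HasFDerivAt (fun y => B (φ y)) ((fderiv ℝ B (φ x)).comp (fderiv ℝ φ x)) x := by
    have := HasFDerivAt.comp (g := B) (g' := fderiv ℝ B (φ x)) x hB.hasFDerivAt h0.hasFDerivAt
    exact this
  have h2 := (h1.clm_apply (hd.hasFDerivAt.clm_apply (hasFDerivAt_const w x))).clm_apply
    (hd.hasFDerivAt.clm_apply (hasFDerivAt_const u x))
  have h3 : (fun y => toMetric (pullForm B φ) y w u) =
      fun y => B (φ y) (fderiv ℝ φ y w) (fderiv ℝ φ y u) := by
    funext y; exact pullForm_apply B φ y w u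
  rw [h3, h2.fderiv]
  simp
  ring

/-- The transformation rule of the Christoffel symbols of the first kind. -/
lemma christoffelFirst_pullForm {B : F → F →L[ℝ] F →L[ℝ] ℝ} {φ : E → F} {x : E}
    (hB : DifferentiableAt ℝ B (φ x)) (hs : ∀ v w, B (φ x) v w = B (φ x) w v)
    (hφ : ContDiffAt ℝ 2 φ x) (v w u : E) :
    christoffelFirst (toMetric (pullForm B φ)) x v w u =
      christoffelFirst (toMetric B) (φ x) (fderiv ℝ φ x v) (fderiv ℝ φ x w) (fderiv ℝ φ x u)
      + B (φ x) (fderiv ℝ (fderiv ℝ φ) x v w) (fderiv ℝ φ x u) := by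
  have hsym : ∀ v w, fderiv ℝ (fderiv ℝ φ) x v w = fderiv ℝ (fderiv ℝ φ) x w v :=
    fun v w => (hφ.isSymmSndFDerivAt (by simp)) v w
  rw [christoffelFirst_toMetric hB, christoffelFirst]
  simp only [fderiv_toMetric_pullForm hB hφ]
  rw [hsym w v, hsym u v, hsym u w, hs (fderiv ℝ φ x v) (fderiv ℝ (fderiv ℝ φ) x w u),
    hs (fderiv ℝ φ x w) (fderiv ℝ (fderiv ℝ φ) x v u)]
  ring

/-- The Hessian of `u`, in coordinates. -/
def coordHessian (g : E → E → E → ℝ) (b : Module.Basis ι ℝ E) (u : E → ℝ) (x v w : E) : ℝ :=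
  fderiv ℝ (fun y => fderiv ℝ u y w) x v - fderiv ℝ u x (christoffel g b x v w)

lemma coordLaplacian_eq (g : E → E → E → ℝ) (b : Module.Basis ι ℝ E) (u : E → ℝ) (x : E) :
    coordLaplacian g b u x = ∑ i, ∑ j, (gram g b x)⁻¹ i j * coordHessian g b u x (b i) (b j) :=
  rfl

variable {κ : Type} [Fintype κ] [DecidableEq κ]

lemma fderiv_christoffel_pullForm {B : F → F →L[ℝ] F →L[ℝ] ℝ} {φ : E → F} {x : E}
    (hB : DifferentiableAt ℝ B (φ x)) (h : IsInner (B (φ x))) (hφ : ContDiffAt ℝ 2 φ x)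
    (hbij : Function.Bijective (fderiv ℝ φ x))
    (b : Module.Basis ι ℝ E) (b' : Module.Basis κ ℝ F) (v w : E) :
    fderiv ℝ φ x (christoffel (toMetric (pullForm B φ)) b x v w) =
      christoffel (toMetric B) b' (φ x) (fderiv ℝ φ x v) (fderiv ℝ φ x w)
      + fderiv ℝ (fderiv ℝ φ) x v w := by
  obtain ⟨z, hz⟩ := hbij.2 (christoffel (toMetric B) b' (φ x) (fderiv ℝ φ x v) (fderiv ℝ φ x w)
      + fderiv ℝ (fderiv ℝ φ) x v w)
  rw [← hz]
  congr 1
  refine sum_inv_gram_smul (h.pullForm hbij.1) b fun l => ?_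
  rw [pullForm_apply, hz, christoffelFirst_pullForm hB h.symm hφ, map_add,
    add_apply, bilin_christoffel h hB]

lemma coordHessian_pullForm {B : F → F →L[ℝ] F →L[ℝ] ℝ} {φ : E → F} {x : E} {u : F → ℝ}
    (hB : DifferentiableAt ℝ B (φ x)) (h : IsInner (B (φ x))) (hφ : ContDiffAt ℝ 2 φ x)
    (hbij : Function.Bijective (fderiv ℝ φ x)) (hu : ContDiffAt ℝ 2 u (φ x))
    (b : Module.Basis ι ℝ E) (b' : Module.Basis κ ℝ F) (v w : E) :
    coordHessian (toMetric (pullForm B φ)) b (u ∘ φ) x v w =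
      coordHessian (toMetric B) b' u (φ x) (fderiv ℝ φ x v) (fderiv ℝ φ x w) := by
  have hd : DifferentiableAt ℝ (fderiv ℝ φ) x :=
    (hφ.fderiv_right (m := 1) (by norm_num)).differentiableAt one_ne_zero
  have hdu : DifferentiableAt ℝ (fderiv ℝ u) (φ x) :=
    (hu.fderiv_right (m := 1) (by norm_num)).differentiableAt one_ne_zero
  have h0 : DifferentiableAt ℝ φ x := hφ.differentiableAt two_ne_zero
  have hu0 : DifferentiableAt ℝ u (φ x) := hu.differentiableAt two_ne_zero
  have hev : (fun y => fderiv ℝ (u ∘ φ) y w) =ᶠ[nhds x]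
      fun y => fderiv ℝ u (φ y) (fderiv ℝ φ y w) := by
    have e1 : ∀ᶠ y in nhds x, ContDiffAt ℝ 1 φ y :=
      (hφ.of_le (by norm_num)).eventually (by simp)
    have e2 : ∀ᶠ y in nhds (φ x), ContDiffAt ℝ 1 u y :=
      (hu.of_le (by norm_num)).eventually (by simp)
    filter_upwards [e1, h0.continuousAt.eventually e2] with y hy1 hy2
    rw [fderiv_comp y (hy2.differentiableAt one_ne_zero) (hy1.differentiableAt one_ne_zero)]
    rfl
  have h1 : HasFDerivAt (fun y => fderiv ℝ u (φ y))
      ((fderiv ℝ (fderiv ℝ u) (φ x)).comp (fderiv ℝ φ x)) x :=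
    hdu.hasFDerivAt.comp x h0.hasFDerivAt
  have h2 := h1.clm_apply (hd.hasFDerivAt.clm_apply (hasFDerivAt_const w x))
  unfold coordHessian
  rw [hev.fderiv_eq, h2.fderiv, fderiv_comp x hu0 h0, ContinuousLinearMap.comp_apply,
    fderiv_christoffel_pullForm hB h hφ hbij b b', fderiv_fderiv_apply hdu]
  simp
  ring

lemma coordHessian_isBilin {B : E → E →L[ℝ] E →L[ℝ] ℝ} {x : E} {u : E → ℝ}
    (hB : DifferentiableAt ℝ B x) (hu : ContDiffAt ℝ 2 u x) (b : Module.Basis ι ℝ E) :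
    ∃ T : E →ₗ[ℝ] E →ₗ[ℝ] ℝ, ∀ v w, T v w = coordHessian (toMetric B) b u x v w := by
  have hdu : DifferentiableAt ℝ (fderiv ℝ u) x :=
    (hu.fderiv_right (m := 1) (by norm_num)).differentiableAt one_ne_zero
  obtain ⟨K, hK, h1, h2, h3, h4⟩ : ∃ K : E → E → E → ℝ,
      (∀ v w, christoffel (toMetric B) b x v w =
        ∑ k, (∑ l, (gram (toMetric B) b x)⁻¹ k l * K v w (b l)) • b k) ∧
      (∀ v v' w u, K (v + v') w u = K v w u + K v' w u) ∧
      (∀ (c : ℝ) v w u, K (c • v) w u = c * K v w u) ∧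
      (∀ v w w' u, K v (w + w') u = K v w u + K v w' u) ∧
      (∀ (c : ℝ) v w u, K v (c • w) u = c * K v w u) := by
    refine ⟨fun v w u =>
      (1 / 2) * (fderiv ℝ B x v w u + fderiv ℝ B x w v u - fderiv ℝ B x u v w), ?_, ?_, ?_, ?_, ?_⟩
    · simp only [christoffel, christoffelFirst_toMetric hB, implies_true]
    all_goals
      intros
      simp only [map_add, map_smul, add_apply, smul_apply, smul_eq_mul]
      ring
  have hH : ∀ v w, coordHessian (toMetric B) b u x v w =
      fderiv ℝ (fderiv ℝ u) x v w - fderiv ℝ u x (christoffel (toMetric B) b x v w) := fun v w => by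
    rw [coordHessian, fderiv_fderiv_apply hdu]
  refine ⟨LinearMap.mk₂ ℝ (coordHessian (toMetric B) b u x) ?_ ?_ ?_ ?_, fun v w => rfl⟩
  · intro v v' w
    simp only [hH, hK, h1, mul_add, Finset.sum_add_distrib,
      add_smul, map_add, add_apply]
    ring
  · intro c v w
    simp only [hH, hK, h2, mul_left_comm _ c, ← Finset.mul_sum,
      mul_smul, ← Finset.smul_sum, map_smul, smul_apply, smul_eq_mul, mul_sub]
  · intro v w w'
    simp only [hH, hK, h3, mul_add, Finset.sum_add_distrib,
      add_smul, map_add]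
    ring
  · intro c v w
    simp only [hH, hK, h4, mul_left_comm _ c, ← Finset.mul_sum,
      mul_smul, ← Finset.smul_sum, map_smul, smul_eq_mul, mul_sub]

/-- The trace of a bilinear form with respect to a metric does not depend on the coordinates. -/
lemma sum_inv_gram_pullForm {B : F → F →L[ℝ] F →L[ℝ] ℝ} {φ : E → F} {x : E}
    (h : IsInner (B (φ x))) (hbij : Function.Bijective (fderiv ℝ φ x))
    (b : Module.Basis ι ℝ E) (b' : Module.Basis ι ℝ F) (T : F →ₗ[ℝ] F →ₗ[ℝ] ℝ) :
    ∑ i, ∑ j, (gram (toMetric (pullForm B φ)) b x)⁻¹ i j *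
        T (fderiv ℝ φ x (b i)) (fderiv ℝ φ x (b j)) =
      ∑ i, ∑ j, (gram (toMetric B) b' (φ x))⁻¹ i j * T (b' i) (b' j) := by
  set M := LinearMap.toMatrix b b' (fderiv ℝ φ x : E →ₗ[ℝ] F) with hM
  set G' := gram (toMetric (pullForm B φ)) b x with hG'
  set G := gram (toMetric B) b' (φ x) with hG
  have hA : ∀ i, fderiv ℝ φ x (b i) = ∑ k, M k i • b' k := by
    intro i
    conv_lhs => rw [← b'.sum_repr (fderiv ℝ φ x (b i))]
    simp [hM, LinearMap.toMatrix_apply]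
  have hGG : G' = M.transpose * G * M := by
    ext i j
    simp only [hG', gram, toMetric, Matrix.of_apply, pullForm_apply, hA, bilin_sum_smul,
      Matrix.mul_apply, Matrix.transpose_apply, hG, Finset.sum_mul]
    rw [Finset.sum_comm]
    exact Finset.sum_congr rfl fun i _ => Finset.sum_congr rfl fun j _ => by ring
  have hdet : IsUnit M.det := by
    have h1 : IsUnit G'.det := gram_toMetric_isUnit_det (h.pullForm hbij.1) b
    rw [hGG, Matrix.det_mul] at h1
    exact isUnit_of_mul_isUnit_right h1
  have hinv : M * G'⁻¹ * M.transpose = G⁻¹ := by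
    rw [hGG, Matrix.mul_inv_rev, Matrix.mul_inv_rev, ← Matrix.mul_assoc, ← Matrix.mul_assoc,
      Matrix.mul_nonsing_inv _ hdet, Matrix.one_mul, Matrix.mul_assoc,
      Matrix.nonsing_inv_mul _ (by rwa [Matrix.det_transpose]), Matrix.mul_one]
  rw [← hinv]
  simp only [hA, map_sum, LinearMap.sum_apply, map_smul, LinearMap.smul_apply, smul_eq_mul,
    Matrix.mul_apply, Matrix.transpose_apply, Finset.mul_sum, Finset.sum_mul]
  calc _ = ∑ i, ∑ j, ∑ k, ∑ l, M k i * G'⁻¹ i j * M l j * T (b' k) (b' l) := by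
        refine Finset.sum_congr rfl fun i _ => Finset.sum_congr rfl fun j _ => ?_
        rw [Finset.sum_comm]
        exact Finset.sum_congr rfl fun k _ => Finset.sum_congr rfl fun l _ => by ring
    _ = ∑ p : ι × ι, ∑ q : ι × ι, M q.1 p.1 * G'⁻¹ p.1 p.2 * M q.2 p.2 * T (b' q.1) (b' q.2) := by
        simp only [Fintype.sum_prod_type]
    _ = ∑ k, ∑ l, ∑ i, ∑ j, M k i * G'⁻¹ i j * M l j * T (b' k) (b' l) := by
        rw [Finset.sum_comm]
        simp only [Fintype.sum_prod_type]
    _ = _ := by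
        refine Finset.sum_congr rfl fun k _ => Finset.sum_congr rfl fun l _ => ?_
        rw [Finset.sum_comm]

/-- The Laplacian does not depend on the coordinates. -/
theorem coordLaplacian_pullForm {B : F → F →L[ℝ] F →L[ℝ] ℝ} {φ : E → F} {x : E} {u : F → ℝ}
    (hB : DifferentiableAt ℝ B (φ x)) (h : IsInner (B (φ x))) (hφ : ContDiffAt ℝ 2 φ x)
    (hbij : Function.Bijective (fderiv ℝ φ x)) (hu : ContDiffAt ℝ 2 u (φ x))
    (b : Module.Basis ι ℝ E) (b' : Module.Basis ι ℝ F) :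
    coordLaplacian (toMetric (pullForm B φ)) b (u ∘ φ) x =
      coordLaplacian (toMetric B) b' u (φ x) := by
  obtain ⟨T, hT⟩ := coordHessian_isBilin hB hu b'
  simp only [coordLaplacian_eq, coordHessian_pullForm hB h hφ hbij hu b b', ← hT]
  exact sum_inv_gram_pullForm h hbij b b' T

end CoordinateCalculus

section MatrixDerivatives

variable {ι : Type} [Fintype ι] [DecidableEq ι]
variable {E : Type} [NormedAddCommGroup E] [NormedSpace ℝ E]

/-- The entrywise derivative of a matrix-valued function in the direction `v`. -/
def matrixDeriv (M : E → Matrix ι ι ℝ) (x v : E) : Matrix ι ι ℝ :=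
  Matrix.of fun i j => fderiv ℝ (fun y => M y i j) x v

lemma hasFDerivAt_det {M : E → Matrix ι ι ℝ} {x : E}
    (hM : ∀ i j, DifferentiableAt ℝ (fun y => M y i j) x) :
    HasFDerivAt (fun y => (M y).det)
      (∑ σ : Equiv.Perm ι, (Equiv.Perm.sign σ : ℤ) • ∑ i, (∏ j ∈ Finset.univ.erase i, M x (σ j) j) •
        fderiv ℝ (fun y => M y (σ i) i) x) x := by
  simp only [Matrix.det_apply]
  refine HasFDerivAt.fun_sum fun σ _ => ?_
  have h := HasFDerivAt.finsetProd (u := Finset.univ) (x := x) (g := fun i y => M y (σ i) i)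
    (fun i _ => (hM (σ i) i).hasFDerivAt)
  have h2 := h.const_smul ((Equiv.Perm.sign σ : ℤ) : ℝ)
  convert h2 using 1
  · ext y
    simp [Units.smul_def]
  · ext y
    simp

/-- Jacobi's formula. -/
lemma fderiv_det {M : E → Matrix ι ι ℝ} {x : E}
    (hM : ∀ i j, DifferentiableAt ℝ (fun y => M y i j) x) (v : E) :
    fderiv ℝ (fun y => (M y).det) x v = ((M x).adjugate * matrixDeriv M x v).trace := by
  rw [(hasFDerivAt_det hM).fderiv]
  have h1 : ((M x).adjugate * matrixDeriv M x v).trace =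
      ∑ i, ((M x).updateCol i (fun k => matrixDeriv M x v k i)).det := by
    rw [Matrix.trace]
    refine Finset.sum_congr rfl fun i _ => ?_
    rw [← Matrix.cramer_apply, Matrix.cramer_eq_adjugate_mulVec]
    rfl
  rw [h1]
  simp only [Matrix.det_apply, sum_apply, smul_apply, Finset.smul_sum]
  rw [Finset.sum_comm]
  refine Finset.sum_congr rfl fun i _ => Finset.sum_congr rfl fun σ _ => ?_
  rw [Units.smul_def, ← Finset.mul_prod_erase _ _ (Finset.mem_univ i), Matrix.updateCol_self]
  congr 1
  rw [smul_eq_mul, mul_comm]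
  congr 1
  refine Finset.prod_congr rfl fun j hj => ?_
  rw [Matrix.updateCol_ne (Finset.ne_of_mem_erase hj)]

lemma contDiffAt_det {k : ℕ∞ω} {M : E → Matrix ι ι ℝ} {x : E}
    (hM : ∀ i j, ContDiffAt ℝ k (fun y => M y i j) x) :
    ContDiffAt ℝ k (fun y => (M y).det) x := by
  simp only [Matrix.det_apply]
  refine ContDiffAt.sum fun σ _ => ?_
  simp only [Units.smul_def, ← Int.cast_smul_eq_zsmul ℝ]
  exact ContDiffAt.const_smul _ (contDiffAt_prod fun i _ => hM _ _)

lemma contDiffAt_inv_apply {k : ℕ∞ω} {M : E → Matrix ι ι ℝ} {x : E}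
    (hM : ∀ i j, ContDiffAt ℝ k (fun y => M y i j) x) (hx : (M x).det ≠ 0) (i j : ι) :
    ContDiffAt ℝ k (fun y => (M y)⁻¹ i j) x := by
  have : (fun y => (M y)⁻¹ i j) =
      fun y => ((M y).det)⁻¹ * ((M y).updateRow j (Pi.single i 1)).det := by
    funext y
    rw [Matrix.inv_def, Matrix.smul_apply, Ring.inverse_eq_inv', Matrix.adjugate_apply, smul_eq_mul]
  rw [this]
  refine ((contDiffAt_det hM).inv hx).mul (contDiffAt_det fun a c => ?_)
  by_cases h : a = j
  · subst h
    simpa using contDiffAt_const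
  · simpa [Matrix.updateRow_ne h] using hM a c

lemma fderiv_inv_apply {M : E → Matrix ι ι ℝ} {x : E}
    (hM : ∀ i j, ContDiffAt ℝ 1 (fun y => M y i j) x) (hx : (M x).det ≠ 0) (v : E) :
    matrixDeriv (fun y => (M y)⁻¹) x v = - ((M x)⁻¹ * matrixDeriv M x v * (M x)⁻¹) := by
  have hM1 : ∀ i j, DifferentiableAt ℝ (fun y => M y i j) x :=
    fun i j => (hM i j).differentiableAt one_ne_zero
  have hN1 : ∀ i j, DifferentiableAt ℝ (fun y => (M y)⁻¹ i j) x :=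
    fun i j => (contDiffAt_inv_apply hM hx i j).differentiableAt one_ne_zero
  have key : matrixDeriv M x v * (M x)⁻¹ + M x * matrixDeriv (fun y => (M y)⁻¹) x v = 0 := by
    ext i j
    have h1 : (fun y => ∑ k, M y i k * (M y)⁻¹ k j) =ᶠ[nhds x] fun _ => (1 : Matrix ι ι ℝ) i j := by
      have : ∀ᶠ y in nhds x, (M y).det ≠ 0 :=
        (contDiffAt_det hM).continuousAt.eventually_ne hx
      filter_upwards [this] with y hy
      rw [← Matrix.mul_apply, Matrix.mul_nonsing_inv _ hy.isUnit]
    have h2 := h1.fderiv_eq (𝕜 := ℝ)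
    have h3 : HasFDerivAt (fun y => ∑ k, M y i k * (M y)⁻¹ k j) _ x :=
      HasFDerivAt.fun_sum fun k _ => (hM1 i k).hasFDerivAt.mul (hN1 k j).hasFDerivAt
    rw [h3.fderiv] at h2
    have h4 := congrArg (fun L => L v) h2
    simp only [fderiv_fun_const, sum_apply, add_apply, smul_apply, smul_eq_mul, Pi.zero_apply,
      zero_apply] at h4
    rw [Matrix.add_apply, Matrix.mul_apply, Matrix.mul_apply, ← Finset.sum_add_distrib,
      Matrix.zero_apply, ← h4]
    refine Finset.sum_congr rfl fun k _ => ?_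
    simp only [matrixDeriv, Matrix.of_apply]
    ring
  have h5 := congrArg (fun A => (M x)⁻¹ * A) key
  simp only [Matrix.mul_add, Matrix.mul_zero, ← Matrix.mul_assoc,
    Matrix.nonsing_inv_mul _ hx.isUnit, Matrix.one_mul] at h5
  exact eq_neg_of_add_eq_zero_right h5

lemma fderiv_sqrt_det {M : E → Matrix ι ι ℝ} {x : E}
    (hM : ∀ i j, ContDiffAt ℝ 1 (fun y => M y i j) x) (hx : 0 < (M x).det) (v : E) :
    fderiv ℝ (fun y => √(M y).det) x v =
      √(M x).det * ((1 / 2) * ((M x)⁻¹ * matrixDeriv M x v).trace) := by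
  have hM1 : ∀ i j, DifferentiableAt ℝ (fun y => M y i j) x :=
    fun i j => (hM i j).differentiableAt one_ne_zero
  have h1 := (hasFDerivAt_det hM1).differentiableAt.hasFDerivAt.sqrt hx.ne'
  rw [h1.fderiv, smul_apply, fderiv_det hM1]
  have h2 : (M x).adjugate = (M x).det • (M x)⁻¹ := by
    rw [Matrix.inv_def, smul_smul, Ring.inverse_eq_inv', mul_inv_cancel₀ hx.ne', one_smul]
  rw [h2, Matrix.smul_mul, Matrix.trace_smul, smul_eq_mul, smul_eq_mul]
  have h3 : √(M x).det * √(M x).det = (M x).det := Real.mul_self_sqrt hx.le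
  have h4 : √(M x).det ≠ 0 := (Real.sqrt_pos.2 hx).ne'
  field_simp
  rw [sq, h3]

end MatrixDerivatives

section DivergenceForm

variable {ι : Type} [Fintype ι] [DecidableEq ι]
variable {E : Type} [NormedAddCommGroup E] [NormedSpace ℝ E]

/-- The `i`-th component of `√(det g) • grad u` in coordinates. -/
def densityGradient (g : E → E → E → ℝ) (b : Module.Basis ι ℝ E) (u : E → ℝ) (i : ι) (x : E) : ℝ :=
  √(gram g b x).det * ∑ j, (gram g b x)⁻¹ i j * fderiv ℝ u x (b j)

lemma contDiffAt_gram {k : ℕ∞ω} {B : E → E →L[ℝ] E →L[ℝ] ℝ} {x : E} (hB : ContDiffAt ℝ k B x)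
    (b : Module.Basis ι ℝ E) (i j : ι) :
    ContDiffAt ℝ k (fun y => gram (toMetric B) b y i j) x :=
  (hB.clm_apply contDiffAt_const).clm_apply contDiffAt_const

lemma contDiffAt_sqrt_det_gram {k : ℕ∞ω} {B : E → E →L[ℝ] E →L[ℝ] ℝ} {x : E} (h : IsInner (B x))
    (hB : ContDiffAt ℝ k B x) (b : Module.Basis ι ℝ E) :
    ContDiffAt ℝ k (fun y => √(gram (toMetric B) b y).det) x :=
  (contDiffAt_det (contDiffAt_gram hB b)).sqrt (gram_toMetric_posDef h b).det_pos.ne'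

lemma contDiffAt_densityGradient {k : ℕ∞ω} {B : E → E →L[ℝ] E →L[ℝ] ℝ} {x : E} {u : E → ℝ}
    (h : IsInner (B x)) (hB : ContDiffAt ℝ k B x) (hu : ContDiffAt ℝ (k + 1) u x)
    (b : Module.Basis ι ℝ E) (i : ι) :
    ContDiffAt ℝ k (densityGradient (toMetric B) b u i) x :=
  (contDiffAt_sqrt_det_gram h hB b).mul <| ContDiffAt.sum fun j _ =>
    (contDiffAt_inv_apply (contDiffAt_gram hB b) (gram_toMetric_posDef h b).det_pos.ne' i j).mul
      ((hu.fderiv_right le_rfl).clm_apply contDiffAt_const)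

/-- The Laplacian in divergence form. -/
theorem sum_fderiv_densityGradient {B : E → E →L[ℝ] E →L[ℝ] ℝ} {x : E} {u : E → ℝ}
    (h : IsInner (B x)) (hB : ContDiffAt ℝ 1 B x) (hu : ContDiffAt ℝ 2 u x)
    (b : Module.Basis ι ℝ E) :
    ∑ i, fderiv ℝ (densityGradient (toMetric B) b u i) x (b i) =
      coordLaplacian (toMetric B) b u x * √(gram (toMetric B) b x).det := by
  have hdu : DifferentiableAt ℝ (fderiv ℝ u) x :=
    (hu.fderiv_right (m := 1) (by norm_num)).differentiableAt one_ne_zero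
  have hB1 : DifferentiableAt ℝ B x := hB.differentiableAt one_ne_zero
  have hpos := (gram_toMetric_posDef h b).det_pos
  have hM := contDiffAt_gram hB b
  set G := gram (toMetric B) b x with hG
  set N := G⁻¹ with hN
  have hNs : ∀ i j, N i j = N j i := gram_inv_symm h b
  set D : ι → ι → ι → ℝ := fun i j k => fderiv ℝ B x (b i) (b j) (b k) with hD
  have hmd : ∀ i, matrixDeriv (gram (toMetric B) b) x (b i) = Matrix.of (D i) := by
    intro i
    ext j k
    simp only [matrixDeriv, gram, Matrix.of_apply, (hasFDerivAt_toMetric hB1 _ _).fderiv, hD,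
      ContinuousLinearMap.flip_apply]
  set s := √G.det with hs
  set p : ι → ℝ := fun j => fderiv ℝ u x (b j) with hp
  have hterm : ∀ i, fderiv ℝ (densityGradient (toMetric B) b u i) x (b i) =
      s * (∑ j, N i j * fderiv ℝ (fderiv ℝ u) x (b i) (b j)
        - ∑ j, (∑ k, ∑ l, N i k * D i k l * N l j) * p j
        + (1 / 2) * (∑ k, ∑ l, N k l * D i l k) * ∑ j, N i j * p j) := by
    intro i
    have h1 := ((contDiffAt_sqrt_det_gram h hB b).differentiableAt one_ne_zero).hasFDerivAt
    have h2 : ∀ j, HasFDerivAt (fun y => (gram (toMetric B) b y)⁻¹ i j * fderiv ℝ u y (b j)) _ x :=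
      fun j => (((contDiffAt_inv_apply hM hpos.ne' i j).differentiableAt
        one_ne_zero).hasFDerivAt).mul (hdu.hasFDerivAt.clm_apply (hasFDerivAt_const (b j) x))
    have h3 := h1.mul (HasFDerivAt.fun_sum (u := Finset.univ) fun j _ => h2 j)
    have h4 : fderiv ℝ (densityGradient (toMetric B) b u i) x = _ := h3.fderiv
    rw [h4]
    have h5 : ∀ j, fderiv ℝ (fun y => (gram (toMetric B) b y)⁻¹ i j) x (b i) =
        - ∑ k, ∑ l, N i k * D i k l * N l j := by
      intro j
      have := congrFun (congrFun (fderiv_inv_apply hM hpos.ne' (b i)) i) j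
      rw [hmd] at this
      refine this.trans ?_
      simp only [Matrix.neg_apply, Matrix.mul_apply, Matrix.of_apply, Finset.sum_mul]
      rw [Finset.sum_comm]
    simp only [add_apply, smul_apply, sum_apply, smul_eq_mul, fderiv_sqrt_det hM hpos, h5, hmd,
      ContinuousLinearMap.comp_apply, ContinuousLinearMap.flip_apply, zero_apply, map_zero, zero_add]
    rw [← hG, ← hN, ← hs, Matrix.trace]
    have hpj : ∀ j, fderiv ℝ u x (b j) = p j := fun _ => rfl
    simp only [Matrix.diag, Matrix.mul_apply, Matrix.of_apply, hpj, mul_comm (p _), neg_mul,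
      Finset.sum_add_distrib, Finset.sum_neg_distrib]
    ring
  have hG2 : ∀ i j, fderiv ℝ u x (christoffel (toMetric B) b x (b i) (b j)) =
      ∑ k, (∑ l, N k l * ((1 / 2) * (D i j l + D j i l - D l i j))) * p k := by
    intro i j
    simp only [christoffel, map_sum, map_smul, smul_eq_mul, christoffelFirst_toMetric hB1, hp, hD]
    rfl
  have e1 : ∑ i, ∑ j, (∑ k, ∑ l, N i k * D i k l * N l j) * p j =
      ∑ i, ∑ j, ∑ k, ∑ l, N i j * N k l * D i j l * p k := by
    refine Finset.sum_congr rfl fun i _ => ?_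
    simp only [Finset.sum_mul]
    rw [Finset.sum_comm]
    refine Finset.sum_congr rfl fun j _ => Finset.sum_congr rfl fun k _ =>
      Finset.sum_congr rfl fun l _ => ?_
    rw [hNs l k]
    ring
  have e2 : ∑ i, (∑ k, ∑ l, N k l * D i l k) * ∑ j, N i j * p j =
      ∑ i, ∑ j, ∑ k, ∑ l, N i j * N k l * D l i j * p k := by
    have r : ∀ i, (∑ k, ∑ l, N k l * D i l k) * ∑ j, N i j * p j =
        ∑ k, ∑ l, ∑ j, N l k * N j i * D i l k * p j := by
      intro i
      rw [Finset.sum_mul]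
      refine Finset.sum_congr rfl fun k _ => ?_
      rw [Finset.sum_mul]
      refine Finset.sum_congr rfl fun l _ => ?_
      rw [Finset.mul_sum]
      refine Finset.sum_congr rfl fun j _ => ?_
      rw [hNs l k, hNs j i]
      ring
    simp only [r]
    rw [Finset.sum_comm]
    rw [Finset.sum_comm (f := fun i j => ∑ k, ∑ l, N i j * N k l * D l i j * p k)]
    refine Finset.sum_congr rfl fun j _ => ?_
    rw [Finset.sum_comm]
    refine Finset.sum_congr rfl fun i _ => ?_
    rw [Finset.sum_comm]
  have e3 : ∑ i, ∑ j, N i j * ∑ k, (∑ l, N k l * ((1 / 2) * (D i j l + D j i l - D l i j))) * p k =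
      (1 / 2) * (∑ i, ∑ j, ∑ k, ∑ l, N i j * N k l * D i j l * p k)
      + (1 / 2) * (∑ i, ∑ j, ∑ k, ∑ l, N i j * N k l * D i j l * p k)
      - (1 / 2) * (∑ i, ∑ j, ∑ k, ∑ l, N i j * N k l * D l i j * p k) := by
    have r : ∑ i, ∑ j, ∑ k, ∑ l, N i j * N k l * D i j l * p k =
        ∑ i, ∑ j, ∑ k, ∑ l, N i j * N k l * D j i l * p k := by
      rw [Finset.sum_comm]
      refine Finset.sum_congr rfl fun i _ => Finset.sum_congr rfl fun j _ => ?_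
      rw [hNs j i]
    conv_rhs =>
      arg 1
      arg 2
      rw [r]
    simp only [Finset.mul_sum, Finset.sum_mul, ← Finset.sum_add_distrib, ← Finset.sum_sub_distrib]
    refine Finset.sum_congr rfl fun i _ => Finset.sum_congr rfl fun j _ =>
      Finset.sum_congr rfl fun k _ => Finset.sum_congr rfl fun l _ => ?_
    ring
  rw [coordLaplacian, ← hG, ← hN]
  simp only [hterm, fderiv_fderiv_apply hdu, hG2, mul_sub (N _ _), Finset.sum_sub_distrib]
  rw [e3, ← Finset.mul_sum, Finset.sum_add_distrib, Finset.sum_sub_distrib, e1]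
  simp only [mul_assoc (1 / 2 : ℝ)]
  rw [← Finset.mul_sum, e2]
  ring

end DivergenceForm

section Ambient

variable {n : ℕ}

/-- The Euclidean inner product. -/
def innerForm (n : ℕ) : Euc n →L[ℝ] Euc n →L[ℝ] ℝ := innerSL ℝ

/-- The ambient metric as a field of continuous bilinear forms. -/
def ambientForm (p : Euc n × ℝ) : (Euc n × ℝ) →L[ℝ] (Euc n × ℝ) →L[ℝ] ℝ :=
  (4 / (1 - ‖p.1‖ ^ 2) ^ 2) • (innerForm n).bilinearComp
      (ContinuousLinearMap.fst ℝ (Euc n) ℝ) (ContinuousLinearMap.fst ℝ (Euc n) ℝ)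
    + (ContinuousLinearMap.mul ℝ ℝ).bilinearComp
      (ContinuousLinearMap.snd ℝ (Euc n) ℝ) (ContinuousLinearMap.snd ℝ (Euc n) ℝ)

lemma ambientForm_apply (p v w : Euc n × ℝ) : ambientForm p v w = ambientMetric p v w := by
  simp only [ambientForm, ambientMetric, innerForm, add_apply, smul_apply,
    ContinuousLinearMap.bilinearComp_apply, ContinuousLinearMap.coe_fst', ContinuousLinearMap.coe_snd',
    smul_eq_mul, ContinuousLinearMap.mul_apply']
  rfl

lemma toMetric_ambientForm : toMetric (ambientForm (n := n)) = ambientMetric := by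
  funext p v w
  exact ambientForm_apply p v w

lemma pullbackMetric_eq (X : Euc n → Euc n × ℝ) :
    pullbackMetric X = toMetric (pullForm ambientForm X) := by
  funext x v w
  rw [toMetric, pullForm_apply, ambientForm_apply, pullbackMetric]

lemma isInner_ambientForm {p : Euc n × ℝ} (hp : ‖p.1‖ < 1) : IsInner (ambientForm p) where
  symm v w := by
    simp only [ambientForm_apply, ambientMetric, real_inner_comm, mul_comm v.2]
  pos v hv := by
    have h1 : 0 < 1 - ‖p.1‖ ^ 2 := by nlinarith [norm_nonneg p.1]
    have h2 : 0 < 4 / (1 - ‖p.1‖ ^ 2) ^ 2 := by positivity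
    rw [ambientForm_apply, ambientMetric, real_inner_self_eq_norm_sq]
    by_cases h : v.1 = 0
    · have h3 : v.2 ≠ 0 := fun h3 => hv (Prod.ext h h3)
      have := mul_self_pos.2 h3
      positivity
    · have := norm_pos_iff.2 h
      have := mul_self_nonneg v.2
      positivity

lemma contDiffAt_ambientForm {p : Euc n × ℝ} (hp : ‖p.1‖ < 1) (k : ℕ∞ω) :
    ContDiffAt ℝ k (ambientForm (n := n)) p := by
  have h1 : (1 - ‖p.1‖ ^ 2) ^ 2 ≠ 0 := by
    have : 0 < 1 - ‖p.1‖ ^ 2 := by nlinarith [norm_nonneg p.1]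
    positivity
  have h2 : ContDiffAt ℝ k (fun p : Euc n × ℝ => 4 / (1 - ‖p.1‖ ^ 2) ^ 2) p :=
    contDiffAt_const.div ((contDiffAt_const.sub (contDiffAt_fst.norm_sq ℝ)).pow 2) h1
  exact (h2.smul contDiffAt_const).add contDiffAt_const

lemma christoffelFirst_ambient_vertical {p : Euc n × ℝ} (hp : ‖p.1‖ < 1) (v w : Euc n × ℝ) :
    christoffelFirst ambientMetric p v w (verticalField n) = 0 := by
  have h1 : ∀ w : Euc n × ℝ, (fun y => ambientMetric y w (verticalField n)) = fun _ => w.2 := by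
    intro w
    funext y
    simp [ambientMetric, verticalField]
  have h2 : fderiv ℝ (fun y => ambientMetric y v w) p (verticalField n) = 0 := by
    have hB : DifferentiableAt ℝ (ambientForm (n := n)) p :=
      (contDiffAt_ambientForm hp 1).differentiableAt one_ne_zero
    have hd : DifferentiableAt ℝ (fun y => ambientMetric y v w) p := by
      rw [← toMetric_ambientForm]
      exact (hasFDerivAt_toMetric hB v w).differentiableAt
    have := hd.lineDeriv_eq_fderiv (v := verticalField n)
    rw [← this, lineDeriv]
    simp [ambientMetric, verticalField]
  simp [christoffelFirst, h1, h2]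

lemma ambientMetric_vertical (p z : Euc n × ℝ) : ambientMetric p z (verticalField n) = z.2 := by
  simp [ambientMetric, verticalField]

lemma christoffel_ambient_snd {p : Euc n × ℝ} (hp : ‖p.1‖ < 1) (v w : Euc n × ℝ) :
    (christoffel ambientMetric (ambientBasis n) p v w).2 = 0 := by
  have hB : DifferentiableAt ℝ (ambientForm (n := n)) p :=
    (contDiffAt_ambientForm hp 1).differentiableAt one_ne_zero
  have := bilin_christoffel (isInner_ambientForm hp) hB (ambientBasis n) v w (verticalField n)
  rw [toMetric_ambientForm, christoffelFirst_ambient_vertical hp, ambientForm_apply,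
    ambientMetric_vertical] at this
  exact this

lemma isInner_pullForm_ambient {X : Euc n → Euc n × ℝ} {x : Euc n} (hx : ‖(X x).1‖ < 1)
    (hinj : Function.Injective (fderiv ℝ X x)) : IsInner (pullForm ambientForm X x) :=
  (isInner_ambientForm hx).pullForm hinj

lemma normalPart_eq {X : Euc n → Euc n × ℝ} {x : Euc n} (hx : ‖(X x).1‖ < 1)
    (hinj : Function.Injective (fderiv ℝ X x)) (z : Euc n × ℝ) :
    normalPart X x z = z - fderiv ℝ X x (∑ k, (∑ l, (gram (pullbackMetric X) (stdBasis n) x)⁻¹ k l *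
      ambientMetric (X x) z (fderiv ℝ X x (stdBasis n l))) • stdBasis n k) := by
  rw [normalPart, Finset.sum_comm, map_sum]
  congr 1
  refine Finset.sum_congr rfl fun k _ => ?_
  rw [map_smul, Finset.sum_smul]
  refine Finset.sum_congr rfl fun l _ => ?_
  rw [pullbackMetric_eq, gram_inv_symm (isInner_pullForm_ambient hx hinj)]

lemma ambientMetric_normalPart {X : Euc n → Euc n × ℝ} {x : Euc n} (hx : ‖(X x).1‖ < 1)
    (hinj : Function.Injective (fderiv ℝ X x)) (z : Euc n × ℝ) (v : Euc n) :
    ambientForm (X x) (normalPart X x z) (fderiv ℝ X x v) = 0 := by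
  have key : ((ambientForm (X x) (normalPart X x z)).comp (fderiv ℝ X x) : Euc n →ₗ[ℝ] ℝ) = 0 := by
    refine (stdBasis n).ext fun m => ?_
    have := bilin_sum_inv_gram_smul (isInner_pullForm_ambient hx hinj) (stdBasis n)
      (fun l => ambientMetric (X x) z (fderiv ℝ X x (stdBasis n l))) m
    rw [pullForm_apply, ← pullbackMetric_eq] at this
    simp only [ContinuousLinearMap.coe_coe, ContinuousLinearMap.comp_apply, normalPart_eq hx hinj,
      map_sub, sub_apply, this, ambientForm_apply, sub_self, LinearMap.zero_apply]
  exact congrArg (fun L => L v) key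

lemma ambientMetric_meanCurvature {X : Euc n → Euc n × ℝ} {x : Euc n} (hx : ‖(X x).1‖ < 1)
    (hinj : Function.Injective (fderiv ℝ X x)) (v : Euc n) :
    ambientMetric (X x) (paramMeanCurvatureVector X x) (fderiv ℝ X x v) = 0 := by
  rw [← ambientForm_apply, paramMeanCurvatureVector]
  simp only [map_smul, map_sum, smul_apply, sum_apply, secondFundamentalForm,
    ambientMetric_normalPart hx hinj, smul_zero, Finset.sum_const_zero]

lemma secondFundamentalForm_eq {X : Euc n → Euc n × ℝ} {x : Euc n} (hx : ‖(X x).1‖ < 1)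
    (hinj : Function.Injective (fderiv ℝ X x)) (hX : ContDiffAt ℝ 2 X x) (v w : Euc n) :
    secondFundamentalForm X x v w = ambientCovDeriv X x v w
      - fderiv ℝ X x (christoffel (pullbackMetric X) (stdBasis n) x v w) := by
  have hB : DifferentiableAt ℝ (ambientForm (n := n)) (X x) :=
    (contDiffAt_ambientForm hx 1).differentiableAt one_ne_zero
  have hd : DifferentiableAt ℝ (fderiv ℝ X) x :=
    (hX.fderiv_right (m := 1) (by norm_num)).differentiableAt one_ne_zero
  have hin := isInner_ambientForm hx
  rw [secondFundamentalForm, normalPart_eq hx hinj, christoffel]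
  congr 2
  refine Finset.sum_congr rfl fun k _ => ?_
  congr 1
  refine Finset.sum_congr rfl fun l _ => ?_
  congr 1
  rw [pullbackMetric_eq, christoffelFirst_pullForm hB hin.symm hX, ambientCovDeriv,
    ← bilin_christoffel hin hB (ambientBasis n), fderiv_fderiv_apply hd, ← ambientForm_apply,
    map_add, add_apply, toMetric_ambientForm, add_comm]

/-- The Laplacian of the height of a parametrized hypersurface. -/
theorem coordLaplacian_height [NeZero n] {X : Euc n → Euc n × ℝ} {x : Euc n}
    (hx : ‖(X x).1‖ < 1) (hinj : Function.Injective (fderiv ℝ X x)) (hX : ContDiffAt ℝ 2 X x) :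
    coordLaplacian (pullbackMetric X) (stdBasis n) (fun y => (X y).2) x =
      n * ambientMetric (X x) (paramMeanCurvatureVector X x) (verticalField n) := by
  have hd : DifferentiableAt ℝ (fderiv ℝ X) x :=
    (hX.fderiv_right (m := 1) (by norm_num)).differentiableAt one_ne_zero
  have hev : ∀ᶠ y in nhds x, ∀ w, fderiv ℝ (fun y => (X y).2) y w = (fderiv ℝ X y w).2 := by
    have : ∀ᶠ y in nhds x, ContDiffAt ℝ 1 X y := (hX.of_le (by norm_num)).eventually (by simp)
    filter_upwards [this] with y hy w
    rw [(hy.differentiableAt one_ne_zero).hasFDerivAt.snd.fderiv]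
    rfl
  have h2 : ∀ v w, fderiv ℝ (fun y => fderiv ℝ (fun y => (X y).2) y w) x v =
      (fderiv ℝ (fun y => fderiv ℝ X y w) x v).2 := by
    intro v w
    have : (fun y => fderiv ℝ (fun y => (X y).2) y w) =ᶠ[nhds x] fun y => (fderiv ℝ X y w).2 :=
      hev.mono fun y hy => hy w
    rw [this.fderiv_eq]
    have := (hd.hasFDerivAt.clm_apply (hasFDerivAt_const w x))
    rw [this.snd.fderiv, this.fderiv]
    rfl
  have hn : (n : ℝ) ≠ 0 := Nat.cast_ne_zero.2 (NeZero.ne n)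
  rw [ambientMetric_vertical, paramMeanCurvatureVector, Prod.smul_snd, smul_eq_mul, ← mul_assoc,
    mul_one_div_cancel hn, one_mul, coordLaplacian, Prod.snd_sum]
  refine Finset.sum_congr rfl fun i _ => ?_
  rw [Prod.snd_sum]
  refine Finset.sum_congr rfl fun j _ => ?_
  rw [Prod.smul_snd, smul_eq_mul, secondFundamentalForm_eq hx hinj hX, ambientCovDeriv,
    Prod.snd_sub, Prod.snd_add, christoffel_ambient_snd hx, add_zero, h2, hev.self_of_nhds]

end Ambient

section Rotation

variable {n : ℕ}

lemma tanh_sq_lt_one (x : ℝ) : Real.tanh x ^ 2 < 1 := by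
  have h := Real.cosh_sq x
  have hc := Real.cosh_pos x
  rw [Real.tanh_eq_sinh_div_cosh, div_pow, div_lt_one (by positivity)]
  linarith

lemma hasDerivAt_tanh_half (ρ : ℝ) :
    HasDerivAt (fun r => Real.tanh (r / 2)) ((1 - Real.tanh (ρ / 2) ^ 2) / 2) ρ := by
  have hc := (Real.cosh_pos (ρ / 2)).ne'
  have h2 : HasDerivAt (fun r : ℝ => r / 2) (1 / 2) ρ := (hasDerivAt_id ρ).div_const 2
  have h := h2.sinh.div h2.cosh hc
  have h3 : (fun r => Real.tanh (r / 2)) =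
      (fun r => Real.sinh (r / 2)) / fun r => Real.cosh (r / 2) := by
    funext r
    exact Real.tanh_eq_sinh_div_cosh _
  rw [h3]
  refine h.congr_deriv ?_
  rw [Real.tanh_eq_sinh_div_cosh]
  have := Real.cosh_sq (ρ / 2)
  field_simp

lemma sinh_mul_one_sub_tanh_half_sq (ρ : ℝ) :
    Real.sinh ρ * (1 - Real.tanh (ρ / 2) ^ 2) = 2 * Real.tanh (ρ / 2) := by
  have hc := (Real.cosh_pos (ρ / 2)).ne'
  have h := Real.cosh_sq (ρ / 2)
  have h1 : Real.sinh ρ = 2 * Real.sinh (ρ / 2) * Real.cosh (ρ / 2) := by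
    rw [← Real.sinh_two_mul]; ring_nf
  rw [h1, Real.tanh_eq_sinh_div_cosh]
  field_simp
  rw [h]
  ring

lemma hasFDerivAt_norm_of_ne {y : Euc n} (hy : y ≠ 0) :
    HasFDerivAt (fun y : Euc n => ‖y‖) (‖y‖⁻¹ • (innerSL ℝ y : Euc n →L[ℝ] ℝ)) y := by
  have h1 := ((hasFDerivAt_id y).norm_sq).sqrt (by simpa using hy)
  have h2 : (fun y : Euc n => √(‖id y‖ ^ 2)) = fun y => ‖y‖ := by
    funext z
    simp
  rw [h2] at h1
  refine h1.congr_fderiv ?_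
  ext v
  simp
  ring

lemma contDiffAt_rotationParam {lam : ℝ → ℝ} {y : Euc n} (hy : y ≠ 0)
    (hl : ContDiffAt ℝ 2 lam ‖y‖) : ContDiffAt ℝ 2 (rotationParam lam) y := by
  have hn : ContDiffAt ℝ 2 (fun y : Euc n => ‖y‖) y := contDiffAt_norm ℝ hy
  have ht : ContDiff ℝ 2 Real.tanh := by
    have : Real.tanh = fun x => Real.sinh x / Real.cosh x := by
      funext x; exact Real.tanh_eq_sinh_div_cosh x
    rw [this]
    exact Real.contDiff_sinh.div Real.contDiff_cosh fun x => (Real.cosh_pos x).ne'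
  exact ((((ht.contDiffAt.comp y (hn.div_const 2)).div hn (norm_ne_zero_iff.2 hy)).smul
    contDiffAt_id).prodMk (hl.comp y hn))

/-- The differential of the rotation hypersurface. -/
lemma fderiv_rotationParam {lam : ℝ → ℝ} {y : Euc n} {l : ℝ} (hy : y ≠ 0)
    (hl : HasDerivAt lam l ‖y‖) (v : Euc n) :
    fderiv ℝ (rotationParam lam) y v =
      ((((1 - Real.tanh (‖y‖ / 2) ^ 2) / 2 - Real.tanh (‖y‖ / 2) / ‖y‖) / ‖y‖
          * (inner ℝ y v / ‖y‖)) • y + (Real.tanh (‖y‖ / 2) / ‖y‖) • v,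
        l * (inner ℝ y v / ‖y‖)) := by
  have hn := hasFDerivAt_norm_of_ne hy
  have hρ : ‖y‖ ≠ 0 := norm_ne_zero_iff.2 hy
  have hq : HasDerivAt (fun r => Real.tanh (r / 2) / r)
      (((1 - Real.tanh (‖y‖ / 2) ^ 2) / 2 - Real.tanh (‖y‖ / 2) / ‖y‖) / ‖y‖) ‖y‖ := by
    refine ((hasDerivAt_tanh_half ‖y‖).div (hasDerivAt_id ‖y‖) hρ).congr_deriv ?_
    simp only [id]
    field_simp
  have h1 := (hq.comp_hasFDerivAt y hn).smul (hasFDerivAt_id y)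
  have h2 := h1.prodMk (hl.comp_hasFDerivAt y hn)
  have h3 : HasFDerivAt (rotationParam lam) _ y := h2
  rw [h3.fderiv]
  refine Prod.ext ?_ ?_
  · simp
    rw [add_comm]
    congr 2
    field_simp
  · simp only [ContinuousLinearMap.prod_apply, smul_apply, innerSL_apply_apply, smul_eq_mul]
    ring

lemma norm_rotationParam_fst (lam : ℝ → ℝ) {y : Euc n} (hy : y ≠ 0) :
    ‖(rotationParam lam y).1‖ ^ 2 = Real.tanh (‖y‖ / 2) ^ 2 := by
  have hρ : ‖y‖ ≠ 0 := norm_ne_zero_iff.2 hy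
  simp only [rotationParam, norm_smul, Real.norm_eq_abs, mul_pow, sq_abs]
  field_simp

lemma norm_rotationParam_fst_lt (lam : ℝ → ℝ) {y : Euc n} (hy : y ≠ 0) :
    ‖(rotationParam lam y).1‖ < 1 := by
  have := norm_rotationParam_fst lam hy
  have h2 := tanh_sq_lt_one (‖y‖ / 2)
  nlinarith [norm_nonneg (rotationParam lam y).1]

/-- The metric of the rotation hypersurface in the coordinates `y = ρ ξ`. -/
lemma pullbackMetric_rotationParam {lam : ℝ → ℝ} {y : Euc n} {l : ℝ} (hy : y ≠ 0)
    (hl : HasDerivAt lam l ‖y‖) (v w : Euc n) :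
    pullbackMetric (rotationParam lam) y v w =
      (Real.sinh ‖y‖ / ‖y‖) ^ 2 * inner ℝ v w + (1 + l ^ 2 - (Real.sinh ‖y‖ / ‖y‖) ^ 2) *
        ((inner ℝ y v / ‖y‖) * (inner ℝ y w / ‖y‖)) := by
  have hρ : ‖y‖ ≠ 0 := norm_ne_zero_iff.2 hy
  have ht := tanh_sq_lt_one (‖y‖ / 2)
  have hs : Real.sinh ‖y‖ = 2 * Real.tanh (‖y‖ / 2) / (1 - Real.tanh (‖y‖ / 2) ^ 2) := by
    rw [← sinh_mul_one_sub_tanh_half_sq, mul_div_cancel_right₀ _ (by linarith)]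
  have hd : 1 - Real.tanh (‖y‖ / 2) ^ 2 ≠ 0 := by linarith
  rw [pullbackMetric, ambientMetric, norm_rotationParam_fst lam hy, fderiv_rotationParam hy hl,
    fderiv_rotationParam hy hl, hs]
  simp only [inner_add_left, inner_add_right, inner_smul_left, inner_smul_right,
    real_inner_self_eq_norm_sq, RCLike.conj_to_real, real_inner_comm y v]
  set t := Real.tanh (‖y‖ / 2)
  set ρ := ‖y‖
  field_simp
  ring

lemma injective_fderiv_rotationParam {lam : ℝ → ℝ} {y : Euc n} {l : ℝ} (hy : y ≠ 0)
    (hl : HasDerivAt lam l ‖y‖) : Function.Injective (fderiv ℝ (rotationParam lam) y) := by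
  have hρ : 0 < ‖y‖ := norm_pos_iff.2 hy
  have hs : 0 < Real.sinh ‖y‖ := Real.sinh_pos_iff.2 hρ
  refine (injective_iff_map_eq_zero _).2 fun v hv => ?_
  have h1 := pullbackMetric_rotationParam hy hl v v
  have h0 : pullbackMetric (rotationParam lam) y v v = 0 := by
    rw [pullbackMetric, hv]
    simp [ambientMetric]
  rw [h0, real_inner_self_eq_norm_sq] at h1
  have hc : 0 < (Real.sinh ‖y‖ / ‖y‖) ^ 2 := by positivity
  set s := inner ℝ y v / ‖y‖
  have h2 : s * s ≤ ‖v‖ ^ 2 := by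
    have h3 := abs_real_inner_le_norm y v
    have h4 : |s| ≤ ‖v‖ := by
      rw [abs_div, abs_of_pos hρ, div_le_iff₀ hρ]
      linarith
    rw [← abs_mul_abs_self]
    nlinarith [abs_nonneg s]
  have h5 : s * s = 0 := by nlinarith [mul_self_nonneg s, mul_nonneg (sq_nonneg l) (mul_self_nonneg s)]
  rw [h5] at h1
  have h6 : ‖v‖ ^ 2 = 0 := by
    rcases mul_eq_zero.1 (by linarith : (Real.sinh ‖y‖ / ‖y‖) ^ 2 * ‖v‖ ^ 2 = 0) with h | h
    · exact absurd h hc.ne'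
    · exact h
  simpa using h6

lemma stdBasis_inner (y : Euc n) (i : Fin n) : inner ℝ y (stdBasis n i) = y i := by
  simp [stdBasis, EuclideanSpace.inner_single_right]

lemma gram_rotationParam {lam : ℝ → ℝ} {y : Euc n} {l : ℝ} (hy : y ≠ 0)
    (hl : HasDerivAt lam l ‖y‖) :
    gram (pullbackMetric (rotationParam lam)) (stdBasis n) y =
      (Real.sinh ‖y‖ / ‖y‖) ^ 2 • (1 : Matrix (Fin n) (Fin n) ℝ) +
        ((1 + l ^ 2 - (Real.sinh ‖y‖ / ‖y‖) ^ 2) / ‖y‖ ^ 2) • Matrix.vecMulVec y y := by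
  have hρ : ‖y‖ ≠ 0 := norm_ne_zero_iff.2 hy
  ext i j
  rw [gram, Matrix.of_apply, pullbackMetric_rotationParam hy hl, stdBasis_inner, stdBasis_inner,
    stdBasis_inner]
  simp only [Matrix.add_apply, Matrix.smul_apply, smul_eq_mul, Matrix.vecMulVec_apply]
  congr 1
  · congr 1
    simp [stdBasis, Matrix.one_apply, eq_comm]
  · field_simp

lemma sum_sq_eq_norm_sq (y : Euc n) : ∑ i, y i * y i = ‖y‖ ^ 2 := by
  rw [EuclideanSpace.norm_sq_eq]
  exact Finset.sum_congr rfl fun i _ => by rw [Real.norm_eq_abs, sq_abs, sq]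

lemma sqrt_det_gram_rotationParam [NeZero n] {lam : ℝ → ℝ} {y : Euc n} {l : ℝ} (hy : y ≠ 0)
    (hl : HasDerivAt lam l ‖y‖) :
    √(gram (pullbackMetric (rotationParam lam)) (stdBasis n) y).det =
      (Real.sinh ‖y‖ / ‖y‖) ^ (n - 1) * √(1 + l ^ 2) := by
  have hρ : 0 < ‖y‖ := norm_pos_iff.2 hy
  have hs : 0 < Real.sinh ‖y‖ := Real.sinh_pos_iff.2 hρ
  have hc : 0 < Real.sinh ‖y‖ / ‖y‖ := by positivity
  set c := Real.sinh ‖y‖ / ‖y‖ with hcd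
  have h1 : gram (pullbackMetric (rotationParam lam)) (stdBasis n) y =
      c ^ 2 • (1 + Matrix.replicateCol Unit ((((1 + l ^ 2 - c ^ 2) / ‖y‖ ^ 2) / c ^ 2) • (y : Fin n → ℝ))
        * Matrix.replicateRow Unit (y : Fin n → ℝ)) := by
    rw [gram_rotationParam hy hl, smul_add, ← hcd]
    congr 1
    ext i j
    simp only [Matrix.smul_apply, Matrix.vecMulVec_apply, Matrix.mul_apply,
      Matrix.replicateCol_apply, Matrix.replicateRow_apply, Finset.univ_unique, Finset.sum_singleton,
      Pi.smul_apply, smul_eq_mul]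
    field_simp
  have h2 : (gram (pullbackMetric (rotationParam lam)) (stdBasis n) y).det =
      (c ^ (n - 1)) ^ 2 * (1 + l ^ 2) := by
    rw [h1, Matrix.det_smul, Matrix.det_one_add_replicateCol_mul_replicateRow, Fintype.card_fin,
      dotProduct_smul]
    have : (y : Fin n → ℝ) ⬝ᵥ (y : Fin n → ℝ) = ‖y‖ ^ 2 := sum_sq_eq_norm_sq y
    rw [this]
    obtain ⟨m, rfl⟩ := Nat.exists_eq_succ_of_ne_zero (NeZero.ne n)
    simp only [Nat.succ_eq_add_one, Nat.add_sub_cancel, smul_eq_mul]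
    field_simp
    ring
  rw [h2, Real.sqrt_mul (by positivity), Real.sqrt_sq (by positivity)]

lemma densityGradient_rotationParam [NeZero n] {lam : ℝ → ℝ} {y : Euc n} (hy : y ≠ 0)
    (hl : DifferentiableAt ℝ lam ‖y‖) (i : Fin n) :
    densityGradient (pullbackMetric (rotationParam lam)) (stdBasis n)
      (fun y => (rotationParam lam y).2) i y = profileFlux n lam ‖y‖ / ‖y‖ ^ n * y i := by
  have hl' := hl.hasDerivAt
  set l := deriv lam ‖y‖ with hld
  have hρ : 0 < ‖y‖ := norm_pos_iff.2 hy
  have hs : 0 < Real.sinh ‖y‖ := Real.sinh_pos_iff.2 hρ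
  have ha : 0 < 1 + l ^ 2 := by positivity
  have hdet : IsUnit (gram (pullbackMetric (rotationParam lam)) (stdBasis n) y).det := by
    rw [pullbackMetric_eq]
    exact gram_toMetric_isUnit_det (isInner_pullForm_ambient (norm_rotationParam_fst_lt lam hy)
      (injective_fderiv_rotationParam hy hl')) _
  have h1 : ∀ j, fderiv ℝ (fun y : Euc n => (rotationParam lam y).2) y (stdBasis n j) =
      l / ‖y‖ * y j := by
    intro j
    have := (hl'.comp_hasFDerivAt y (hasFDerivAt_norm_of_ne hy)).fderiv
    have h3 : (fun y : Euc n => (rotationParam lam y).2) = lam ∘ fun y : Euc n => ‖y‖ := rfl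
    rw [h3, this]
    simp only [smul_apply, smul_eq_mul]
    have h4 : (innerSL ℝ y : Euc n →L[ℝ] ℝ) (stdBasis n j) = y j := stdBasis_inner y j
    rw [h4]
    ring
  have h2 : (gram (pullbackMetric (rotationParam lam)) (stdBasis n) y)⁻¹.mulVec y =
      (1 + l ^ 2)⁻¹ • (y : Fin n → ℝ) := by
    have h3 : (gram (pullbackMetric (rotationParam lam)) (stdBasis n) y).mulVec y =
        (1 + l ^ 2) • (y : Fin n → ℝ) := by
      rw [gram_rotationParam hy hl', Matrix.add_mulVec, Matrix.smul_mulVec, Matrix.smul_mulVec,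
        Matrix.one_mulVec, Matrix.vecMulVec_mulVec]
      have : (y : Fin n → ℝ) ⬝ᵥ (y : Fin n → ℝ) = ‖y‖ ^ 2 := sum_sq_eq_norm_sq y
      rw [this]
      ext i
      simp
      field_simp
      ring
    have h4 := congrArg (fun z => (1 + l ^ 2)⁻¹ •
      (gram (pullbackMetric (rotationParam lam)) (stdBasis n) y)⁻¹.mulVec z) h3
    simp only [Matrix.mulVec_mulVec, Matrix.nonsing_inv_mul _ hdet, Matrix.one_mulVec,
      Matrix.mulVec_smul] at h4
    rw [smul_smul, inv_mul_cancel₀ ha.ne', one_smul] at h4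
    exact h4.symm
  have h3 : ∑ j, (gram (pullbackMetric (rotationParam lam)) (stdBasis n) y)⁻¹ i j * y j =
      (1 + l ^ 2)⁻¹ * y i := congrFun h2 i
  rw [densityGradient, sqrt_det_gram_rotationParam hy hl']
  simp only [h1, mul_left_comm _ (l / ‖y‖), ← Finset.mul_sum]
  rw [h3, profileFlux, ← hld]
  have hsq : √(1 + l ^ 2) * √(1 + l ^ 2) = 1 + l ^ 2 := Real.mul_self_sqrt ha.le
  have hsp : 0 < √(1 + l ^ 2) := Real.sqrt_pos.2 ha
  obtain ⟨m, rfl⟩ := Nat.exists_eq_succ_of_ne_zero (NeZero.ne n)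
  simp only [Nat.succ_eq_add_one, Nat.add_sub_cancel]
  rw [show (1 + l ^ 2)⁻¹ = (√(1 + l ^ 2) * √(1 + l ^ 2))⁻¹ by rw [hsq], div_pow]
  field_simp
  ring

end Rotation

section RotationFlux

variable {n : ℕ}

lemma sum_fderiv_radial {k : ℝ → ℝ} {k' : ℝ} {y : Euc n} (hy : y ≠ 0) (hk : HasDerivAt k k' ‖y‖) :
    ∑ i, fderiv ℝ (fun z : Euc n => k ‖z‖ * z i) y (stdBasis n i) = k' * ‖y‖ + n * k ‖y‖ := by
  have hρ : ‖y‖ ≠ 0 := norm_ne_zero_iff.2 hy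
  have h1 : ∀ i, fderiv ℝ (fun z : Euc n => k ‖z‖ * z i) y (stdBasis n i) =
      k ‖y‖ + k' / ‖y‖ * (y i * y i) := by
    intro i
    have h2 := hk.comp_hasFDerivAt y (hasFDerivAt_norm_of_ne hy)
    have h3 : HasFDerivAt (fun z : Euc n => z i) (EuclideanSpace.proj i : Euc n →L[ℝ] ℝ) y :=
      (EuclideanSpace.proj i : Euc n →L[ℝ] ℝ).hasFDerivAt
    have h4 : HasFDerivAt (fun z : Euc n => k ‖z‖ * z i) _ y := h2.mul h3
    have h5 : (innerSL ℝ y : Euc n →L[ℝ] ℝ) (stdBasis n i) = y i := stdBasis_inner y i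
    have h6 : (EuclideanSpace.proj i : Euc n →L[ℝ] ℝ) (stdBasis n i) = 1 := by simp [stdBasis]
    rw [h4.fderiv]
    simp only [add_apply, smul_apply, smul_eq_mul, h5, h6, Function.comp_apply]
    ring
  simp only [h1, Finset.sum_add_distrib, ← Finset.mul_sum, sum_sq_eq_norm_sq]
  simp
  field_simp
  ring

lemma hasDerivAt_profileFlux_vertical [NeZero n] {lam : ℝ → ℝ} {y : Euc n} (hy : y ≠ 0)
    (hl : ContDiffAt ℝ 2 lam ‖y‖) :
    HasDerivAt (profileFlux n lam)
      (n * ambientMetric (rotationParam lam y) (paramMeanCurvatureVector (rotationParam lam) y)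
        (verticalField n) * √(1 + deriv lam ‖y‖ ^ 2) * Real.sinh ‖y‖ ^ (n - 1)) ‖y‖ := by
  have hρ : 0 < ‖y‖ := norm_pos_iff.2 hy
  have hl1 : DifferentiableAt ℝ lam ‖y‖ := hl.differentiableAt two_ne_zero
  have hl' := hl1.hasDerivAt
  have hdl : DifferentiableAt ℝ (deriv lam) ‖y‖ := by
    have h1 : DifferentiableAt ℝ (fderiv ℝ lam) ‖y‖ :=
      (hl.fderiv_right (m := 1) (by norm_num)).differentiableAt one_ne_zero
    have h2 : DifferentiableAt ℝ (fun r => fderiv ℝ lam r 1) ‖y‖ :=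
      h1.clm_apply (differentiableAt_const _)
    simpa only [fderiv_apply_one_eq_deriv] using h2
  have hΦ : DifferentiableAt ℝ (profileFlux n lam) ‖y‖ := by
    have ha : 1 + deriv lam ‖y‖ ^ 2 ≠ 0 := by positivity
    have h1 : DifferentiableAt ℝ (fun r => √(1 + deriv lam r ^ 2)) ‖y‖ :=
      ((hdl.pow 2).const_add 1).sqrt ha
    exact (((Real.differentiable_sinh _).pow _).mul hdl).div h1
      (Real.sqrt_ne_zero'.2 (by positivity))
  have hx := norm_rotationParam_fst_lt lam hy
  have hinj := injective_fderiv_rotationParam hy hl'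
  have hX := contDiffAt_rotationParam hy hl
  have hB : ContDiffAt ℝ 1 (pullForm ambientForm (rotationParam lam)) y :=
    contDiffAt_pullForm (contDiffAt_ambientForm hx 1) (hX.of_le (by norm_num))
  have hdiv := sum_fderiv_densityGradient (isInner_pullForm_ambient hx hinj) hB hX.snd (stdBasis n)
  rw [← pullbackMetric_eq, coordLaplacian_height hx hinj hX, sqrt_det_gram_rotationParam hy hl']
    at hdiv
  have hev : ∀ᶠ z : Euc n in nhds y, z ≠ 0 ∧ DifferentiableAt ℝ lam ‖z‖ := by
    have h1 : ∀ᶠ r in nhds ‖y‖, DifferentiableAt ℝ lam r :=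
      ((hl.of_le (m := 1) (by norm_num)).eventually (by simp)).mono fun r hr =>
        hr.differentiableAt one_ne_zero
    exact (continuousAt_id.eventually_ne hy).and (continuous_norm.continuousAt.eventually h1)
  have hk : HasDerivAt (fun r => profileFlux n lam r / r ^ n)
      ((deriv (profileFlux n lam) ‖y‖ * ‖y‖ ^ n - profileFlux n lam ‖y‖ * (n * ‖y‖ ^ (n - 1)))
        / (‖y‖ ^ n) ^ 2) ‖y‖ :=
    hΦ.hasDerivAt.div (hasDerivAt_pow n ‖y‖) (by positivity)
  have hdg : ∀ i, fderiv ℝ (densityGradient (pullbackMetric (rotationParam lam)) (stdBasis n)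
      (fun y => (rotationParam lam y).2) i) y =
      fderiv ℝ (fun z : Euc n => profileFlux n lam ‖z‖ / ‖z‖ ^ n * z i) y := fun i =>
    Filter.EventuallyEq.fderiv_eq
      (hev.mono fun z hz => densityGradient_rotationParam hz.1 hz.2 i)
  simp only [hdg] at hdiv
  rw [sum_fderiv_radial hy hk] at hdiv
  refine hΦ.hasDerivAt.congr_deriv ?_
  obtain ⟨m, rfl⟩ := Nat.exists_eq_succ_of_ne_zero (NeZero.ne n)
  simp only [Nat.succ_eq_add_one, Nat.add_sub_cancel] at hdiv ⊢
  rw [div_pow] at hdiv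
  field_simp at hdiv
  have hp : ‖y‖ ^ (m + (m + 2)) ≠ 0 := by positivity
  apply mul_left_cancel₀ hp
  linear_combination hdiv

/-- The upward unit normal of the rotation hypersurface. -/
def rotationNormal (lam : ℝ → ℝ) (y : Euc n) : Euc n × ℝ :=
  (-(deriv lam ‖y‖ * ((1 - Real.tanh (‖y‖ / 2) ^ 2) / 2) / (‖y‖ * √(1 + deriv lam ‖y‖ ^ 2))) • y,
    1 / √(1 + deriv lam ‖y‖ ^ 2))

lemma isUpwardUnitNormal_rotationNormal {lam : ℝ → ℝ} {y : Euc n} (hy : y ≠ 0)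
    (hl : DifferentiableAt ℝ lam ‖y‖) :
    IsUpwardUnitNormal (rotationParam lam) y (rotationNormal lam y) := by
  have hρ : ‖y‖ ≠ 0 := norm_ne_zero_iff.2 hy
  have ht := tanh_sq_lt_one (‖y‖ / 2)
  have hd : 1 - Real.tanh (‖y‖ / 2) ^ 2 ≠ 0 := by linarith
  have ha : 0 < 1 + deriv lam ‖y‖ ^ 2 := by positivity
  have hsq : √(1 + deriv lam ‖y‖ ^ 2) ^ 2 = 1 + deriv lam ‖y‖ ^ 2 := Real.sq_sqrt ha.le
  have hsp : 0 < √(1 + deriv lam ‖y‖ ^ 2) := Real.sqrt_pos.2 ha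
  set a := √(1 + deriv lam ‖y‖ ^ 2) with had
  constructor
  · rw [ambientMetric, norm_rotationParam_fst lam hy, rotationNormal, ← had]
    simp only [inner_smul_left, inner_smul_right, real_inner_self_eq_norm_sq, RCLike.conj_to_real]
    field_simp
    linarith
  · intro v
    rw [ambientMetric, norm_rotationParam_fst lam hy, rotationNormal, ← had,
      fderiv_rotationParam hy hl.hasDerivAt]
    simp only [inner_smul_left, inner_smul_right, real_inner_self_eq_norm_sq, RCLike.conj_to_real,
      inner_add_right]
    field_simp
    ring
  · rw [ambientMetric_vertical]
    exact one_div_pos.2 hsp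

lemma IsUpwardUnitNormal.eq_rotationNormal {lam : ℝ → ℝ} {y : Euc n} {N : Euc n × ℝ} (hy : y ≠ 0)
    (hl : DifferentiableAt ℝ lam ‖y‖) (hN : IsUpwardUnitNormal (rotationParam lam) y N) :
    N = rotationNormal lam y := by
  have hρ : 0 < ‖y‖ := norm_pos_iff.2 hy
  have ht := tanh_sq_lt_one (‖y‖ / 2)
  have ht0 : 0 < Real.tanh (‖y‖ / 2) := by
    rw [Real.tanh_eq_sinh_div_cosh]
    exact div_pos (Real.sinh_pos_iff.2 (by positivity)) (Real.cosh_pos _)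
  have hd : 0 < 1 - Real.tanh (‖y‖ / 2) ^ 2 := by linarith
  have ha : 0 < 1 + deriv lam ‖y‖ ^ 2 := by positivity
  have hsq : √(1 + deriv lam ‖y‖ ^ 2) ^ 2 = 1 + deriv lam ‖y‖ ^ 2 := Real.sq_sqrt ha.le
  have hsp : 0 < √(1 + deriv lam ‖y‖ ^ 2) := Real.sqrt_pos.2 ha
  obtain ⟨hu, hn, hup⟩ := hN
  rw [ambientMetric_vertical] at hup
  obtain ⟨N1, s⟩ := N
  simp only at hup
  have hn1 : ∀ v, inner ℝ y v = 0 → inner ℝ N1 v = 0 := by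
    intro v hv
    have := hn v
    rw [ambientMetric, norm_rotationParam_fst lam hy, fderiv_rotationParam hy hl.hasDerivAt, hv]
      at this
    simp only [zero_div, mul_zero, zero_smul, zero_add, inner_smul_right, add_zero] at this
    have h2 : 4 / (1 - Real.tanh (‖y‖ / 2) ^ 2) ^ 2 ≠ 0 := by positivity
    have h3 : Real.tanh (‖y‖ / 2) / ‖y‖ ≠ 0 := by positivity
    simpa [h2, h3, ht0.ne', hρ.ne'] using this
  obtain ⟨α, hα⟩ : ∃ α : ℝ, N1 = α • y := by
    refine ⟨inner ℝ N1 y / ‖y‖ ^ 2, ?_⟩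
    set v := N1 - (inner ℝ N1 y / ‖y‖ ^ 2) • y with hv
    have h1 : inner ℝ y v = 0 := by
      rw [hv, inner_sub_right, inner_smul_right, real_inner_self_eq_norm_sq, real_inner_comm y N1]
      field_simp
      ring
    have h2 : inner ℝ v v = 0 := by
      conv_lhs => rw [hv, ← hv]
      rw [hv, inner_sub_left, ← hv, hn1 v h1, inner_smul_left, h1]
      simp
    rw [inner_self_eq_zero] at h2
    exact sub_eq_zero.1 (hv ▸ h2)
  subst hα
  have h1 := hn y
  rw [ambientMetric, norm_rotationParam_fst lam hy, fderiv_rotationParam hy hl.hasDerivAt] at h1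
  rw [ambientMetric, norm_rotationParam_fst lam hy] at hu
  simp only [inner_smul_left, inner_smul_right, real_inner_self_eq_norm_sq, RCLike.conj_to_real,
      inner_add_right] at h1 hu
  rw [rotationNormal]
  set a := √(1 + deriv lam ‖y‖ ^ 2) with had
  set t := Real.tanh (‖y‖ / 2)
  set l := deriv lam ‖y‖
  set ρ := ‖y‖
  have hα : α = - (s * l * (1 - t ^ 2) / (2 * ρ)) := by
    field_simp at h1
    have h3 : ρ * (1 - t ^ 2) * (4 * α * ρ + 2 * (1 - t ^ 2) * s * l) = 0 := by
      linear_combination h1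
    have h4 := (mul_eq_zero.1 h3).resolve_left (by positivity)
    field_simp
    linarith
  have hs : (s * a) ^ 2 = 1 := by
    rw [hα] at hu
    field_simp at hu
    rw [mul_pow, hsq]
    linarith
  have hs1 : s * a = 1 := by
    have : 0 < s * a := mul_pos hup hsp
    nlinarith
  have hs2 : s = 1 / a := by
    field_simp
    exact hs1
  refine Prod.ext ?_ hs2
  show α • y = _
  congr 1
  rw [hα, hs2]
  field_simp

lemma ambientMetric_meanCurvature_vertical {lam : ℝ → ℝ} {y : Euc n} (hy : y ≠ 0)
    (hl : DifferentiableAt ℝ lam ‖y‖) :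
    ambientMetric (rotationParam lam y) (paramMeanCurvatureVector (rotationParam lam) y)
        (verticalField n) * √(1 + deriv lam ‖y‖ ^ 2) =
      ambientMetric (rotationParam lam y) (paramMeanCurvatureVector (rotationParam lam) y)
        (rotationNormal lam y) := by
  have hρ : ‖y‖ ≠ 0 := norm_ne_zero_iff.2 hy
  have ha : 0 < 1 + deriv lam ‖y‖ ^ 2 := by positivity
  have hsq : √(1 + deriv lam ‖y‖ ^ 2) ^ 2 = 1 + deriv lam ‖y‖ ^ 2 := Real.sq_sqrt ha.le
  have hsp : 0 < √(1 + deriv lam ‖y‖ ^ 2) := Real.sqrt_pos.2 ha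
  have hdec : verticalField n = (1 / √(1 + deriv lam ‖y‖ ^ 2)) • rotationNormal lam y +
      fderiv ℝ (rotationParam lam) y
        ((deriv lam ‖y‖ / ((√(1 + deriv lam ‖y‖ ^ 2)) ^ 2 * ‖y‖)) • y) := by
    rw [fderiv_rotationParam hy hl.hasDerivAt, rotationNormal, verticalField]
    set a := √(1 + deriv lam ‖y‖ ^ 2)
    refine Prod.ext ?_ ?_
    · simp only [Prod.smul_mk, Prod.mk_add_mk, smul_smul, ← add_smul, inner_smul_right,
        real_inner_self_eq_norm_sq]
      rw [eq_comm, smul_eq_zero]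
      left
      field_simp
      ring
    · simp only [Prod.smul_mk, Prod.mk_add_mk, inner_smul_right, real_inner_self_eq_norm_sq,
        smul_eq_mul]
      field_simp
      linarith
  rw [hdec, ← ambientForm_apply, map_add, map_smul, ambientForm_apply, ambientForm_apply,
    ambientMetric_meanCurvature (norm_rotationParam_fst_lt lam hy)
      (injective_fderiv_rotationParam hy hl.hasDerivAt), smul_eq_mul]
  field_simp
  ring

/-- The flux formula of rotation hypersurfaces. -/
theorem rotation_flux (n : ℕ) [NeZero n] (J : Set ℝ) (lam : ℝ → ℝ) (hJ : IsOpen J)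
    (hJc : J.OrdConnected) (hJ0 : J ⊆ Set.Ioi 0) (hlam : ContDiffOn ℝ 2 lam J) :
    (∀ ρ ∈ J, ∀ ξ : Euc n, ‖ξ‖ = 1 →
        ∃! N : Euc n × ℝ, IsUpwardUnitNormal (rotationParam lam) (ρ • ξ) N) ∧
      (∀ ρ ∈ J, ∀ ξ : Euc n, ‖ξ‖ = 1 → ∀ N : Euc n × ℝ,
        IsUpwardUnitNormal (rotationParam lam) (ρ • ξ) N →
        HasDerivAt (profileFlux n lam)
          (n * ambientMetric (rotationParam lam (ρ • ξ))
            (paramMeanCurvatureVector (rotationParam lam) (ρ • ξ)) N * Real.sinh ρ ^ (n - 1)) ρ) ∧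
      (∀ H : ℝ, HasConstantMeanCurvature n lam J H →
        ∀ ρ₀ ∈ J, ∀ ρ ∈ J,
          profileFlux n lam ρ =
            n * H * (∫ t in ρ₀..ρ, Real.sinh t ^ (n - 1)) + profileFlux n lam ρ₀) ∧
      (∀ H : ℝ, HasConstantMeanCurvature n lam J H ↔
        ∃ d : ℝ, ∀ ρ ∈ J,
          profileFlux n lam ρ = n * H * (∫ t in (0 : ℝ)..ρ, Real.sinh t ^ (n - 1)) + d) := by
  have hnorm : ∀ ρ ∈ J, ∀ ξ : Euc n, ‖ξ‖ = 1 → ‖ρ • ξ‖ = ρ := fun ρ hρ ξ hξ => by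
    rw [norm_smul, hξ, mul_one, Real.norm_of_nonneg (le_of_lt (hJ0 hρ))]
  have hne : ∀ ρ ∈ J, ∀ ξ : Euc n, ‖ξ‖ = 1 → ρ • ξ ≠ 0 := fun ρ hρ ξ hξ => by
    rw [← norm_ne_zero_iff, hnorm ρ hρ ξ hξ]
    exact (hJ0 hρ).ne'
  have hC : ∀ ρ ∈ J, ContDiffAt ℝ 2 lam ρ := fun ρ hρ => hlam.contDiffAt (hJ.mem_nhds hρ)
  have hD : ∀ ρ ∈ J, DifferentiableAt ℝ lam ρ := fun ρ hρ =>
    (hC ρ hρ).differentiableAt two_ne_zero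
  have hex : ∀ ρ ∈ J, ∀ ξ : Euc n, ‖ξ‖ = 1 →
      ∃! N : Euc n × ℝ, IsUpwardUnitNormal (rotationParam lam) (ρ • ξ) N := by
    intro ρ hρ ξ hξ
    have h1 := hne ρ hρ ξ hξ
    have h2 : DifferentiableAt ℝ lam ‖ρ • ξ‖ := by
      rw [hnorm ρ hρ ξ hξ]
      exact hD ρ hρ
    exact ⟨_, isUpwardUnitNormal_rotationNormal h1 h2, fun N hN => hN.eq_rotationNormal h1 h2⟩
  have hder : ∀ ρ ∈ J, ∀ ξ : Euc n, ‖ξ‖ = 1 → ∀ N : Euc n × ℝ,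
        IsUpwardUnitNormal (rotationParam lam) (ρ • ξ) N →
        HasDerivAt (profileFlux n lam)
          (n * ambientMetric (rotationParam lam (ρ • ξ))
            (paramMeanCurvatureVector (rotationParam lam) (ρ • ξ)) N * Real.sinh ρ ^ (n - 1)) ρ := by
    intro ρ hρ ξ hξ N hN
    have h1 := hne ρ hρ ξ hξ
    have h3 := hnorm ρ hρ ξ hξ
    have h2 : ContDiffAt ℝ 2 lam ‖ρ • ξ‖ := by
      rw [h3]
      exact hC ρ hρ
    have h4 := hasDerivAt_profileFlux_vertical h1 h2
    have h5 : DifferentiableAt ℝ lam ‖ρ • ξ‖ := h2.differentiableAt two_ne_zero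
    rw [mul_assoc (n : ℝ), ambientMetric_meanCurvature_vertical h1 h5,
      ← hN.eq_rotationNormal h1 h5, h3] at h4
    exact h4
  obtain ⟨ξ, hξ⟩ : ∃ ξ : Euc n, ‖ξ‖ = 1 := ⟨EuclideanSpace.single 0 1, by simp⟩
  have hcont : Continuous fun t : ℝ => Real.sinh t ^ (n - 1) := Real.continuous_sinh.pow _
  have hint : ∀ H : ℝ, HasConstantMeanCurvature n lam J H →
        ∀ ρ₀ ∈ J, ∀ ρ ∈ J,
          profileFlux n lam ρ =
            n * H * (∫ t in ρ₀..ρ, Real.sinh t ^ (n - 1)) + profileFlux n lam ρ₀ := by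
    intro H hH ρ₀ hρ₀ ρ hρ
    have h1 : ∀ r ∈ Set.uIcc ρ₀ ρ, HasDerivAt (profileFlux n lam)
        (n * H * Real.sinh r ^ (n - 1)) r := by
      intro r hr
      have hrJ := hJc.uIcc_subset hρ₀ hρ hr
      obtain ⟨N, hN, -⟩ := hex r hrJ ξ hξ
      have := hder r hrJ ξ hξ N hN
      rwa [hH r hrJ ξ hξ N hN] at this
    have h2 := intervalIntegral.integral_eq_sub_of_hasDerivAt h1
      ((continuous_const.mul hcont).intervalIntegrable _ _)
    rw [intervalIntegral.integral_const_mul] at h2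
    linarith
  refine ⟨hex, hder, hint, fun H => ⟨fun hH => ?_, ?_⟩⟩
  · rcases J.eq_empty_or_nonempty with rfl | ⟨ρ₀, hρ₀⟩
    · exact ⟨0, fun ρ hρ => absurd hρ (Set.notMem_empty ρ)⟩
    · refine ⟨profileFlux n lam ρ₀ - n * H * ∫ t in (0 : ℝ)..ρ₀, Real.sinh t ^ (n - 1),
        fun ρ hρ => ?_⟩
      have h1 := hint H hH ρ₀ hρ₀ ρ hρ
      have h2 := intervalIntegral.integral_add_adjacent_intervals (μ := volume)
        (hcont.intervalIntegrable 0 ρ₀) (hcont.intervalIntegrable ρ₀ ρ)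
      rw [h1, ← h2]
      ring
  · rintro ⟨d, hd⟩ ρ hρ ξ hξ N hN
    have h1 := hder ρ hρ ξ hξ N hN
    have h2 : HasDerivAt (fun r => n * H * (∫ t in (0 : ℝ)..r, Real.sinh t ^ (n - 1)) + d)
        (n * H * Real.sinh ρ ^ (n - 1)) ρ :=
      ((intervalIntegral.integral_hasDerivAt_right (hcont.intervalIntegrable _ _)
        (hcont.stronglyMeasurableAtFilter _ _) hcont.continuousAt).const_mul _).add_const d
    have h3 : profileFlux n lam =ᶠ[nhds ρ]
        fun r => n * H * (∫ t in (0 : ℝ)..r, Real.sinh t ^ (n - 1)) + d :=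
      Filter.eventually_of_mem (hJ.mem_nhds hρ) hd
    have h4 := h1.unique (h2.congr_of_eventuallyEq h3)
    have h5 : 0 < Real.sinh ρ ^ (n - 1) := pow_pos (Real.sinh_pos_iff.2 (hJ0 hρ)) _
    have h6 : (n : ℝ) ≠ 0 := Nat.cast_ne_zero.2 (NeZero.ne n)
    exact mul_left_cancel₀ h6 (mul_right_cancel₀ h5.ne' h4)

end RotationFlux

section PushedDensities

variable {M : Type*} [MeasurableSpace M]

/-- The supremum of a family of measures which are compatible on the overlaps of their domains
coincides with each of them on its domain. -/
lemma iSup_measure_restrict {α : Type*} {p : α → Prop} {ν : α → Measure M} {S : α → Set M}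
    {e : α} (he : p e) (hS : MeasurableSet (S e)) (h0 : ν e (S e)ᶜ = 0)
    (hcomp : ∀ e', p e' → ∀ A, MeasurableSet A → ν e' (A ∩ S e) ≤ ν e A) :
    (⨆ (e' : α) (_ : p e'), ν e').restrict (S e) = ν e := by
  classical
  set κ : Measure M := (⊤ : ENNReal) • (Measure.count.restrict (S e)ᶜ) with hκ
  have hle : (⨆ (e' : α) (_ : p e'), ν e') ≤ ν e + κ := by
    refine iSup₂_le fun e' he' => Measure.le_iff.2 fun A hA => ?_
    rcases (A ∩ (S e)ᶜ).eq_empty_or_nonempty with h | h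
    · have h1 : A ∩ S e = A := by
        rw [Set.inter_eq_left]
        intro a ha
        by_contra h2
        exact (h ▸ (⟨ha, h2⟩ : a ∈ A ∩ (S e)ᶜ) : a ∈ (∅ : Set M))
      have := hcomp e' he' A hA
      rw [h1] at this
      exact this.trans (by simp)
    · have h1 : κ A = ⊤ := by
        rw [hκ, Measure.smul_apply, Measure.restrict_apply hA, smul_eq_mul, ENNReal.top_mul]
        exact Measure.count_ne_zero h
      simp [h1]
  refine le_antisymm ?_ ?_
  · refine Measure.le_iff.2 fun A hA => ?_
    rw [Measure.restrict_apply hA]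
    refine (hle (A ∩ S e)).trans ?_
    have h1 : κ (A ∩ S e) = 0 := by
      rw [hκ, Measure.smul_apply, Measure.restrict_apply (hA.inter hS)]
      simp [Set.inter_assoc]
    rw [Measure.add_apply, h1, add_zero]
    exact measure_mono Set.inter_subset_left
  · refine Measure.le_iff.2 fun A hA => ?_
    rw [Measure.restrict_apply hA]
    have h1 : ν e A = ν e (A ∩ S e) := by
      refine le_antisymm ?_ (measure_mono Set.inter_subset_left)
      calc ν e A ≤ ν e (A ∩ S e) + ν e (A \ S e) := measure_le_inter_add_sdiff _ _ _
        _ ≤ ν e (A ∩ S e) + ν e (S e)ᶜ := by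
            gcongr
            exact fun a ha => ha.2
        _ = _ := by rw [h0, add_zero]
    rw [h1]
    exact (le_iSup₂ (f := fun e' (_ : p e') => ν e') e he) (A ∩ S e)

variable {E : Type*} [NormedAddCommGroup E] [NormedSpace ℝ E] [FiniteDimensional ℝ E]
  [MeasureSpace E] [BorelSpace E]

/-- The image under `P` of the measure with density `ρ` on `U`. -/
def pushDensity (P : E → M) (U : Set E) (ρ : E → ENNReal) : Measure M :=
  Measure.map P ((volume.restrict U).withDensity ρ)

variable [TopologicalSpace M] [BorelSpace M]

lemma measurableSet_inter_preimage {P : E → M} {U : Set E} (hU : MeasurableSet U)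
    (hP : ContinuousOn P U) {A : Set M} (hA : MeasurableSet A) : MeasurableSet (U ∩ P ⁻¹' A) := by
  have h1 : Measurable (U.domRestrict P) := (continuousOn_iff_continuous_domRestrict.1 hP).measurable
  have h2 := (MeasurableEmbedding.subtype_coe hU).measurableSet_image.2 (h1 hA)
  convert h2 using 1
  ext x
  simp [and_comm]

lemma aemeasurable_withDensity_restrict {P : E → M} {U : Set E} (hU : MeasurableSet U)
    (hP : ContinuousOn P U) (ρ : E → ENNReal) :
    AEMeasurable P ((volume.restrict U).withDensity ρ) :=
  (hP.aemeasurable hU).mono_ac (withDensity_absolutelyContinuous _ _)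

lemma pushDensity_restrict {P : E → M} {U : Set E} (hU : MeasurableSet U)
    (hP : ContinuousOn P U) (ρ : E → ENNReal) {A : Set M} (hA : MeasurableSet A) :
    (pushDensity P U ρ).restrict A =
      Measure.map P ((volume.restrict (U ∩ P ⁻¹' A)).withDensity ρ) := by
  rw [pushDensity, Measure.restrict_map_of_aemeasurable
    (aemeasurable_withDensity_restrict hU hP ρ) hA, ← restrict_withDensity hU,
    Measure.restrict_restrict' hU, Set.inter_comm,
    restrict_withDensity (measurableSet_inter_preimage hU hP hA)]

lemma pushDensity_apply {P : E → M} {U : Set E} (hU : MeasurableSet U)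
    (hP : ContinuousOn P U) (ρ : E → ENNReal) {A : Set M} (hA : MeasurableSet A) :
    pushDensity P U ρ A = ∫⁻ x in U ∩ P ⁻¹' A, ρ x := by
  rw [pushDensity, Measure.map_apply_of_aemeasurable
    (aemeasurable_withDensity_restrict hU hP ρ) hA, ← restrict_withDensity hU,
    Measure.restrict_apply' hU, Set.inter_comm,
    withDensity_apply _ (measurableSet_inter_preimage hU hP hA)]

/-- Change of variables on the overlap of two parametrizations. -/
lemma pushDensity_le [(volume : Measure E).IsAddHaarMeasure] {P P' : E → M} {U U' : Set E}
    (hU : MeasurableSet U) (hU' : MeasurableSet U') (hP : ContinuousOn P U)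
    (hP' : ContinuousOn P' U') {ρ ρ' : E → ENNReal} {S : Set M} (hS : MeasurableSet S)
    {ψ : E → E} {ψ' : E → E →L[ℝ] E}
    (hψ : ∀ x ∈ U, P x ∈ S → ψ x ∈ U' ∧ P' (ψ x) = P x ∧ HasFDerivAt ψ (ψ' x) x ∧
      ρ x = ENNReal.ofReal |(ψ' x).det| * ρ' (ψ x))
    (hinj : Set.InjOn P U) {A : Set M} (hA : MeasurableSet A) :
    pushDensity P U ρ (A ∩ S) ≤ pushDensity P' U' ρ' A := by
  rw [pushDensity_apply hU hP _ (hA.inter hS), pushDensity_apply hU' hP' _ hA]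
  have hm := measurableSet_inter_preimage hU hP (hA.inter hS)
  have h1 : ∫⁻ x in U ∩ P ⁻¹' (A ∩ S), ρ x =
      ∫⁻ x in U ∩ P ⁻¹' (A ∩ S), ENNReal.ofReal |(ψ' x).det| * ρ' (ψ x) :=
    setLIntegral_congr_fun hm fun x hx => (hψ x hx.1 hx.2.2).2.2.2
  rw [h1, ← lintegral_image_eq_lintegral_abs_det_fderiv_mul volume hm
    (fun x hx => (hψ x hx.1 hx.2.2).2.2.1.hasFDerivWithinAt)]
  · refine lintegral_mono_set ?_
    rintro _ ⟨x, hx, rfl⟩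
    obtain ⟨h2, h3, -⟩ := hψ x hx.1 hx.2.2
    exact ⟨h2, by rw [Set.mem_preimage, h3]; exact hx.2.1⟩
  · intro x hx y hy hxy
    refine hinj hx.1 hy.1 ?_
    rw [← (hψ x hx.1 hx.2.2).2.1, ← (hψ y hy.1 hy.2.2).2.1, hxy]

lemma aemeasurable_ofReal_density {U : Set E} (hU : MeasurableSet U) {ρ : E → ℝ}
    (hρ : ContinuousOn ρ U) : AEMeasurable (fun x => ENNReal.ofReal (ρ x)) (volume.restrict U) :=
  (hρ.aemeasurable hU).ennreal_ofReal

lemma integrableOn_pushDensity {P : E → M} {U : Set E} (hU : MeasurableSet U)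
    (hP : ContinuousOn P U) {ρ : E → ℝ} (hρ : ContinuousOn ρ U) (hρ0 : ∀ x, 0 ≤ ρ x) {A : Set M}
    (hA : MeasurableSet A) {F : M → ℝ}
    (hF : AEStronglyMeasurable F ((pushDensity P U fun x => ENNReal.ofReal (ρ x)).restrict A)) :
    IntegrableOn F A (pushDensity P U fun x => ENNReal.ofReal (ρ x)) ↔
      IntegrableOn (fun x => ρ x * F (P x)) (U ∩ P ⁻¹' A) := by
  have hm := measurableSet_inter_preimage hU hP hA
  have hP1 := aemeasurable_withDensity_restrict hm (hP.mono Set.inter_subset_left)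
    fun x => ENNReal.ofReal (ρ x)
  rw [IntegrableOn, pushDensity_restrict hU hP _ hA] at *
  rw [integrable_map_measure hF hP1, integrable_withDensity_iff_integrable_smul₀'
    (aemeasurable_ofReal_density hm (hρ.mono Set.inter_subset_left)) (by simp)]
  simp only [ENNReal.toReal_ofReal (hρ0 _), smul_eq_mul, Function.comp_apply, IntegrableOn]

lemma setIntegral_pushDensity {P : E → M} {U : Set E} (hU : MeasurableSet U)
    (hP : ContinuousOn P U) {ρ : E → ℝ} (hρ : ContinuousOn ρ U) (hρ0 : ∀ x, 0 ≤ ρ x) {A : Set M}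
    (hA : MeasurableSet A) {F : M → ℝ}
    (hF : AEStronglyMeasurable F ((pushDensity P U fun x => ENNReal.ofReal (ρ x)).restrict A)) :
    ∫ p in A, F p ∂(pushDensity P U fun x => ENNReal.ofReal (ρ x)) =
      ∫ x in U ∩ P ⁻¹' A, ρ x * F (P x) := by
  have hm := measurableSet_inter_preimage hU hP hA
  have hP1 := aemeasurable_withDensity_restrict hm (hP.mono Set.inter_subset_left)
    fun x => ENNReal.ofReal (ρ x)
  rw [pushDensity_restrict hU hP _ hA] at *
  rw [integral_map hP1 hF, integral_withDensity_eq_integral_toReal_smul₀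
    (aemeasurable_ofReal_density hm (hρ.mono Set.inter_subset_left)) (by simp)]
  simp only [ENNReal.toReal_ofReal (hρ0 _), smul_eq_mul]

end PushedDensities

section HalfSpace

open Set

lemma box_divergence {m : ℕ} {W : Fin (m + 1) → (Fin (m + 1) → ℝ) → ℝ}
    (hW : ∀ i, ContDiff ℝ 1 (W i)) {R : ℝ} (hR : 0 ≤ R)
    (h0 : ∀ i z j, R ≤ |z j| → W i z = 0) (h0' : ∀ i z j, R < |z j| → fderiv ℝ (W i) z = 0) :
    ∫ z in {z : Fin (m + 1) → ℝ | 0 ≤ z 0}, ∑ i, fderiv ℝ (W i) z (Pi.single i 1) =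
      - ∫ y : Fin m → ℝ, W 0 (Fin.insertNth (α := fun _ => ℝ) 0 0 y) := by
  set a : Fin (m + 1) → ℝ := fun i => if i = 0 then 0 else -R with ha
  set b : Fin (m + 1) → ℝ := fun _ => R with hb
  have hab : a ≤ b := fun i => by
    by_cases h : i = 0 <;> simp [ha, hb, h, hR]
  have hcont : Continuous fun z => ∑ i, fderiv ℝ (W i) z (Pi.single i 1) :=
    continuous_finsetSum _ fun i _ =>
      ((hW i).continuous_fderiv one_ne_zero).clm_apply continuous_const
  have hdiv := integral_divergence_of_hasFDerivAt_off_countable' a b hab W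
    (fun i z => fderiv ℝ (W i) z) ∅ countable_empty (fun i => (hW i).continuous.continuousOn)
    (fun x _ i => ((hW i).differentiable one_ne_zero x).hasFDerivAt)
    (hcont.continuousOn.integrableOn_compact isCompact_Icc)
  have h1 : ∫ z in {z : Fin (m + 1) → ℝ | 0 ≤ z 0}, ∑ i, fderiv ℝ (W i) z (Pi.single i 1) =
      ∫ z in Icc a b, ∑ i, fderiv ℝ (W i) z (Pi.single i 1) := by
    refine setIntegral_eq_of_subset_of_forall_sdiff_eq_zero
      (measurableSet_le measurable_const (measurable_pi_apply 0)) ?_ ?_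
    · intro z hz
      simpa [ha] using hz.1 0
    · rintro z ⟨hz0, hz⟩
      obtain ⟨j, hj⟩ : ∃ j, R < |z j| := by
        by_contra! hcon
        refine hz ⟨fun i => ?_, fun i => (abs_le.1 (hcon i)).2⟩
        by_cases h : i = 0
        · subst h; simpa [ha] using hz0
        · simpa [ha, h] using (abs_le.1 (hcon i)).1
      exact Finset.sum_eq_zero fun i _ => by rw [h0' i z j hj]; rfl
  rw [h1, hdiv, Finset.sum_eq_single 0]
  · have h2 : ∀ x : Fin m → ℝ, W 0 (Fin.insertNth (α := fun _ => ℝ) 0 (b 0) x) = 0 := fun x =>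
      h0 0 _ 0 (by simp [hb, le_abs_self])
    have h3 : ∫ x in Icc (a ∘ Fin.succAbove 0) (b ∘ Fin.succAbove 0),
        W 0 (Fin.insertNth (α := fun _ => ℝ) 0 (a 0) x) =
        ∫ y : Fin m → ℝ, W 0 (Fin.insertNth (α := fun _ => ℝ) 0 0 y) := by
      have ha0 : a 0 = 0 := by simp [ha]
      rw [ha0]
      refine setIntegral_eq_integral_of_forall_compl_eq_zero fun x hx => ?_
      obtain ⟨j, hj⟩ : ∃ j, R < |x j| := by
        by_contra! hcon
        refine hx ⟨fun i => ?_, fun i => (abs_le.1 (hcon i)).2⟩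
        simpa [ha] using (abs_le.1 (hcon i)).1
      exact h0 0 _ j.succ (by simpa using hj.le)
    simp only [h2, integral_zero, zero_sub]
    rw [h3]
  · intro i _ hi
    have h2 : ∀ x : Fin m → ℝ, W i (Fin.insertNth (α := fun _ => ℝ) i (b i) x) = 0 := fun x =>
      h0 i _ i (by simp [hb, le_abs_self])
    have h3 : ∀ x : Fin m → ℝ, W i (Fin.insertNth (α := fun _ => ℝ) i (a i) x) = 0 := fun x =>
      h0 i _ i (by simp [ha, hi, le_abs_self])
    simp [h2, h3]
  · simp

/-- The divergence theorem on a half-space, for compactly supported vector fields. -/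
theorem halfSpace_divergence (n : ℕ) [NeZero n] {V : Fin n → Euc n → ℝ}
    (hV : ∀ i, ContDiff ℝ 1 (V i)) (hc : ∀ i, HasCompactSupport (V i)) :
    ∫ x in {x : Euc n | 0 ≤ x 0}, ∑ i, fderiv ℝ (V i) x (stdBasis n i) =
      - ∫ y, V 0 (hyperplaneIncl y) := by
  obtain ⟨m, rfl⟩ := Nat.exists_eq_succ_of_ne_zero (NeZero.ne n)
  set L : (Fin (m + 1) → ℝ) ≃L[ℝ] Euc (m + 1) :=
    (PiLp.continuousLinearEquiv 2 ℝ fun _ : Fin (m + 1) => ℝ).symm with hL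
  have hLz : ∀ z, L z = WithLp.toLp 2 z := fun z => rfl
  set W : Fin (m + 1) → (Fin (m + 1) → ℝ) → ℝ := fun i z => V i (L z) with hWd
  have hW : ∀ i, ContDiff ℝ 1 (W i) := fun i => (hV i).comp L.contDiff
  have hdW : ∀ i z, fderiv ℝ (W i) z = (fderiv ℝ (V i) (L z)).comp (L : _ →L[ℝ] Euc (m + 1)) :=
    fun i z => (((hV i).differentiable one_ne_zero (L z)).hasFDerivAt.comp z L.hasFDerivAt).fderiv
  obtain ⟨R, hR⟩ : ∃ R, ∀ i, ∀ x ∈ tsupport (V i), ‖x‖ < R := by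
    have h1 : IsCompact (⋃ i, tsupport (V i)) := isCompact_iUnion fun i => hc i
    obtain ⟨R, hR⟩ := h1.isBounded.exists_norm_le
    exact ⟨R + 1, fun i x hx => (hR x (mem_iUnion_of_mem i hx)).trans_lt (lt_add_one R)⟩
  have habs : ∀ (z : Fin (m + 1) → ℝ) j, |z j| ≤ ‖L z‖ := fun z j => by
    exact PiLp.norm_apply_le (L z) j
  have hns : ∀ i z j, max R 0 ≤ |z j| → L z ∉ tsupport (V i) := fun i z j hz h =>
    absurd (hR i _ h) (not_lt.2 ((le_max_left _ _).trans (hz.trans (habs z j))))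
  have key := box_divergence hW (le_max_right R 0)
    (fun i z j hz => image_eq_zero_of_notMem_tsupport (f := V i) (hns i z j hz))
    (fun i z j hz => by
      have h2 : fderiv ℝ (V i) (L z) = 0 := by
        by_contra h
        exact hns i z j hz.le (support_fderiv_subset ℝ h)
      rw [hdW, h2]
      rfl)
  have hmp := PiLp.volume_preserving_toLp (Fin (m + 1))
  have hme : MeasurableEmbedding (@WithLp.toLp 2 (Fin (m + 1) → ℝ)) :=
    (MeasurableEquiv.toLp 2 (Fin (m + 1) → ℝ)).measurableEmbedding
  have h1 := hmp.setIntegral_preimage_emb hme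
    (fun x => ∑ i, fderiv ℝ (V i) x (stdBasis (m + 1) i)) {x : Euc (m + 1) | 0 ≤ x 0}
  have h2 : ∀ z : Fin (m + 1) → ℝ, ∑ i, fderiv ℝ (W i) z (Pi.single i 1) =
      ∑ i, fderiv ℝ (V i) (WithLp.toLp 2 z) (stdBasis (m + 1) i) := by
    intro z
    refine Finset.sum_congr rfl fun i _ => ?_
    rw [hdW, ContinuousLinearMap.comp_apply, hLz]
    congr 1
    simp [hL, stdBasis]
  refine h1.symm.trans ?_
  simp only [h2] at key
  refine Eq.trans key ?_
  congr 1
  have h3 := (volume_measurePreserving_piCongrLeft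
    (fun _ : {x : Fin (m + 1) // x ≠ 0} => ℝ) (finSuccAboveEquiv (0 : Fin (m + 1)))).integral_comp'
    (fun y => V 0 (hyperplaneIncl y))
  refine Eq.trans ?_ h3
  refine integral_congr_ae (Filter.Eventually.of_forall fun y => ?_)
  simp only [hWd, hLz]
  congr 1
  unfold hyperplaneIncl
  congr 1
  funext j
  refine Fin.cases ?_ (fun k => ?_) j
  · simp
  · have h4 : (⟨k.succ, Fin.succ_ne_zero k⟩ : {x : Fin (m + 1) // x ≠ 0}) =
        finSuccAboveEquiv 0 k := rfl
    simp only [Fin.insertNth_zero', Fin.cons_succ, ne_eq, Fin.succ_ne_zero, not_false_eq_true,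
      dite_true]
    rw [h4]
    exact (Equiv.piCongrLeft_apply_apply (fun _ : {x : Fin (m + 1) // x ≠ 0} => ℝ)
      (finSuccAboveEquiv 0) y k).symm

end HalfSpace

section CoordinateCongruence

variable {ι : Type} [Fintype ι] [DecidableEq ι]
variable {E : Type} [NormedAddCommGroup E] [NormedSpace ℝ E]

lemma coordLaplacian_congr {g g' : E → E → E → ℝ} {b : Module.Basis ι ℝ E} {u u' : E → ℝ} {x : E}
    (hg : g =ᶠ[nhds x] g') (hu : u =ᶠ[nhds x] u') :
    coordLaplacian g b u x = coordLaplacian g' b u' x := by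
  have h1 : ∀ v w, fderiv ℝ (fun y => g y v w) x = fderiv ℝ (fun y => g' y v w) x := fun v w =>
    Filter.EventuallyEq.fderiv_eq (hg.mono fun y hy => by simp only [hy])
  have h2 : gram g b x = gram g' b x := by simp only [gram, hg.self_of_nhds]
  have h3 : ∀ w, fderiv ℝ (fun y => fderiv ℝ u y w) x = fderiv ℝ (fun y => fderiv ℝ u' y w) x :=
    fun w => Filter.EventuallyEq.fderiv_eq ((hu.fderiv (𝕜 := ℝ)).mono fun y hy => by simp only [hy])
  simp only [coordLaplacian, christoffel, christoffelFirst, h1, h2, h3, hu.fderiv_eq]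

lemma coordLaplacian_zero (g : E → E → E → ℝ) (b : Module.Basis ι ℝ E) (x : E) :
    coordLaplacian g b (fun _ => 0) x = 0 := by
  simp [coordLaplacian]

lemma det_bilin_comp (T : E →ₗ[ℝ] E →ₗ[ℝ] ℝ) (A : E →ₗ[ℝ] E) (b : Module.Basis ι ℝ E) :
    (Matrix.of fun i j => T (A (b i)) (A (b j))).det =
      LinearMap.det A ^ 2 * (Matrix.of fun i j => T (b i) (b j)).det := by
  set Q := LinearMap.toMatrix b b A with hQ
  have hA : ∀ i, A (b i) = ∑ k, Q k i • b k := by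
    intro i
    conv_lhs => rw [← b.sum_repr (A (b i))]
    simp [hQ, LinearMap.toMatrix_apply]
  have h1 : (Matrix.of fun i j => T (A (b i)) (A (b j))) =
      Q.transpose * (Matrix.of fun i j => T (b i) (b j)) * Q := by
    ext i j
    simp only [hA, map_sum, LinearMap.sum_apply, map_smul, LinearMap.smul_apply, smul_eq_mul,
      Matrix.mul_apply, Matrix.transpose_apply, Matrix.of_apply, Finset.mul_sum, Finset.sum_mul]
    exact Finset.sum_congr rfl fun k _ => Finset.sum_congr rfl fun l _ => by ring
  rw [h1, Matrix.det_mul, Matrix.det_mul, Matrix.det_transpose, hQ, LinearMap.det_toMatrix]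
  ring

end CoordinateCongruence

section Charts

variable {n : ℕ} {M : Type*} [TopologicalSpace M] [ChartedSpace (Euc n) M]
  [IsManifold (𝓡 n) ∞ M] {g : SmoothMetric n M} {f : M → Euc n × ℝ}
  {e e' : OpenPartialHomeomorph M (Euc n)} {x : Euc n}

lemma mdifferentiableAt_symm (he : e ∈ IsManifold.maximalAtlas (𝓡 n) ∞ M) (hx : x ∈ e.target) :
    MDifferentiableAt (𝓡 n) (𝓡 n) e.symm x :=
  (contMDiffAt_symm_of_mem_maximalAtlas he hx).mdifferentiableAt (by simp)

lemma mdifferentiableAt_chart (he : e ∈ IsManifold.maximalAtlas (𝓡 n) ∞ M) {p : M}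
    (hp : p ∈ e.source) : MDifferentiableAt (𝓡 n) (𝓡 n) e p :=
  (contMDiffAt_of_mem_maximalAtlas he hp).mdifferentiableAt (by simp)

lemma chartDifferential_symm (he : e ∈ IsManifold.maximalAtlas (𝓡 n) ∞ M) (hx : x ∈ e.target)
    (v : Euc n) :
    chartDifferential e (e.symm x) (mfderiv (𝓡 n) (𝓡 n) e.symm x v) = v := by
  have h1 : mfderiv (𝓡 n) (𝓡 n) (e ∘ e.symm) x = _ :=
    mfderiv_comp x (mdifferentiableAt_chart he (e.map_target hx)) (mdifferentiableAt_symm he hx)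
  have h2 : (e ∘ e.symm) =ᶠ[nhds x] id :=
    Filter.eventually_of_mem (e.open_target.mem_nhds hx) fun y hy => e.right_inv hy
  rw [h2.mfderiv_eq, mfderiv_id] at h1
  exact (congrArg (fun L => L v) h1).symm

lemma symm_chartDifferential (he : e ∈ IsManifold.maximalAtlas (𝓡 n) ∞ M) (hx : x ∈ e.target)
    (v : TangentSpace (𝓡 n) (e.symm x)) :
    mfderiv (𝓡 n) (𝓡 n) e.symm x (chartDifferential e (e.symm x) v) = v := by
  have hp := e.map_target hx
  have h1 : mfderiv (𝓡 n) (𝓡 n) (e.symm ∘ e) (e.symm x) = _ :=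
    mfderiv_comp (e.symm x) (by rw [e.right_inv hx]; exact mdifferentiableAt_symm he hx)
      (mdifferentiableAt_chart he hp)
  have h2 : (e.symm ∘ e) =ᶠ[nhds (e.symm x)] id :=
    Filter.eventually_of_mem (e.open_source.mem_nhds hp) fun y hy => e.left_inv hy
  rw [h2.mfderiv_eq, mfderiv_id] at h1
  have h3 := (congrArg (fun L => L v) h1).symm
  have h4 : ∀ z, z = x → (mfderiv (𝓡 n) (𝓡 n) e.symm z : Euc n → Euc n)
      (chartDifferential e (e.symm x) v) =
      (mfderiv (𝓡 n) (𝓡 n) e.symm x : Euc n → Euc n) (chartDifferential e (e.symm x) v) := by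
    rintro z rfl; rfl
  exact (h4 _ (e.right_inv hx)).symm.trans h3

lemma contDiffAt_comp_symm {F : Type*} [NormedAddCommGroup F] [NormedSpace ℝ F] {u : M → F}
    (he : e ∈ IsManifold.maximalAtlas (𝓡 n) ∞ M) (hu : ContMDiff (𝓡 n) 𝓘(ℝ, F) ∞ u)
    (hx : x ∈ e.target) : ContDiffAt ℝ ∞ (u ∘ e.symm) x :=
  ((hu (e.symm x)).comp x (contMDiffAt_symm_of_mem_maximalAtlas he hx)).contDiffAt

lemma fderiv_comp_symm {F : Type*} [NormedAddCommGroup F] [NormedSpace ℝ F] {u : M → F}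
    (he : e ∈ IsManifold.maximalAtlas (𝓡 n) ∞ M) (hu : ContMDiff (𝓡 n) 𝓘(ℝ, F) ∞ u)
    (hx : x ∈ e.target) (v : Euc n) :
    fderiv ℝ (u ∘ e.symm) x v =
      mfderiv (𝓡 n) 𝓘(ℝ, F) u (e.symm x) (mfderiv (𝓡 n) (𝓡 n) e.symm x v) := by
  rw [← mfderiv_eq_fderiv, mfderiv_comp x ((hu _).mdifferentiableAt (by simp))
    (mdifferentiableAt_symm he hx)]
  rfl

lemma metricInChart_eq (hf : IsIsometricImmersion g f)
    (he : e ∈ IsManifold.maximalAtlas (𝓡 n) ∞ M) (hx : x ∈ e.target) :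
    metricInChart g e x = pullbackMetric (f ∘ e.symm) x := by
  funext v w
  rw [metricInChart, hf.isometric, pullbackMetric, fderiv_comp_symm he hf.contMDiff hx,
    fderiv_comp_symm he hf.contMDiff hx]
  rfl

lemma metricInChart_eventuallyEq (hf : IsIsometricImmersion g f)
    (he : e ∈ IsManifold.maximalAtlas (𝓡 n) ∞ M) (hx : x ∈ e.target) :
    metricInChart g e =ᶠ[nhds x] toMetric (pullForm ambientForm (f ∘ e.symm)) := by
  filter_upwards [e.open_target.mem_nhds hx] with y hy
  rw [metricInChart_eq hf he hy, pullbackMetric_eq]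

lemma injective_fderiv_immersion (hf : IsIsometricImmersion g f)
    (he : e ∈ IsManifold.maximalAtlas (𝓡 n) ∞ M) (hx : x ∈ e.target) :
    Function.Injective (fderiv ℝ (f ∘ e.symm) x) := by
  refine (injective_iff_map_eq_zero _).2 fun v hv => ?_
  have h1 : metricInChart g e x v v = 0 := by
    rw [metricInChart_eq hf he hx, pullbackMetric, hv]
    simp [ambientMetric]
  have h2 : (mfderiv (𝓡 n) (𝓡 n) e.symm x v : TangentSpace (𝓡 n) (e.symm x)) = 0 := by
    by_contra h
    exact (g.pos _ _ h).ne' h1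
  rw [← chartDifferential_symm he hx v, h2]
  exact map_zero (mfderiv (𝓡 n) (𝓡 n) e (e.symm x))

lemma isInner_pullForm_immersion (hf : IsIsometricImmersion g f)
    (he : e ∈ IsManifold.maximalAtlas (𝓡 n) ∞ M) (hx : x ∈ e.target) :
    IsInner (pullForm ambientForm (f ∘ e.symm) x) :=
  isInner_pullForm_ambient (hf.mem_ball _) (injective_fderiv_immersion hf he hx)

lemma contDiffAt_pullForm_immersion (hf : IsIsometricImmersion g f)
    (he : e ∈ IsManifold.maximalAtlas (𝓡 n) ∞ M) (hx : x ∈ e.target) :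
    ContDiffAt ℝ ∞ (pullForm ambientForm (f ∘ e.symm)) x :=
  contDiffAt_pullForm (contDiffAt_ambientForm (hf.mem_ball _) ∞)
    (contDiffAt_comp_symm he hf.contMDiff hx)

/-! ### Changes of coordinates -/

lemma contDiffAt_transition (he : e ∈ IsManifold.maximalAtlas (𝓡 n) ∞ M)
    (he' : e' ∈ IsManifold.maximalAtlas (𝓡 n) ∞ M) (hx : x ∈ e.target)
    (hx' : e.symm x ∈ e'.source) : ContDiffAt ℝ ∞ (e' ∘ e.symm) x :=
  ((contMDiffAt_of_mem_maximalAtlas he' hx').comp x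
    (contMDiffAt_symm_of_mem_maximalAtlas he hx)).contDiffAt

lemma fderiv_transition (he : e ∈ IsManifold.maximalAtlas (𝓡 n) ∞ M)
    (he' : e' ∈ IsManifold.maximalAtlas (𝓡 n) ∞ M) (hx : x ∈ e.target)
    (hx' : e.symm x ∈ e'.source) (v : Euc n) : fderiv ℝ (e' ∘ e.symm) x v =
      chartDifferential e' (e.symm x) (mfderiv (𝓡 n) (𝓡 n) e.symm x v) := by
  rw [← mfderiv_eq_fderiv, mfderiv_comp x (mdifferentiableAt_chart he' hx')
    (mdifferentiableAt_symm he hx)]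
  rfl

lemma comp_symm_transition {F : Type*} (u : M → F) (hx : x ∈ e.target)
    (hx' : e.symm x ∈ e'.source) :
    u ∘ e.symm =ᶠ[nhds x] (u ∘ e'.symm) ∘ (e' ∘ e.symm) := by
  have h1 : ∀ᶠ y in nhds x, e.symm y ∈ e'.source :=
    (e.continuousAt_symm hx).eventually (e'.open_source.mem_nhds hx')
  exact h1.mono fun y hy => by simp [e'.left_inv hy]

lemma bijective_fderiv_transition (he : e ∈ IsManifold.maximalAtlas (𝓡 n) ∞ M)
    (he' : e' ∈ IsManifold.maximalAtlas (𝓡 n) ∞ M) (hx : x ∈ e.target)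
    (hx' : e.symm x ∈ e'.source) : Function.Bijective (fderiv ℝ (e' ∘ e.symm) x) := by
  have hinj : Function.Injective (fderiv ℝ (e' ∘ e.symm) x) := by
    refine (injective_iff_map_eq_zero _).2 fun v hv => ?_
    set φ := e' ∘ e.symm
    have hy : φ x ∈ e'.target := e'.map_source hx'
    have hy' : e'.symm (φ x) = e.symm x := e'.left_inv hx'
    have h1 : (e ∘ e'.symm) ∘ φ =ᶠ[nhds x] id := by
      have h2 : ∀ᶠ y in nhds x, e.symm y ∈ e'.source :=
        (e.continuousAt_symm hx).eventually (e'.open_source.mem_nhds hx')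
      filter_upwards [h2, e.open_target.mem_nhds hx] with y hy hyt
      simp [φ, e'.left_inv hy, e.right_inv hyt]
    have h3 := fderiv_comp x
      ((contDiffAt_transition he' he hy (by rw [hy']; exact e.map_target hx)).differentiableAt
        (by simp)) ((contDiffAt_transition he he' hx hx').differentiableAt (by simp))
    rw [h1.fderiv_eq, fderiv_id] at h3
    have h4 := congrArg (fun L => L v) h3
    simp only [ContinuousLinearMap.comp_apply, ContinuousLinearMap.id_apply] at h4
    rw [h4, hv, map_zero]
  exact ⟨hinj, LinearMap.surjective_of_injective (f := (fderiv ℝ (e' ∘ e.symm) x : Euc n →ₗ[ℝ] Euc n))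
    hinj⟩

lemma pullForm_transition (hf : IsIsometricImmersion g f)
    (he : e ∈ IsManifold.maximalAtlas (𝓡 n) ∞ M)
    (he' : e' ∈ IsManifold.maximalAtlas (𝓡 n) ∞ M) (hx : x ∈ e.target)
    (hx' : e.symm x ∈ e'.source) :
    pullForm ambientForm (f ∘ e.symm) x =
      pullForm (pullForm ambientForm (f ∘ e'.symm)) (e' ∘ e.symm) x := by
  have hy : (e' ∘ e.symm) x ∈ e'.target := e'.map_source hx'
  have h1 : fderiv ℝ (f ∘ e.symm) x = _ := (comp_symm_transition f hx hx').fderiv_eq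
  have h2 := fderiv_comp x
    ((contDiffAt_comp_symm he' hf.contMDiff hy).differentiableAt (by simp))
    ((contDiffAt_transition he he' hx hx').differentiableAt (by simp))
  have h3 : (f ∘ e.symm) x = (f ∘ e'.symm) ((e' ∘ e.symm) x) := by
    simp [e'.left_inv hx']
  ext v w
  rw [pullForm_apply, pullForm_apply, pullForm_apply, h1, h2, h3]
  rfl

lemma pullForm_transition_eventually (hf : IsIsometricImmersion g f)
    (he : e ∈ IsManifold.maximalAtlas (𝓡 n) ∞ M)
    (he' : e' ∈ IsManifold.maximalAtlas (𝓡 n) ∞ M) (hx : x ∈ e.target)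
    (hx' : e.symm x ∈ e'.source) :
    pullForm ambientForm (f ∘ e.symm) =ᶠ[nhds x]
      pullForm (pullForm ambientForm (f ∘ e'.symm)) (e' ∘ e.symm) := by
  have h2 : ∀ᶠ y in nhds x, e.symm y ∈ e'.source :=
    (e.continuousAt_symm hx).eventually (e'.open_source.mem_nhds hx')
  filter_upwards [h2, e.open_target.mem_nhds hx] with y hy hyt
  exact pullForm_transition hf he he' hyt hy

/-- The Laplacian may be computed in any chart. -/
lemma laplacian_eq_coordLaplacian (hf : IsIsometricImmersion g f)
    (he : e ∈ IsManifold.maximalAtlas (𝓡 n) ∞ M) {u : M → ℝ}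
    (hu : ContMDiff (𝓡 n) 𝓘(ℝ, ℝ) ∞ u) (hx : x ∈ e.target) :
    laplacian g u (e.symm x) =
      coordLaplacian (toMetric (pullForm ambientForm (f ∘ e.symm))) (stdBasis n) (u ∘ e.symm) x := by
  set p := e.symm x with hp
  have hp1 : p ∈ e.source := e.map_target hx
  have hc := IsManifold.chart_mem_maximalAtlas (I := 𝓡 n) (n := ∞) p
  have hx' : p ∈ (chartAt (Euc n) p).source := mem_chart_source _ p
  set c := chartAt (Euc n) p with hcd
  have hy : (c ∘ e.symm) x ∈ c.target := c.map_source hx'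
  have h1 : laplacian g u p = coordLaplacian (toMetric (pullForm ambientForm (f ∘ c.symm)))
      (stdBasis n) (u ∘ c.symm) ((c ∘ e.symm) x) :=
    coordLaplacian_congr (metricInChart_eventuallyEq hf hc hy) Filter.EventuallyEq.rfl
  have h2 : ∀ k : ℕ, (k : ℕ∞ω) ≤ ∞ := fun k => by exact_mod_cast le_top
  rw [h1, ← coordLaplacian_pullForm
    ((contDiffAt_pullForm_immersion hf hc hy).differentiableAt (by simp))
    (isInner_pullForm_immersion hf hc hy)
    ((contDiffAt_transition he hc hx hx').of_le (h2 2))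
    (bijective_fderiv_transition he hc hx hx')
    ((contDiffAt_comp_symm hc hu hy).of_le (h2 2)) (stdBasis n) (stdBasis n)]
  refine coordLaplacian_congr ?_ (comp_symm_transition u hx hx').symm
  exact (pullForm_transition_eventually hf he hc hx hx').symm.fun_comp fun L v w => L v w

/-- The Laplacian of the height function. -/
theorem laplacian_height [NeZero n] (hf : IsIsometricImmersion g f) (p : M) :
    laplacian g (height f) p =
      n * ambientMetric (f p) (meanCurvatureVector f p) (verticalField n) := by
  have hc := IsManifold.chart_mem_maximalAtlas (I := 𝓡 n) (n := ∞) p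
  have hx' : p ∈ (chartAt (Euc n) p).source := mem_chart_source _ p
  set c := chartAt (Euc n) p with hcd
  have hy : c p ∈ c.target := c.map_source hx'
  have h1 : f p = (f ∘ c.symm) (c p) := by simp [c.left_inv hx']
  have h2 : ∀ k : ℕ, (k : ℕ∞ω) ≤ ∞ := fun k => by exact_mod_cast le_top
  rw [h1]
  refine Eq.trans ?_ (coordLaplacian_height (hf.mem_ball _) (injective_fderiv_immersion hf hc hy)
    ((contDiffAt_comp_symm hc hf.contMDiff hy).of_le (h2 2)))
  rw [pullbackMetric_eq]
  exact coordLaplacian_congr (metricInChart_eventuallyEq hf hc hy) Filter.EventuallyEq.rfl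

end Charts

section Densities

variable {n : ℕ} {M : Type*} [TopologicalSpace M] [ChartedSpace (Euc n) M]
  [IsManifold (𝓡 n) ∞ M] {g : SmoothMetric n M} {f : M → Euc n × ℝ}
  {e e' : OpenPartialHomeomorph M (Euc n)} {x : Euc n}

lemma bilin_comp_metric (hf : IsIsometricImmersion g f)
    (he : e ∈ IsManifold.maximalAtlas (𝓡 n) ∞ M)
    (he' : e' ∈ IsManifold.maximalAtlas (𝓡 n) ∞ M) (hx : x ∈ e.target)
    (hx' : e.symm x ∈ e'.source) (v w : Euc n) :
    metricInChart g e x v w = metricInChart g e' ((e' ∘ e.symm) x)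
      (fderiv ℝ (e' ∘ e.symm) x v) (fderiv ℝ (e' ∘ e.symm) x w) := by
  have hy : (e' ∘ e.symm) x ∈ e'.target := e'.map_source hx'
  rw [metricInChart_eq hf he hx, metricInChart_eq hf he' hy, pullbackMetric_eq, pullbackMetric_eq,
    toMetric, toMetric, pullForm_transition hf he he' hx hx', pullForm_apply]

lemma exists_bilin_metric (hf : IsIsometricImmersion g f)
    (he : e ∈ IsManifold.maximalAtlas (𝓡 n) ∞ M) (hx : x ∈ e.target) :
    ∃ T : Euc n →ₗ[ℝ] Euc n →ₗ[ℝ] ℝ, ∀ v w, T v w = metricInChart g e x v w := by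
  refine ⟨LinearMap.mk₂ ℝ (fun v w => pullForm ambientForm (f ∘ e.symm) x v w) ?_ ?_ ?_ ?_,
    fun v w => ?_⟩
  · intros; rw [map_add, add_apply]
  · intros; rw [map_smul, smul_apply]
  · intros; rw [map_add]
  · intros; rw [map_smul]
  · rw [metricInChart_eq hf he hx, pullbackMetric_eq]
    rfl

/-- The Riemannian density in a chart. -/
def chartDensity (g : SmoothMetric n M) (e : OpenPartialHomeomorph M (Euc n)) (x : Euc n) : ℝ :=
  √(gram (metricInChart g e) (stdBasis n) x).det

lemma chartDensity_transition (hf : IsIsometricImmersion g f)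
    (he : e ∈ IsManifold.maximalAtlas (𝓡 n) ∞ M)
    (he' : e' ∈ IsManifold.maximalAtlas (𝓡 n) ∞ M) (hx : x ∈ e.target)
    (hx' : e.symm x ∈ e'.source) :
    chartDensity g e x = |(fderiv ℝ (e' ∘ e.symm) x).det| *
      chartDensity g e' ((e' ∘ e.symm) x) := by
  obtain ⟨T, hT⟩ := exists_bilin_metric hf he' (e'.map_source hx')
  have h1 := det_bilin_comp T (fderiv ℝ (e' ∘ e.symm) x : Euc n →ₗ[ℝ] Euc n) (stdBasis n)
  have h2 : (gram (metricInChart g e) (stdBasis n) x) = Matrix.of fun i j =>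
      T ((fderiv ℝ (e' ∘ e.symm) x : Euc n →ₗ[ℝ] Euc n) (stdBasis n i))
        ((fderiv ℝ (e' ∘ e.symm) x : Euc n →ₗ[ℝ] Euc n) (stdBasis n j)) := by
    ext i j
    simp only [gram, Matrix.of_apply, bilin_comp_metric hf he he' hx hx', hT]
    rfl
  have h3 : (gram (metricInChart g e') (stdBasis n) ((e' ∘ e.symm) x)) =
      Matrix.of fun i j => T (stdBasis n i) (stdBasis n j) := by
    ext i j
    simp only [gram, Matrix.of_apply, hT]
    rfl
  rw [chartDensity, chartDensity, h2, h3, h1, Real.sqrt_mul (sq_nonneg _), Real.sqrt_sq_eq_abs]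

lemma contDiffAt_chartDensity (hf : IsIsometricImmersion g f)
    (he : e ∈ IsManifold.maximalAtlas (𝓡 n) ∞ M) (hx : x ∈ e.target) :
    ContDiffAt ℝ ∞ (chartDensity g e) x := by
  refine (contDiffAt_sqrt_det_gram (isInner_pullForm_immersion hf he hx)
    (contDiffAt_pullForm_immersion hf he hx) (stdBasis n)).congr_of_eventuallyEq ?_
  filter_upwards [metricInChart_eventuallyEq hf he hx] with y hy
  simp only [chartDensity, gram, hy]

lemma chartDensity_pos (hf : IsIsometricImmersion g f)
    (he : e ∈ IsManifold.maximalAtlas (𝓡 n) ∞ M) (hx : x ∈ e.target) :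
    0 < chartDensity g e x := by
  have := (gram_toMetric_posDef (isInner_pullForm_immersion hf he hx) (stdBasis n)).det_pos
  refine Real.sqrt_pos.2 ?_
  simpa only [gram, (metricInChart_eventuallyEq hf he hx).self_of_nhds] using this

lemma continuousOn_chartDensity (hf : IsIsometricImmersion g f)
    (he : e ∈ IsManifold.maximalAtlas (𝓡 n) ∞ M) : ContinuousOn (chartDensity g e) e.target :=
  fun _ hx => (contDiffAt_chartDensity hf he hx).continuousAt.continuousWithinAt

/-- In a chart domain, the Riemannian measure is `√(det g_{ij}) dx`. -/
lemma riemannianMeasure_restrict [MeasurableSpace M] [BorelSpace M]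
    (hf : IsIsometricImmersion g f) (he : e ∈ IsManifold.maximalAtlas (𝓡 n) ∞ M) :
    (riemannianMeasure g).restrict e.source =
      pushDensity e.symm e.target fun x => ENNReal.ofReal (chartDensity g e x) := by
  have hS := e.open_source.measurableSet
  refine iSup_measure_restrict (p := fun e => e ∈ IsManifold.maximalAtlas (𝓡 n) ∞ M)
    (ν := fun e => pushDensity e.symm e.target fun x => ENNReal.ofReal (chartDensity g e x))
    (S := fun e => e.source) he hS ?_ ?_
  · rw [pushDensity_apply e.open_target.measurableSet e.continuousOn_symm _ hS.compl]
    have : e.target ∩ e.symm ⁻¹' e.sourceᶜ = ∅ := by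
      ext x
      simp only [Set.mem_inter_iff, Set.mem_preimage, Set.mem_compl_iff, Set.mem_empty_iff_false,
        iff_false, not_and, not_not]
      exact fun hx => e.map_target hx
    rw [this]
    simp
  · intro e' he' A hA
    refine pushDensity_le e'.open_target.measurableSet e.open_target.measurableSet
      e'.continuousOn_symm e.continuousOn_symm hS (ψ := e ∘ e'.symm)
      (ψ' := fun x => fderiv ℝ (e ∘ e'.symm) x) ?_ e'.symm.injOn hA
    intro x hx hxS
    refine ⟨e.map_source hxS, e.left_inv hxS,
      ((contDiffAt_transition he' he hx hxS).differentiableAt (by simp)).hasFDerivAt, ?_⟩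
    rw [chartDensity_transition hf he' he hx hxS, ENNReal.ofReal_mul (abs_nonneg _)]

end Densities

section DomainCharts

variable {n : ℕ} [NeZero n] {M : Type*} [TopologicalSpace M] [ChartedSpace (Euc n) M]
  [IsManifold (𝓡 n) ∞ M] {g : SmoothMetric n M} {f : M → Euc n × ℝ} {Ω : Set M}
  {e e' : OpenPartialHomeomorph M (Euc n)} {x : Euc n}

lemma IsDomainChart.mem_frontier_iff (h : IsDomainChart Ω e) (hΩ : IsClosed Ω) {q : M}
    (hq : q ∈ e.source) : q ∈ frontier Ω ↔ e q 0 = 0 := by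
  have hc : ContinuousAt (fun q => e q 0) q :=
    (EuclideanSpace.proj (0 : Fin n) : Euc n →L[ℝ] ℝ).continuous.continuousAt.comp
      (e.continuousAt hq)
  rw [hΩ.frontier_eq, Set.mem_sdiff, h.mem_iff q hq]
  constructor
  · rintro ⟨h1, h2⟩
    by_contra h3
    refine h2 (mem_interior_iff_mem_nhds.2 ?_)
    have h4 : 0 < e q 0 := lt_of_le_of_ne h1 (Ne.symm h3)
    filter_upwards [hc.eventually (lt_mem_nhds h4), e.open_source.mem_nhds hq] with r hr hrs
    exact (h.mem_iff r hrs).2 hr.le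
  · intro h1
    refine ⟨h1.ge, fun h2 => ?_⟩
    have h3 : e q ∈ interior {y : Euc n | 0 ≤ y 0} := by
      rw [mem_interior_iff_mem_nhds]
      have h4 : ∀ᶠ r in nhds q, r ∈ Ω ∧ r ∈ e.source :=
        (show ∀ᶠ r in nhds q, r ∈ Ω from mem_interior_iff_mem_nhds.1 h2).and
          (e.open_source.mem_nhds hq)
      have h5 : ∀ᶠ y in nhds (e q), e.symm y ∈ Ω ∧ e.symm y ∈ e.source := by
        have := e.continuousAt_symm (e.map_source hq)
        rw [ContinuousAt, e.left_inv hq] at this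
        exact this.eventually h4
      filter_upwards [h5, e.open_target.mem_nhds (e.map_source hq)] with y hy hyt
      have := (h.mem_iff _ hy.2).1 hy.1
      rwa [e.right_inv hyt] at this
    rw [interior_halfSpace] at h3
    exact h3.ne' h1

lemma IsDomainChart.symm_mem_iff (h : IsDomainChart Ω e) (hx : x ∈ e.target) :
    e.symm x ∈ Ω ↔ 0 ≤ x 0 := by
  rw [h.mem_iff _ (e.map_target hx), e.right_inv hx]

lemma IsDomainChart.symm_mem_frontier_iff (h : IsDomainChart Ω e) (hΩ : IsClosed Ω)
    (hx : x ∈ e.target) : e.symm x ∈ frontier Ω ↔ x 0 = 0 := by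
  rw [h.mem_frontier_iff hΩ (e.map_target hx), e.right_inv hx]

/-- Each point of a compact domain lies in a chart in which the domain is a half-space. -/
lemma exists_isDomainChart (hΩ : IsClosed Ω)
    (hb : ∀ p ∈ frontier Ω, ∃ e : OpenPartialHomeomorph M (Euc n), p ∈ e.source ∧ IsDomainChart Ω e)
    {p : M} (hp : p ∈ Ω) :
    ∃ e : OpenPartialHomeomorph M (Euc n), p ∈ e.source ∧ IsDomainChart Ω e := by
  by_cases hpf : p ∈ frontier Ω
  · exact hb p hpf
  have hpi : p ∈ interior Ω := by
    by_contra h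
    exact hpf (by rw [hΩ.frontier_eq]; exact ⟨hp, h⟩)
  set c := chartAt (Euc n) p
  have hc : c ∈ IsManifold.maximalAtlas (𝓡 n) ∞ M := IsManifold.chart_mem_maximalAtlas p
  have hpc : p ∈ c.source := mem_chart_source _ p
  set a : Euc n := EuclideanSpace.single 0 1 - c p
  set e1 := c.transHomeomorph (Homeomorph.addRight a)
  have he1 : ∀ q, e1 q = c q + a := fun q => rfl
  have he1s : ∀ y, e1.symm y = c.symm (y - a) := fun y => by
    rw [sub_eq_add_neg]
    rfl
  have hs1 : e1.source = c.source := rfl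
  have ho : IsOpen (e1.source ∩ e1 ⁻¹' {y : Euc n | 0 < y 0}) :=
    e1.isOpen_inter_preimage (isOpen_lt continuous_const
      (EuclideanSpace.proj (0 : Fin n) : Euc n →L[ℝ] ℝ).continuous)
  set s := e1.source ∩ e1 ⁻¹' {y : Euc n | 0 < y 0} ∩ interior Ω
  have hs : IsOpen s := ho.inter isOpen_interior
  have hsrc : (e1.restr s).source = e1.source ∩ s := by
    rw [OpenPartialHomeomorph.restr_source, hs.interior_eq]
  refine ⟨e1.restr s, ?_, ?_, ?_⟩
  · rw [hsrc]
    refine ⟨hpc, ⟨hpc, ?_⟩, hpi⟩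
    simp [he1, a]
  · refine OpenPartialHomeomorph.mem_maximalAtlas_of_contMDiffOn _ ?_ ?_
    · intro q hq
      rw [hsrc] at hq
      have h1 : ContMDiffAt (𝓡 n) (𝓡 n) ∞ (fun q => c q + a) q :=
        ((contDiff_id.add contDiff_const).contMDiff.contMDiffAt (x := c q)).comp q
          (contMDiffAt_of_mem_maximalAtlas hc hq.1)
      exact h1.contMDiffWithinAt
    · intro y hy
      have hy1 : y ∈ e1.target := ((e1.restr s).mapsTo_symm hy).elim fun _ _ => hy.1
      have hy2 : y - a ∈ c.target := by
        rw [sub_eq_add_neg]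
        exact hy1
      have h1 : ContMDiffAt (𝓡 n) (𝓡 n) ∞ (fun y => c.symm (y - a)) y :=
        (contMDiffAt_symm_of_mem_maximalAtlas hc hy2).comp y
          ((contDiff_id.sub contDiff_const).contMDiff.contMDiffAt)
      exact (h1.congr_of_eventuallyEq (Filter.Eventually.of_forall he1s)).contMDiffWithinAt
  · intro q hq
    rw [hsrc] at hq
    exact ⟨fun _ => le_of_lt hq.2.1.2, fun _ => interior_subset hq.2.2⟩

end DomainCharts

section BoundaryCoordinates

variable {n : ℕ} [NeZero n]

/-- The inclusion of the hyperplane `{x₀ = 0}`, as a linear map. -/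
def hyperplaneInclL (n : ℕ) [NeZero n] : ({i : Fin n // i ≠ 0} → ℝ) →L[ℝ] Euc n :=
  LinearMap.toContinuousLinearMap
    { toFun := hyperplaneIncl
      map_add' := fun y z => by
        ext i
        by_cases h : i = 0 <;> simp [hyperplaneIncl, h]
      map_smul' := fun c y => by
        ext i
        by_cases h : i = 0 <;> simp [hyperplaneIncl, h] }

lemma continuous_hyperplaneIncl : Continuous (hyperplaneIncl (n := n)) :=
  (hyperplaneInclL n).continuous

lemma hyperplaneIncl_zero_coord (y : {i : Fin n // i ≠ 0} → ℝ) : hyperplaneIncl y 0 = 0 := by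
  simp [hyperplaneIncl]

lemma hyperplaneIncl_injective : Function.Injective (hyperplaneIncl (n := n)) := by
  intro y z h
  funext i
  have := congrArg (fun v : Euc n => v i) h
  simpa [hyperplaneIncl, i.2] using this

/-- The projection on the hyperplane `{x₀ = 0}`. -/
def hyperplaneProj (n : ℕ) [NeZero n] : Euc n →L[ℝ] ({i : Fin n // i ≠ 0} → ℝ) :=
  ContinuousLinearMap.pi fun i => EuclideanSpace.proj (i : Fin n)

lemma hyperplaneIncl_proj {x : Euc n} (hx : x 0 = 0) : hyperplaneIncl (hyperplaneProj n x) = x := by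
  ext i
  by_cases h : i = 0
  · subst h
    rw [hyperplaneIncl_zero_coord, hx]
  · simp [hyperplaneIncl, hyperplaneProj, h]

lemma hyperplaneIncl_single (i : {i : Fin n // i ≠ 0}) :
    hyperplaneIncl (Pi.single i 1) = stdBasis n i := by
  ext j
  by_cases h : j = 0
  · subst h
    simp [hyperplaneIncl, stdBasis, i.2.symm]
  · by_cases h2 : j = i
    · subst h2
      simp [hyperplaneIncl, stdBasis, h]
    · have h3 : (⟨j, h⟩ : {i : Fin n // i ≠ 0}) ≠ i := fun h4 => h2 (congrArg Subtype.val h4)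
      simp [hyperplaneIncl, stdBasis, h, h2, Pi.single_apply, h3]

/-- The matrix of a positive definite form restricted to the hyperplane `{x₀ = 0}`. -/
def tangentMinor (G : Matrix (Fin n) (Fin n) ℝ) :
    Matrix {i : Fin n // i ≠ 0} {i : Fin n // i ≠ 0} ℝ :=
  G.submatrix (fun i => (i : Fin n)) (fun i => (i : Fin n))

lemma det_tangentMinor (G : Matrix (Fin n) (Fin n) ℝ) :
    (tangentMinor G).det = G.adjugate 0 0 := by
  obtain ⟨m, rfl⟩ := Nat.exists_eq_succ_of_ne_zero (NeZero.ne n)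
  rw [Matrix.adjugate_fin_succ_eq_det_submatrix,
    ← Matrix.det_submatrix_equiv_self (finSuccAboveEquiv (0 : Fin (m + 1))) (tangentMinor G)]
  simp only [Fin.val_zero, add_zero, pow_zero, one_mul]
  rfl

lemma det_tangentMinor_eq {G : Matrix (Fin n) (Fin n) ℝ} (hG : G.det ≠ 0) :
    (tangentMinor G).det = G⁻¹ 0 0 * G.det := by
  rw [det_tangentMinor, Matrix.inv_def, Matrix.smul_apply, Ring.inverse_eq_inv', smul_eq_mul]
  field_simp

/-- The components of the unit normal to the hyperplane `{x₀ = 0}`. -/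
lemma sqrt_det_tangentMinor_mul {B : Euc n → Euc n →L[ℝ] Euc n →L[ℝ] ℝ} {x : Euc n}
    (h : IsInner (B x)) {N : Euc n} (h1 : B x N N = 1) (h2 : ∀ v : Euc n, v 0 = 0 → B x N v = 0)
    (h3 : 0 < N 0) (L : Euc n →L[ℝ] ℝ) :
    √(tangentMinor (gram (toMetric B) (stdBasis n) x)).det * L N =
      √(gram (toMetric B) (stdBasis n) x).det *
        ∑ j, (gram (toMetric B) (stdBasis n) x)⁻¹ 0 j * L (stdBasis n j) := by
  have hpd := gram_toMetric_posDef h (stdBasis n)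
  set G := gram (toMetric B) (stdBasis n) x with hG
  set c := B x N (stdBasis n 0) with hc
  have hb : ∀ l, B x N (stdBasis n l) = if l = 0 then c else 0 := by
    intro l
    split_ifs with hl
    · rw [hl]
    · exact h2 _ (by simp [stdBasis, Ne.symm hl])
  have hN := sum_inv_gram_smul h (stdBasis n) hb
  simp only [mul_ite, mul_zero, Finset.sum_ite_eq', Finset.mem_univ, if_true] at hN
  rw [← hG] at hN
  have hN0 : N 0 = G⁻¹ 0 0 * c := by
    conv_lhs => rw [← hN]
    simp [stdBasis, Finset.sum_apply, Pi.single_apply]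
  have hself : c * N 0 = 1 := by
    have hNs : N = ∑ i, N i • stdBasis n i := by
      conv_lhs => rw [← (stdBasis n).sum_repr N]
      simp [stdBasis]
    have h4 : B x N N = ∑ i, N i * B x N (stdBasis n i) := by
      refine (congrArg (B x N) hNs).trans ?_
      simp only [map_sum, map_smul, smul_eq_mul]
    rw [h4] at h1
    simp only [hb, mul_ite, mul_zero, Finset.sum_ite_eq', Finset.mem_univ, if_true] at h1
    linarith
  have hcpos : 0 < c := by
    by_contra hneg
    push Not at hneg
    nlinarith
  have hk : 0 < G⁻¹ 0 0 := by
    rw [hN0] at h3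
    exact (pos_iff_pos_of_mul_pos h3).2 hcpos
  have hck : √(G⁻¹ 0 0) * c = 1 := by
    have h5 : G⁻¹ 0 0 * c ^ 2 = 1 := by rw [← hself, hN0]; ring
    rw [← Real.sqrt_sq hcpos.le, ← Real.sqrt_mul hk.le, h5, Real.sqrt_one]
  have hLN : L N = c * ∑ j, G⁻¹ 0 j * L (stdBasis n j) := by
    conv_lhs => rw [← hN]
    rw [map_sum, Finset.mul_sum]
    refine Finset.sum_congr rfl fun j _ => ?_
    rw [map_smul, smul_eq_mul, gram_inv_symm h (stdBasis n) j 0]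
    ring
  rw [det_tangentMinor_eq hpd.det_pos.ne', Real.sqrt_mul hk.le, hLN]
  linear_combination (√G.det * ∑ j, G⁻¹ 0 j * L (stdBasis n j)) * hck

lemma det_tangentMinor_pos {B : Euc n → Euc n →L[ℝ] Euc n →L[ℝ] ℝ} {x : Euc n}
    (h : IsInner (B x)) : 0 < (tangentMinor (gram (toMetric B) (stdBasis n) x)).det := by
  have hpd := gram_toMetric_posDef h (stdBasis n)
  rw [det_tangentMinor_eq hpd.det_pos.ne']
  have := hpd.inv.diag_pos (i := 0)
  exact mul_pos this hpd.det_pos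

end BoundaryCoordinates

section BoundaryMeasure

variable {n : ℕ} [NeZero n] {M : Type*} [TopologicalSpace M] [ChartedSpace (Euc n) M]
  [IsManifold (𝓡 n) ∞ M] {g : SmoothMetric n M} {f : M → Euc n × ℝ} {Ω : Set M}
  {e e' : OpenPartialHomeomorph M (Euc n)} {x : Euc n}

/-- Changes of domain charts preserve the hyperplane `{x₀ = 0}` and its sides. -/
lemma IsDomainChart.fderiv_transition_zero (h : IsDomainChart Ω e) (h' : IsDomainChart Ω e')
    (hΩ : IsClosed Ω) (hx : x ∈ e.target) (hx' : e.symm x ∈ e'.source) (hx0 : x 0 = 0) :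
    ∃ c : ℝ, 0 < c ∧ ∀ v : Euc n, fderiv ℝ (e' ∘ e.symm) x v 0 = c * v 0 := by
  set φ := e' ∘ e.symm with hφ
  have hd : HasFDerivAt φ (fderiv ℝ φ x) x :=
    ((contDiffAt_transition h.mem_maximalAtlas h'.mem_maximalAtlas hx hx').differentiableAt
      (by simp)).hasFDerivAt
  set L : Euc n →L[ℝ] ℝ := (EuclideanSpace.proj (0 : Fin n) : Euc n →L[ℝ] ℝ).comp (fderiv ℝ φ x)
    with hL
  have hLv : ∀ v, L v = fderiv ℝ φ x v 0 := fun v => rfl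
  have hh : HasFDerivAt (fun y => φ y 0) L x :=
    (EuclideanSpace.proj (0 : Fin n) : Euc n →L[ℝ] ℝ).hasFDerivAt.comp x hd
  have hφ0 : φ x 0 = 0 :=
    (h'.mem_frontier_iff hΩ hx').1 ((h.symm_mem_frontier_iff hΩ hx).2 hx0)
  have hev : ∀ᶠ y in nhds x, 0 ≤ y 0 → 0 ≤ φ y 0 := by
    have h2 : ∀ᶠ y in nhds x, e.symm y ∈ e'.source :=
      (e.continuousAt_symm hx).eventually (e'.open_source.mem_nhds hx')
    filter_upwards [h2, e.open_target.mem_nhds hx] with y hy hyt hy0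
    exact (h'.mem_iff _ hy).1 ((h.symm_mem_iff hyt).2 hy0)
  have hline : ∀ v : Euc n, HasDerivAt (fun t : ℝ => φ (x + t • v) 0) (L v) 0 := by
    intro v
    have h1 : HasDerivAt (fun t : ℝ => x + t • v) v 0 := by
      simpa using ((hasDerivAt_id (0 : ℝ)).smul_const v).const_add x
    have h2 : HasFDerivAt (fun y => φ y 0) L (x + (0 : ℝ) • v) := by simpa using hh
    exact h2.comp_hasDerivAt (0 : ℝ) h1
  have hlev : ∀ v : Euc n, ∀ᶠ t : ℝ in nhds 0, 0 ≤ (x + t • v) 0 → 0 ≤ φ (x + t • v) 0 := by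
    intro v
    have h1 : Filter.Tendsto (fun t : ℝ => x + t • v) (nhds 0) (nhds x) := by
      have : Continuous fun t : ℝ => x + t • v := by fun_prop
      simpa using this.tendsto 0
    exact h1.eventually hev
  have hker : ∀ v : Euc n, v 0 = 0 → L v = 0 := by
    intro v hv
    refine IsLocalMin.hasDerivAt_eq_zero (f := fun t : ℝ => φ (x + t • v) 0) (a := 0) ?_ (hline v)
    filter_upwards [hlev v] with t ht
    simp only [zero_smul, add_zero, hφ0]
    exact ht (by simp [hx0, hv])
  set b : Euc n := EuclideanSpace.single 0 1 with hb
  have hmul : ∀ v : Euc n, L v = L b * v 0 := by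
    intro v
    have h1 := hker (v - v 0 • b) (by simp [hb])
    rw [map_sub, map_smul, smul_eq_mul] at h1
    linarith
  have hnn : 0 ≤ L b := by
    refine ge_of_tendsto (hline b).tendsto_slope_zero_right ?_
    have h1 : ∀ᶠ t : ℝ in nhdsWithin 0 (Set.Ioi 0), 0 ≤ (x + t • b) 0 → 0 ≤ φ (x + t • b) 0 :=
      (hlev b).filter_mono nhdsWithin_le_nhds
    filter_upwards [h1, self_mem_nhdsWithin] with t ht ht0
    have ht0' : (0 : ℝ) < t := ht0
    simp only [zero_add, zero_smul, add_zero, hφ0, sub_zero, smul_eq_mul]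
    exact mul_nonneg (by positivity) (ht (by simp [hx0, hb, ht0'.le]))
  have hne : L b ≠ 0 := by
    intro h0
    obtain ⟨v, hv⟩ := (bijective_fderiv_transition h.mem_maximalAtlas h'.mem_maximalAtlas hx hx').2 b
    have h1 := hmul v
    rw [hLv, hv, h0] at h1
    simp [hb] at h1
  exact ⟨L b, lt_of_le_of_ne hnn hne.symm, hmul⟩

/-- The density of the boundary measure in a domain chart. -/
def boundaryDensity (g : SmoothMetric n M) (e : OpenPartialHomeomorph M (Euc n)) (x : Euc n) : ℝ :=
  √(tangentMinor (gram (metricInChart g e) (stdBasis n) x)).det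

lemma boundaryDensity_pos (hf : IsIsometricImmersion g f)
    (he : e ∈ IsManifold.maximalAtlas (𝓡 n) ∞ M) (hx : x ∈ e.target) :
    0 < boundaryDensity g e x := by
  have := det_tangentMinor_pos (isInner_pullForm_immersion hf he hx)
  refine Real.sqrt_pos.2 ?_
  simpa only [gram, (metricInChart_eventuallyEq hf he hx).self_of_nhds] using this

lemma continuousOn_boundaryDensity (hf : IsIsometricImmersion g f)
    (he : e ∈ IsManifold.maximalAtlas (𝓡 n) ∞ M) :
    ContinuousOn (boundaryDensity g e) e.target := by
  intro x hx
  set B := pullForm ambientForm (f ∘ e.symm) with hB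
  have h0 : ContDiffAt ℝ ∞ B x := contDiffAt_pullForm_immersion hf he hx
  have h1 : ContDiffAt ℝ ∞ (fun y => (tangentMinor (gram (toMetric B) (stdBasis n) y)).det) x :=
    contDiffAt_det (fun i j => contDiffAt_gram h0 (stdBasis n) (i : Fin n) (j : Fin n))
  refine ContinuousAt.continuousWithinAt ?_
  refine (Real.continuous_sqrt.continuousAt.comp h1.continuousAt).congr ?_
  filter_upwards [metricInChart_eventuallyEq hf he hx] with y hy
  simp only [boundaryDensity, gram, hy, Function.comp_apply, hB]

lemma boundaryDensity_transition (hf : IsIsometricImmersion g f) (h : IsDomainChart Ω e)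
    (h' : IsDomainChart Ω e') (hΩ : IsClosed Ω) (hx : x ∈ e.target) (hx' : e.symm x ∈ e'.source)
    (hx0 : x 0 = 0) :
    boundaryDensity g e x =
      |((hyperplaneProj n).comp ((fderiv ℝ (e' ∘ e.symm) x).comp (hyperplaneInclL n))).det| *
      boundaryDensity g e' ((e' ∘ e.symm) x) := by
  obtain ⟨T, hT⟩ := exists_bilin_metric hf h'.mem_maximalAtlas (e'.map_source hx')
  obtain ⟨c, -, hc⟩ := h.fderiv_transition_zero h' hΩ hx hx' hx0
  set A := (hyperplaneProj n).comp ((fderiv ℝ (e' ∘ e.symm) x).comp (hyperplaneInclL n)) with hA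
  have hincl : ∀ y, hyperplaneIncl (A y) = fderiv ℝ (e' ∘ e.symm) x (hyperplaneIncl y) := fun y =>
    hyperplaneIncl_proj (by
      have := hc (hyperplaneIncl y)
      rwa [hyperplaneIncl_zero_coord, mul_zero] at this)
  set T' := T.compl₁₂ (hyperplaneInclL n : ({i : Fin n // i ≠ 0} → ℝ) →ₗ[ℝ] Euc n)
    (hyperplaneInclL n : ({i : Fin n // i ≠ 0} → ℝ) →ₗ[ℝ] Euc n) with hT'
  set A' := (A : ({i : Fin n // i ≠ 0} → ℝ) →ₗ[ℝ] ({i : Fin n // i ≠ 0} → ℝ)) with hA'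
  have hA'v : ∀ y, A' y = A y := fun y => rfl
  have hT'v : ∀ y z, T' y z = T (hyperplaneIncl y) (hyperplaneIncl z) := fun y z => rfl
  have h1 := det_bilin_comp T' A' (Pi.basisFun ℝ {i : Fin n // i ≠ 0})
  have h2 : tangentMinor (gram (metricInChart g e) (stdBasis n) x) = Matrix.of fun i j =>
      T' (A' (Pi.basisFun ℝ {i : Fin n // i ≠ 0} i))
        (A' (Pi.basisFun ℝ {i : Fin n // i ≠ 0} j)) := by
    ext i j
    simp only [tangentMinor, Matrix.submatrix_apply, gram, Matrix.of_apply, hT'v,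
      hA'v, hincl, Pi.basisFun_apply, hyperplaneIncl_single, hT,
      bilin_comp_metric hf h.mem_maximalAtlas h'.mem_maximalAtlas hx hx', Function.comp_apply]
  have h3 : tangentMinor (gram (metricInChart g e') (stdBasis n) ((e' ∘ e.symm) x)) =
      Matrix.of fun i j => T' (Pi.basisFun ℝ {i : Fin n // i ≠ 0} i)
        (Pi.basisFun ℝ {i : Fin n // i ≠ 0} j) := by
    ext i j
    simp only [tangentMinor, Matrix.submatrix_apply, gram, Matrix.of_apply, hT'v,
      Pi.basisFun_apply, hyperplaneIncl_single, hT, Function.comp_apply]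
  rw [boundaryDensity, boundaryDensity, h2, h3, h1, Real.sqrt_mul (sq_nonneg _),
    Real.sqrt_sq_eq_abs]

lemma continuousOn_symm_hyperplaneIncl (e : OpenPartialHomeomorph M (Euc n)) :
    ContinuousOn (fun y => e.symm (hyperplaneIncl y)) (hyperplaneIncl ⁻¹' e.target) :=
  e.continuousOn_symm.comp continuous_hyperplaneIncl.continuousOn fun _ hy => hy

/-- In a domain chart, the boundary measure is `√(det (g_{ij})_{i, j ≠ 0}) dx`. -/
lemma boundaryMeasure_restrict [MeasurableSpace M] [BorelSpace M]
    (hf : IsIsometricImmersion g f) (h : IsDomainChart Ω e) (hΩ : IsClosed Ω) :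
    (boundaryMeasure g Ω).restrict e.source =
      pushDensity (fun y => e.symm (hyperplaneIncl y)) (hyperplaneIncl ⁻¹' e.target)
        fun y => ENNReal.ofReal (boundaryDensity g e (hyperplaneIncl y)) := by
  have hS := e.open_source.measurableSet
  have hU : ∀ e : OpenPartialHomeomorph M (Euc n),
      MeasurableSet (hyperplaneIncl (n := n) ⁻¹' e.target) := fun e =>
    (e.open_target.preimage continuous_hyperplaneIncl).measurableSet
  refine iSup_measure_restrict (p := fun e => IsDomainChart Ω e)
    (ν := fun e => pushDensity (fun y => e.symm (hyperplaneIncl y)) (hyperplaneIncl ⁻¹' e.target)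
        fun y => ENNReal.ofReal (boundaryDensity g e (hyperplaneIncl y)))
    (S := fun e => e.source) h hS ?_ ?_
  · rw [pushDensity_apply (hU e) (continuousOn_symm_hyperplaneIncl e) _ hS.compl]
    have : hyperplaneIncl ⁻¹' e.target ∩
        (fun y : {i : Fin n // i ≠ 0} → ℝ => e.symm (hyperplaneIncl y)) ⁻¹' e.sourceᶜ = ∅ := by
      ext x
      simp only [Set.mem_inter_iff, Set.mem_preimage, Set.mem_compl_iff, Set.mem_empty_iff_false,
        iff_false, not_and, not_not]
      exact fun hx => e.map_target hx
    rw [this]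
    simp
  · intro e' h' A hA
    refine pushDensity_le (hU e') (hU e) (continuousOn_symm_hyperplaneIncl e')
      (continuousOn_symm_hyperplaneIncl e) hS
      (ψ := fun y => hyperplaneProj n ((e ∘ e'.symm) (hyperplaneIncl y)))
      (ψ' := fun y => (hyperplaneProj n).comp
        ((fderiv ℝ (e ∘ e'.symm) (hyperplaneIncl y)).comp (hyperplaneInclL n))) ?_ ?_ hA
    · intro y hy hyS
      have h0 : (e ∘ e'.symm) (hyperplaneIncl y) 0 = 0 :=
        (h.mem_frontier_iff hΩ hyS).1
          ((h'.symm_mem_frontier_iff hΩ hy).2 (hyperplaneIncl_zero_coord y))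
      have h1 := hyperplaneIncl_proj h0
      refine ⟨?_, ?_, ?_, ?_⟩
      · rw [Set.mem_preimage, h1]
        exact e.map_source hyS
      · show e.symm (hyperplaneIncl _) = _
        rw [h1]
        exact e.left_inv hyS
      · exact (hyperplaneProj n).hasFDerivAt.comp y
          (((contDiffAt_transition h'.mem_maximalAtlas h.mem_maximalAtlas hy hyS).differentiableAt
            (by simp)).hasFDerivAt.comp y (hyperplaneInclL n).hasFDerivAt)
      · simp only
        rw [h1, boundaryDensity_transition hf h' h hΩ hy hyS (hyperplaneIncl_zero_coord y),
          ENNReal.ofReal_mul (abs_nonneg _)]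
    · exact e'.symm.injOn.comp hyperplaneIncl_injective.injOn fun _ hy => hy

/-- The derivative of `w` in the direction of the vector field `ν`. -/
def normalDerivative (w : M → ℝ) (ν : (p : M) → TangentSpace (𝓡 n) p) (p : M) : ℝ :=
  mfderiv (𝓡 n) 𝓘(ℝ, ℝ) w p (ν p)

/-- The normal derivative and the boundary density in a domain chart. -/
lemma boundaryDensity_mul_normal (hf : IsIsometricImmersion g f) (h : IsDomainChart Ω e)
    (hΩ : IsClosed Ω) (hx : x ∈ e.target) (hx0 : x 0 = 0) {w : M → ℝ}
    (hw : ContMDiff (𝓡 n) 𝓘(ℝ, ℝ) ∞ w) {ν : (p : M) → TangentSpace (𝓡 n) p}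
    (hν : IsInnerUnitNormal g Ω (e.symm x) (ν (e.symm x))) :
    boundaryDensity g e x * normalDerivative w ν (e.symm x) =
      densityGradient (metricInChart g e) (stdBasis n) (w ∘ e.symm) 0 x := by
  obtain ⟨h1, e', hx', h', h2, h3⟩ := hν
  have he := h.mem_maximalAtlas
  obtain ⟨c, hc0, hc⟩ := h.fderiv_transition_zero h' hΩ hx hx' hx0
  set N := chartDifferential e (e.symm x) (ν (e.symm x)) with hN
  have hNν : mfderiv (𝓡 n) (𝓡 n) e.symm x N = ν (e.symm x) := symm_chartDifferential he hx _
  have hm : gram (metricInChart g e) (stdBasis n) x =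
      gram (toMetric (pullForm ambientForm (f ∘ e.symm))) (stdBasis n) x := by
    simp only [gram, (metricInChart_eventuallyEq hf he hx).self_of_nhds]
  have hB : ∀ v w, pullForm ambientForm (f ∘ e.symm) x v w =
      g.inner (e.symm x) (mfderiv (𝓡 n) (𝓡 n) e.symm x v) (mfderiv (𝓡 n) (𝓡 n) e.symm x w) := by
    intro v w
    have := congrFun (congrFun (metricInChart_eventuallyEq hf he hx).self_of_nhds v) w
    exact this.symm
  have hcd : ∀ v : Euc n, chartDifferential e' (e.symm x) (mfderiv (𝓡 n) (𝓡 n) e.symm x v) 0 = c * v 0 := by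
    intro v
    rw [← fderiv_transition he h'.mem_maximalAtlas hx hx', hc]
  have key := sqrt_det_tangentMinor_mul (isInner_pullForm_immersion hf he hx) (N := N)
    (by rw [hB, hNν]; exact h1)
    (fun v hv => by
      rw [hB, hNν]
      exact h2 _ ((hcd v).trans (by rw [hv, mul_zero])))
    (by
      have := hcd N
      rw [hNν] at this
      rw [this] at h3
      exact (pos_iff_pos_of_mul_pos h3).1 hc0)
    (fderiv ℝ (w ∘ e.symm) x)
  rw [boundaryDensity, densityGradient, hm, ← key, normalDerivative, fderiv_comp_symm he hw hx, hNν]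

end BoundaryMeasure

section CoordinateSums

variable {ι : Type} [Fintype ι] [DecidableEq ι]
variable {E : Type} [NormedAddCommGroup E] [NormedSpace ℝ E]

lemma coordLaplacian_finsetSum (g : E → E → E → ℝ) (b : Module.Basis ι ℝ E) {x : E} {κ : Type*}
    (s : Finset κ) {u : κ → E → ℝ} (hu : ∀ k ∈ s, ContDiffAt ℝ 2 (u k) x) :
    coordLaplacian g b (fun y => ∑ k ∈ s, u k y) x = ∑ k ∈ s, coordLaplacian g b (u k) x := by
  have h1 : ∀ᶠ y in nhds x, fderiv ℝ (fun y => ∑ k ∈ s, u k y) y = ∑ k ∈ s, fderiv ℝ (u k) y := by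
    have h2 : ∀ᶠ y in nhds x, ∀ k ∈ s, DifferentiableAt ℝ (u k) y :=
      (Filter.eventually_all_finset s).2 fun k hk =>
        ((hu k hk).eventually (by simp)).mono fun y hy => hy.differentiableAt two_ne_zero
    exact h2.mono fun y hy => fderiv_fun_sum hy
  have h3 : ∀ v w, fderiv ℝ (fun y => fderiv ℝ (fun y => ∑ k ∈ s, u k y) y v) x w =
      ∑ k ∈ s, fderiv ℝ (fun y => fderiv ℝ (u k) y v) x w := by
    intro v w
    have h4 : (fun y => fderiv ℝ (fun y => ∑ k ∈ s, u k y) y v) =ᶠ[nhds x]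
        fun y => ∑ k ∈ s, fderiv ℝ (u k) y v :=
      h1.mono fun y hy => by simp only [hy, sum_apply]
    rw [h4.fderiv_eq, fderiv_fun_sum, sum_apply]
    exact fun k hk => (((hu k hk).fderiv_right (m := 1) (by norm_num)).differentiableAt
      one_ne_zero).clm_apply (differentiableAt_const v)
  simp only [coordLaplacian, h3, h1.self_of_nhds, sum_apply, ← Finset.sum_sub_distrib,
    Finset.mul_sum]
  rw [Finset.sum_comm (s := s)]
  exact Finset.sum_congr rfl fun i _ => Finset.sum_comm

end CoordinateSums

section GermDependence

variable {n : ℕ} {M : Type*} [TopologicalSpace M] [ChartedSpace (Euc n) M]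
  [IsManifold (𝓡 n) ∞ M] {g : SmoothMetric n M} {f : M → Euc n × ℝ}
  {e : OpenPartialHomeomorph M (Euc n)} {x : Euc n} {p : M} {u u' : M → ℝ}
  {ν : (p : M) → TangentSpace (𝓡 n) p}

lemma laplacian_congr (h : u =ᶠ[nhds p] u') : laplacian g u p = laplacian g u' p := by
  have hp := mem_chart_source (Euc n) p
  have h1 := (chartAt (Euc n) p).continuousAt_symm (mem_chart_target (Euc n) p)
  rw [ContinuousAt, (chartAt (Euc n) p).left_inv hp] at h1
  exact coordLaplacian_congr Filter.EventuallyEq.rfl (h1.eventually h)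

lemma laplacian_eq_zero (h : u =ᶠ[nhds p] fun _ => 0) : laplacian g u p = 0 :=
  (laplacian_congr h).trans (coordLaplacian_zero _ _ _)

lemma normalDerivative_congr (h : u =ᶠ[nhds p] u') :
    normalDerivative u ν p = normalDerivative u' ν p :=
  DFunLike.congr_fun (h.mfderiv_eq (I := 𝓡 n) (I' := 𝓘(ℝ, ℝ))) (ν p)

lemma normalDerivative_eq_fderiv (hu : ContMDiff (𝓡 n) 𝓘(ℝ, ℝ) ∞ u)
    (he : e ∈ IsManifold.maximalAtlas (𝓡 n) ∞ M) (hx : x ∈ e.target) :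
    normalDerivative u ν (e.symm x) =
      fderiv ℝ (u ∘ e.symm) x (chartDifferential e (e.symm x) (ν (e.symm x))) := by
  rw [fderiv_comp_symm he hu hx]
  exact congrArg (mfderiv (𝓡 n) 𝓘(ℝ, ℝ) u (e.symm x)) (symm_chartDifferential he hx _).symm

lemma normalDerivative_eq_zero (h : u =ᶠ[nhds p] fun _ => 0) : normalDerivative u ν p = 0 := by
  rw [normalDerivative_congr h, normalDerivative, mfderiv_const]
  rfl

lemma laplacian_finsetSum {κ : Type*} (s : Finset κ)
    {w : κ → M → ℝ} (hw : ∀ k ∈ s, ContMDiff (𝓡 n) 𝓘(ℝ, ℝ) ∞ (w k)) (p : M) :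
    laplacian g (fun q => ∑ k ∈ s, w k q) p = ∑ k ∈ s, laplacian g (w k) p :=
  coordLaplacian_finsetSum _ _ s fun k hk =>
    (contDiffAt_comp_symm (IsManifold.chart_mem_maximalAtlas p) (hw k hk)
      (mem_chart_target _ p)).of_le
      ((fun k : ℕ => by exact_mod_cast le_top : ∀ k : ℕ, (k : ℕ∞ω) ≤ ∞) 2)

lemma normalDerivative_finsetSum {κ : Type*} (s : Finset κ)
    {w : κ → M → ℝ} (hw : ∀ k ∈ s, ContMDiff (𝓡 n) 𝓘(ℝ, ℝ) ∞ (w k)) (p : M) :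
    normalDerivative (fun q => ∑ k ∈ s, w k q) ν p = ∑ k ∈ s, normalDerivative (w k) ν p := by
  have hc := IsManifold.chart_mem_maximalAtlas (I := 𝓡 n) (n := ∞) p
  have hp := mem_chart_source (Euc n) p
  have ht := mem_chart_target (Euc n) p
  have h1 : ∀ w : M → ℝ, ContMDiff (𝓡 n) 𝓘(ℝ, ℝ) ∞ w → normalDerivative w ν p =
      fderiv ℝ (w ∘ (chartAt (Euc n) p).symm) (chartAt (Euc n) p p)
        (chartDifferential (chartAt (Euc n) p) p (ν p)) := by
    intro w hw
    have := normalDerivative_eq_fderiv (ν := ν) hw hc ht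
    rwa [(chartAt (Euc n) p).left_inv hp] at this
  rw [h1 _ (contMDiff_finsetSum hw), Finset.sum_congr rfl fun k hk => h1 _ (hw k hk)]
  have h2 : (fun q => ∑ k ∈ s, w k q) ∘ (chartAt (Euc n) p).symm =
      fun y => ∑ k ∈ s, (w k ∘ (chartAt (Euc n) p).symm) y := rfl
  rw [h2, fderiv_fun_sum, sum_apply]
  exact fun k hk => (contDiffAt_comp_symm hc (hw k hk) ht).differentiableAt (by simp)

end GermDependence

lemma continuous_of_eq_zero {M : Type*} [TopologicalSpace M] {F : M → ℝ}
    {K S : Set M} (hK : IsClosed K) (hS : IsOpen S)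
    (hKS : K ⊆ S) (hF : ContinuousOn F S) (h0 : ∀ p ∉ K, F p = 0) : Continuous F := by
  refine continuous_iff_continuousAt.2 fun p => ?_
  by_cases hp : p ∈ S
  · exact hF.continuousAt (hS.mem_nhds hp)
  · refine (continuousAt_const (y := (0 : ℝ))).congr ?_
    filter_upwards [hK.isOpen_compl.mem_nhds fun h => hp (hKS h)] with q hq
    exact (h0 q hq).symm

section LocalIntegrals

variable {E : Type*} [NormedAddCommGroup E] [NormedSpace ℝ E] [FiniteDimensional ℝ E]
  [MeasureSpace E] [BorelSpace E] {M : Type*} [TopologicalSpace M] [MeasurableSpace M]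
  [BorelSpace M]

/-- Integration, in a parametrization, of a function that vanishes off its image. -/
lemma integral_parametrized {P : E → M} {U : Set E} (hU : MeasurableSet U)
    (hP : ContinuousOn P U) {ρ : E → ℝ} (hρ : ContinuousOn ρ U) (hρ0 : ∀ x, 0 ≤ ρ x)
    {μ : Measure M} {S A : Set M} (hμ : μ.restrict S = pushDensity P U fun x => ENNReal.ofReal (ρ x))
    (hA : MeasurableSet A) {F : M → ℝ}
    (hF : AEStronglyMeasurable F (μ.restrict A)) (h0 : ∀ p ∈ A, p ∉ S → F p = 0) {Φ : E → ℝ}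
    (hΦ : ∀ x ∈ U, P x ∈ A → ρ x * F (P x) = Φ x) (hi : IntegrableOn Φ (U ∩ P ⁻¹' A)) :
    IntegrableOn F A μ ∧ ∫ p in A, F p ∂μ = ∫ x in U ∩ P ⁻¹' A, Φ x := by
  have hm := measurableSet_inter_preimage hU hP hA
  have h1 : μ.restrict (A ∩ S) = (μ.restrict S).restrict A := (Measure.restrict_restrict hA).symm
  have hF' : AEStronglyMeasurable F ((μ.restrict S).restrict A) := by
    rw [← h1]
    exact hF.mono_measure (Measure.restrict_mono Set.inter_subset_left le_rfl)
  constructor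
  · have h2 : IntegrableOn F (A ∩ S) μ := by
      rw [IntegrableOn, h1, hμ]
      rw [hμ] at hF'
      exact (integrableOn_pushDensity hU hP hρ hρ0 hA hF').2
        (hi.congr_fun (fun x hx => (hΦ x hx.1 hx.2).symm) hm)
    exact h2.of_forall_sdiff_eq_zero hA fun p hp => h0 p hp.1 fun hS => hp.2 ⟨hp.1, hS⟩
  · have h2 : ∫ p in A, F p ∂μ = ∫ p in A ∩ S, F p ∂μ :=
      setIntegral_eq_of_subset_of_forall_sdiff_eq_zero hA Set.inter_subset_left
        fun p hp => h0 p hp.1 fun hS => hp.2 ⟨hp.1, hS⟩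
    rw [hμ] at hF' h1
    rw [h2, h1, setIntegral_pushDensity hU hP hρ hρ0 hA hF']
    exact setIntegral_congr_fun hm fun x hx => hΦ x hx.1 hx.2

end LocalIntegrals

section LocalFlux

variable {n : ℕ} {M : Type*} [TopologicalSpace M] [ChartedSpace (Euc n) M]
  [IsManifold (𝓡 n) ∞ M] {g : SmoothMetric n M} {f : M → Euc n × ℝ}
  {e : OpenPartialHomeomorph M (Euc n)} {x : Euc n} {w : M → ℝ} {K : Set M}

/-- The gradient of `w` times the Riemannian density, in the chart `e`, extended by zero. -/
def chartGradient (g : SmoothMetric n M) (e : OpenPartialHomeomorph M (Euc n)) (w : M → ℝ)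
    (i : Fin n) : Euc n → ℝ :=
  e.target.indicator (densityGradient (metricInChart g e) (stdBasis n) (w ∘ e.symm) i)

lemma chartGradient_eventuallyEq (hf : IsIsometricImmersion g f)
    (he : e ∈ IsManifold.maximalAtlas (𝓡 n) ∞ M) (hx : x ∈ e.target) (i : Fin n) :
    chartGradient g e w i =ᶠ[nhds x] densityGradient
      (toMetric (pullForm ambientForm (f ∘ e.symm))) (stdBasis n) (w ∘ e.symm) i := by
  filter_upwards [metricInChart_eventuallyEq hf he hx, e.open_target.mem_nhds hx] with y hy hyt
  simp only [chartGradient, Set.indicator_of_mem hyt, densityGradient, gram, hy]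

lemma chartGradient_eventuallyEq_zero (hK : IsCompact K) (hKe : K ⊆ e.source)
    (hw : ∀ p ∉ K, w p = 0) (hx : x ∉ e '' K) (i : Fin n) :
    chartGradient g e w i =ᶠ[nhds x] fun _ => 0 := by
  have hc : IsClosed (e '' K) := (hK.image_of_continuousOn (e.continuousOn.mono hKe)).isClosed
  filter_upwards [hc.isOpen_compl.mem_nhds hx] with y hy
  by_cases hyt : y ∈ e.target
  · have h1 : w ∘ e.symm =ᶠ[nhds y] fun _ => 0 := by
      filter_upwards [hc.isOpen_compl.mem_nhds hy, e.open_target.mem_nhds hyt] with z hz hzt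
      exact hw _ fun h => hz ⟨_, h, e.right_inv hzt⟩
    simp only [chartGradient, Set.indicator_of_mem hyt, densityGradient, h1.fderiv_eq]
    simp
  · exact Set.indicator_of_notMem hyt _

lemma hasCompactSupport_chartGradient (hK : IsCompact K) (hKe : K ⊆ e.source)
    (hw : ∀ p ∉ K, w p = 0) (i : Fin n) : HasCompactSupport (chartGradient g e w i) :=
  HasCompactSupport.intro (hK.image_of_continuousOn (e.continuousOn.mono hKe)) fun _ hx =>
    (chartGradient_eventuallyEq_zero hK hKe hw hx i).self_of_nhds

lemma contDiff_chartGradient (hf : IsIsometricImmersion g f)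
    (he : e ∈ IsManifold.maximalAtlas (𝓡 n) ∞ M) (hK : IsCompact K) (hKe : K ⊆ e.source)
    (hw : ∀ p ∉ K, w p = 0) (hws : ContMDiff (𝓡 n) 𝓘(ℝ, ℝ) ∞ w) (i : Fin n) :
    ContDiff ℝ 1 (chartGradient g e w i) := by
  have hle : ∀ k : ℕ, (k : ℕ∞ω) ≤ ∞ := fun k => by exact_mod_cast le_top
  refine contDiff_iff_contDiffAt.2 fun x => ?_
  by_cases hx : x ∈ e.target
  · refine ContDiffAt.congr_of_eventuallyEq ?_ (chartGradient_eventuallyEq hf he hx i)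
    exact contDiffAt_densityGradient (isInner_pullForm_immersion hf he hx)
      ((contDiffAt_pullForm_immersion hf he hx).of_le (hle 1))
      ((contDiffAt_comp_symm he hws hx).of_le (hle 2)) _ _
  · refine contDiffAt_const.congr_of_eventuallyEq (chartGradient_eventuallyEq_zero hK hKe hw ?_ i)
    rintro ⟨p, hp, rfl⟩
    exact hx (e.map_source (hKe hp))

lemma sum_fderiv_chartGradient (hf : IsIsometricImmersion g f)
    (he : e ∈ IsManifold.maximalAtlas (𝓡 n) ∞ M) (hws : ContMDiff (𝓡 n) 𝓘(ℝ, ℝ) ∞ w)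
    (hx : x ∈ e.target) :
    ∑ i, fderiv ℝ (chartGradient g e w i) x (stdBasis n i) =
      chartDensity g e x * laplacian g w (e.symm x) := by
  have hle : ∀ k : ℕ, (k : ℕ∞ω) ≤ ∞ := fun k => by exact_mod_cast le_top
  simp only [(chartGradient_eventuallyEq hf he hx _).fderiv_eq]
  rw [sum_fderiv_densityGradient (isInner_pullForm_immersion hf he hx)
    ((contDiffAt_pullForm_immersion hf he hx).of_le (hle 1))
    ((contDiffAt_comp_symm he hws hx).of_le (hle 2)), laplacian_eq_coordLaplacian hf he hws hx,
    mul_comm, chartDensity]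
  simp only [gram, (metricInChart_eventuallyEq hf he hx).self_of_nhds]

lemma continuous_laplacian (hf : IsIsometricImmersion g f)
    (he : e ∈ IsManifold.maximalAtlas (𝓡 n) ∞ M) (hK : IsCompact K) (hKc : IsClosed K)
    (hKe : K ⊆ e.source) (hw : ∀ p ∉ K, w p = 0) (hws : ContMDiff (𝓡 n) 𝓘(ℝ, ℝ) ∞ w) :
    Continuous (laplacian g w) := by
  refine continuous_of_eq_zero hKc e.open_source hKe ?_ fun p hp => laplacian_eq_zero ?_
  · have h1 : Continuous fun x => ∑ i, fderiv ℝ (chartGradient g e w i) x (stdBasis n i) :=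
      continuous_finsetSum _ fun i _ => ((contDiff_chartGradient hf he hK hKe hw hws i
        ).continuous_fderiv one_ne_zero).clm_apply continuous_const
    have h2 := (h1.continuousOn.div (continuousOn_chartDensity hf he)
      fun x hx => (chartDensity_pos hf he hx).ne').comp e.continuousOn e.mapsTo
    refine h2.congr fun p hp => ?_
    have h3 := sum_fderiv_chartGradient hf he hws (e.map_source hp)
    rw [e.left_inv hp] at h3
    simp only [Function.comp_apply, Pi.div_apply, h3]
    rw [mul_div_cancel_left₀ _ (chartDensity_pos hf he (e.map_source hp)).ne']
  · filter_upwards [hKc.isOpen_compl.mem_nhds hp] with q hq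
    exact hw q hq

variable [NeZero n] {Ω : Set M} [MeasurableSpace M] [BorelSpace M]
  {ν : (p : M) → TangentSpace (𝓡 n) p}

lemma integral_laplacian_local (hf : IsIsometricImmersion g f) (he : IsDomainChart Ω e)
    (hΩ : IsClosed Ω) (hK : IsCompact K) (hKc : IsClosed K) (hKe : K ⊆ e.source)
    (hw : ∀ p ∉ K, w p = 0) (hws : ContMDiff (𝓡 n) 𝓘(ℝ, ℝ) ∞ w) :
    IntegrableOn (laplacian g w) Ω (riemannianMeasure g) ∧
      ∫ p in Ω, laplacian g w p ∂(riemannianMeasure g) =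
        - ∫ y, chartGradient g e w 0 (hyperplaneIncl y) := by
  have hm := he.mem_maximalAtlas
  have hV := contDiff_chartGradient hf hm hK hKe hw hws
  have hVc : ∀ i, HasCompactSupport (chartGradient g e w i) :=
    hasCompactSupport_chartGradient hK hKe hw
  have hc : Continuous fun x => ∑ i, fderiv ℝ (chartGradient g e w i) x (stdBasis n i) :=
    continuous_finsetSum _ fun i _ =>
      ((hV i).continuous_fderiv one_ne_zero).clm_apply continuous_const
  have h0 : ∀ x ∉ e '' K, ∑ i, fderiv ℝ (chartGradient g e w i) x (stdBasis n i) = 0 := by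
    intro x hx
    refine Finset.sum_eq_zero fun i _ => ?_
    rw [(chartGradient_eventuallyEq_zero hK hKe hw hx i).fderiv_eq]
    simp
  have hint : Integrable fun x => ∑ i, fderiv ℝ (chartGradient g e w i) x (stdBasis n i) :=
    hc.integrable_of_hasCompactSupport
      (HasCompactSupport.intro (hK.image_of_continuousOn (e.continuousOn.mono hKe)) h0)
  obtain ⟨h1, h2⟩ := integral_parametrized e.open_target.measurableSet e.continuousOn_symm
    (continuousOn_chartDensity hf hm) (fun x => Real.sqrt_nonneg _)
    (riemannianMeasure_restrict hf hm) hΩ.measurableSet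
    (continuous_laplacian hf hm hK hKc hKe hw hws).aestronglyMeasurable
    (fun p _ hp => laplacian_eq_zero (by
      filter_upwards [hKc.isOpen_compl.mem_nhds fun h => hp (hKe h)] with q hq
      exact hw q hq))
    (fun x hx _ => (sum_fderiv_chartGradient hf hm hws hx).symm) hint.integrableOn
  refine ⟨h1, ?_⟩
  rw [h2, ← halfSpace_divergence n hV hVc]
  refine (setIntegral_eq_of_subset_of_forall_sdiff_eq_zero ?_ ?_ ?_).symm
  · exact (isClosed_le continuous_const
      (EuclideanSpace.proj (0 : Fin n) : Euc n →L[ℝ] ℝ).continuous).measurableSet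
  · exact fun x hx => (he.symm_mem_iff hx.1).1 hx.2
  · rintro x ⟨hx0, hx⟩
    refine h0 x ?_
    rintro ⟨p, hp, rfl⟩
    have hpt := e.map_source (hKe hp)
    exact hx ⟨hpt, (he.symm_mem_iff hpt).2 hx0⟩

lemma integral_normalDerivative_local (hf : IsIsometricImmersion g f) (he : IsDomainChart Ω e)
    (hΩ : IsClosed Ω) (hK : IsCompact K) (hKc : IsClosed K) (hKe : K ⊆ e.source)
    (hw : ∀ p ∉ K, w p = 0) (hws : ContMDiff (𝓡 n) 𝓘(ℝ, ℝ) ∞ w)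
    (hν : ∀ p ∈ frontier Ω, IsInnerUnitNormal g Ω p (ν p)) :
    IntegrableOn (normalDerivative w ν) (frontier Ω) (boundaryMeasure g Ω) ∧
      ∫ p in frontier Ω, normalDerivative w ν p ∂(boundaryMeasure g Ω) =
        ∫ y, chartGradient g e w 0 (hyperplaneIncl y) := by
  have hm := he.mem_maximalAtlas
  have hV := contDiff_chartGradient hf hm hK hKe hw hws 0
  have hVc := hasCompactSupport_chartGradient (g := g) hK hKe hw 0
  have hA : MeasurableSet (frontier Ω) := isClosed_frontier.measurableSet
  have hU : IsOpen (hyperplaneIncl (n := n) ⁻¹' e.target) :=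
    e.open_target.preimage continuous_hyperplaneIncl
  have hint : Integrable fun y => chartGradient g e w 0 (hyperplaneIncl y) := by
    refine (hV.continuous.comp continuous_hyperplaneIncl).integrable_of_hasCompactSupport ?_
    exact hVc.comp_isClosedEmbedding (LinearMap.isClosedEmbedding_of_injective
      (f := (hyperplaneInclL n : ({i : Fin n // i ≠ 0} → ℝ) →ₗ[ℝ] Euc n))
      (LinearMap.ker_eq_bot.2 hyperplaneIncl_injective))
  have hzero : ∀ p ∉ K, normalDerivative w ν p = 0 := fun p hp => normalDerivative_eq_zero (by
    filter_upwards [hKc.isOpen_compl.mem_nhds hp] with q hq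
    exact hw q hq)
  have hval : ∀ p ∈ frontier Ω, p ∈ e.source →
      boundaryDensity g e (e p) * normalDerivative w ν p = chartGradient g e w 0 (e p) := by
    intro p hp hpe
    have hpt := e.map_source hpe
    have h1 := e.left_inv hpe
    have h2 := boundaryDensity_mul_normal hf he hΩ hpt ((he.mem_frontier_iff hΩ hpe).1 hp) hws
      (ν := ν) (by rw [h1]; exact hν p hp)
    rw [h1] at h2
    rw [h2, chartGradient, Set.indicator_of_mem hpt]
  have hcont : Continuous (e.source.indicator fun p =>
      chartGradient g e w 0 (e p) / boundaryDensity g e (e p)) := by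
    refine continuous_of_eq_zero hKc e.open_source hKe ?_ fun p hp => ?_
    · refine ((hV.continuous.continuousOn.div (continuousOn_boundaryDensity hf hm)
        fun x hx => (boundaryDensity_pos hf hm hx).ne').comp e.continuousOn e.mapsTo).congr ?_
      exact fun p hp => Set.indicator_of_mem hp _
    · by_cases hpe : p ∈ e.source
      · have h1 : e p ∉ e '' K := by
          rintro ⟨q, hq, hqp⟩
          exact hp (e.injOn (hKe hq) hpe hqp ▸ hq)
        rw [Set.indicator_of_mem hpe,
          (chartGradient_eventuallyEq_zero hK hKe hw h1 0).self_of_nhds, zero_div]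
      · exact Set.indicator_of_notMem hpe _
  have hF : AEStronglyMeasurable (normalDerivative w ν)
      ((boundaryMeasure g Ω).restrict (frontier Ω)) := by
    refine hcont.aestronglyMeasurable.congr ?_
    filter_upwards [ae_restrict_mem hA] with p hp
    by_cases hpe : p ∈ e.source
    · rw [Set.indicator_of_mem hpe, ← hval p hp hpe,
        mul_div_cancel_left₀ _ (boundaryDensity_pos hf hm (e.map_source hpe)).ne']
    · rw [Set.indicator_of_notMem hpe, hzero p fun h => hpe (hKe h)]
  obtain ⟨h1, h2⟩ := integral_parametrized hU.measurableSet (continuousOn_symm_hyperplaneIncl e)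
    ((continuousOn_boundaryDensity hf hm).comp continuous_hyperplaneIncl.continuousOn
      fun _ hy => hy) (fun x => Real.sqrt_nonneg _)
    (boundaryMeasure_restrict hf he hΩ) hA hF (fun p _ hp => hzero p fun h => hp (hKe h))
    (Φ := fun y => chartGradient g e w 0 (hyperplaneIncl y))
    (fun y hy hyA => by
      have := hval _ hyA (e.map_target hy)
      rwa [e.right_inv hy] at this) hint.integrableOn
  refine ⟨h1, ?_⟩
  rw [h2]
  refine setIntegral_eq_integral_of_forall_compl_eq_zero fun y hy => ?_
  have hyt : hyperplaneIncl y ∉ e.target := fun hyt =>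
    hy ⟨hyt, (he.symm_mem_frontier_iff hΩ hyt).2 (hyperplaneIncl_zero_coord y)⟩
  exact Set.indicator_of_notMem hyt _

end LocalFlux

lemma contMDiff_height {n : ℕ} {M : Type*} [TopologicalSpace M] [ChartedSpace (Euc n) M]
    [IsManifold (𝓡 n) ∞ M] {g : SmoothMetric n M} {f : M → Euc n × ℝ} (hf : IsIsometricImmersion g f) :
    ContMDiff (𝓡 n) 𝓘(ℝ, ℝ) ∞ (height f) :=
  contDiff_snd.contMDiff.comp hf.contMDiff

section Flux

variable {n : ℕ} [NeZero n] {M : Type*} [TopologicalSpace M] [T2Space M]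
  [SecondCountableTopology M] [ChartedSpace (Euc n) M] [IsManifold (𝓡 n) ∞ M]
  [MeasurableSpace M] [BorelSpace M] {g : SmoothMetric n M} {f : M → Euc n × ℝ} {Ω : Set M}
  {ν : (p : M) → TangentSpace (𝓡 n) p}

/-- Near a compact domain, a smooth function is a finite sum of smooth functions with compact
support in domain charts. -/
lemma exists_localization (hΩ : IsCompactDomain n Ω) {u : M → ℝ}
    (hu : ContMDiff (𝓡 n) 𝓘(ℝ, ℝ) ∞ u) :
    ∃ (s : Finset M) (w : M → M → ℝ), (∀ p ∈ Ω, (fun q => ∑ i ∈ s, w i q) =ᶠ[nhds p] u) ∧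
      ∀ i ∈ s, ContMDiff (𝓡 n) 𝓘(ℝ, ℝ) ∞ (w i) ∧
        ∃ (e : OpenPartialHomeomorph M (Euc n)) (K : Set M), IsDomainChart Ω e ∧ IsCompact K ∧
          K ⊆ e.source ∧ ∀ p ∉ K, w i p = 0 := by
  have hlc : LocallyCompactSpace M := ChartedSpace.locallyCompactSpace (Euc n) M
  have h1 : ∀ p ∈ Ω, ∃ (e : OpenPartialHomeomorph M (Euc n)) (K : Set M), IsDomainChart Ω e ∧
      IsCompact K ∧ K ⊆ e.source ∧ p ∈ interior K := by
    intro p hp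
    obtain ⟨e, hpe, he⟩ := exists_isDomainChart hΩ.isCompact.isClosed hΩ.exists_chart hp
    obtain ⟨K, hK, hpK, hKe⟩ := exists_compact_subset e.open_source hpe
    exact ⟨e, K, he, hK, hKe, hpK⟩
  choose! e K he hK hKe hpK using h1
  obtain ⟨s, hs, hcov⟩ := hΩ.isCompact.elim_nhds_subcover (fun p => interior (K p))
    fun p hp => isOpen_interior.mem_nhds (hpK p hp)
  have hopen : IsOpen (⋃ p ∈ s, interior (K p)) := isOpen_biUnion fun _ _ => isOpen_interior
  obtain ⟨L, hL, hΩL, hLU⟩ := exists_compact_between hΩ.isCompact hopen hcov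
  obtain ⟨χ, hχ⟩ := SmoothPartitionOfUnity.exists_isSubordinate (𝓡 n) hL.isClosed
    (fun i : s => interior (K i)) (fun _ => isOpen_interior)
    (fun p hp => by
      obtain ⟨i, hi, hpi⟩ := Set.mem_iUnion₂.1 (hLU hp)
      exact Set.mem_iUnion.2 ⟨⟨i, hi⟩, hpi⟩)
  classical
  refine ⟨s, fun i q => if h : i ∈ s then χ ⟨i, h⟩ q * u q else 0, fun p hp => ?_, fun i hi => ?_⟩
  · filter_upwards [mem_interior_iff_mem_nhds.1 (hΩL hp)] with q hq
    have h2 := χ.sum_eq_one hq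
    rw [finsum_eq_sum_of_fintype] at h2
    rw [← Finset.sum_coe_sort]
    simp only [Finset.coe_mem, dif_pos, Subtype.coe_eta]
    rw [← Finset.sum_mul, h2, one_mul]
  · simp only [hi, dif_pos]
    refine ⟨(χ ⟨i, hi⟩).contMDiff.mul hu, e i (hs i hi), K i, he i (hs i hi), hK i (hs i hi),
      hKe i (hs i hi), fun p hp => ?_⟩
    rw [image_eq_zero_of_notMem_tsupport fun h => hp (interior_subset (hχ ⟨i, hi⟩ h)), zero_mul]

/-- The divergence theorem for the gradient of a smooth function on a compact domain. -/
theorem integral_laplacian (hf : IsIsometricImmersion g f) (hΩ : IsCompactDomain n Ω)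
    {u : M → ℝ} (hu : ContMDiff (𝓡 n) 𝓘(ℝ, ℝ) ∞ u)
    (hν : ∀ p ∈ frontier Ω, IsInnerUnitNormal g Ω p (ν p)) :
    IntegrableOn (laplacian g u) Ω (riemannianMeasure g) ∧
      IntegrableOn (normalDerivative u ν) (frontier Ω) (boundaryMeasure g Ω) ∧
      ∫ p in Ω, laplacian g u p ∂(riemannianMeasure g) =
        - ∫ p in frontier Ω, normalDerivative u ν p ∂(boundaryMeasure g Ω) := by
  obtain ⟨s, w, hsum, hw⟩ := exists_localization hΩ hu
  have hΩc : IsClosed Ω := hΩ.isCompact.isClosed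
  have hws : ∀ i ∈ s, ContMDiff (𝓡 n) 𝓘(ℝ, ℝ) ∞ (w i) := fun i hi => (hw i hi).1
  have h1 : ∀ p ∈ Ω, laplacian g u p = ∑ i ∈ s, laplacian g (w i) p := fun p hp => by
    rw [← laplacian_finsetSum s hws p, laplacian_congr (hsum p hp)]
  have h2 : ∀ p ∈ frontier Ω, normalDerivative u ν p = ∑ i ∈ s, normalDerivative (w i) ν p :=
    fun p hp => by
      rw [← normalDerivative_finsetSum s hws p,
        normalDerivative_congr (hsum p (hΩc.frontier_subset hp))]
  have hI : ∀ i ∈ s, IntegrableOn (laplacian g (w i)) Ω (riemannianMeasure g) ∧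
      IntegrableOn (normalDerivative (w i) ν) (frontier Ω) (boundaryMeasure g Ω) ∧
      ∫ p in Ω, laplacian g (w i) p ∂(riemannianMeasure g) =
        - ∫ p in frontier Ω, normalDerivative (w i) ν p ∂(boundaryMeasure g Ω) := by
    intro i hi
    obtain ⟨hwi, e, K, he, hK, hKe, h0⟩ := hw i hi
    obtain ⟨h3, h4⟩ := integral_laplacian_local hf he hΩc hK hK.isClosed hKe h0 hwi
    obtain ⟨h5, h6⟩ := integral_normalDerivative_local hf he hΩc hK hK.isClosed hKe h0 hwi hν
    exact ⟨h3, h5, by rw [h4, h6]⟩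
  have hm := hΩc.measurableSet
  have hm' := (isClosed_frontier (s := Ω)).measurableSet
  refine ⟨?_, ?_, ?_⟩
  · refine IntegrableOn.congr_fun ?_ (fun p hp => (h1 p hp).symm) hm
    exact integrable_finsetSum s fun i hi => (hI i hi).1
  · refine IntegrableOn.congr_fun ?_ (fun p hp => (h2 p hp).symm) hm'
    exact integrable_finsetSum s fun i hi => (hI i hi).2.1
  · rw [setIntegral_congr_fun hm h1, setIntegral_congr_fun hm' h2,
      integral_finsetSum s fun i hi => (hI i hi).1,
      integral_finsetSum s fun i hi => (hI i hi).2.1, ← Finset.sum_neg_distrib]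
    exact Finset.sum_congr rfl fun i hi => (hI i hi).2.2

/-- The integral of the Laplacian of the height function in terms of the mean curvature. -/
lemma integral_laplacian_height (hf : IsIsometricImmersion g f) (hΩ : MeasurableSet Ω)
    (h : IntegrableOn (laplacian g (height f)) Ω (riemannianMeasure g)) :
    IntegrableOn (fun p => ambientMetric (f p) (meanCurvatureVector f p) (verticalField n)) Ω
        (riemannianMeasure g) ∧
      ∫ p in Ω, laplacian g (height f) p ∂(riemannianMeasure g) =
        n * ∫ p in Ω, ambientMetric (f p) (meanCurvatureVector f p) (verticalField n)
          ∂(riemannianMeasure g) := by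
  have hn : (n : ℝ) ≠ 0 := Nat.cast_ne_zero.2 (NeZero.ne n)
  constructor
  · refine IntegrableOn.congr_fun (h.const_mul ((n : ℝ)⁻¹)) (fun p _ => ?_) hΩ
    simp only [laplacian_height hf p]
    rw [inv_mul_cancel_left₀ hn]
  · simp only [laplacian_height hf]
    exact integral_const_mul _ _

end Flux

end

end VerticalFlux

open VerticalFlux in
theorem mainTheorem10 (n : ℕ) [NeZero n] :
    -- the Laplacian of the height function, and the flux formula over compact domains
    (∀ (M : Type*) [TopologicalSpace M] [T2Space M] [SecondCountableTopology M]
        [ChartedSpace (Euc n) M] [IsManifold (𝓡 n) ∞ M] [MeasurableSpace M] [BorelSpace M]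
        (g : SmoothMetric n M) (f : M → Euc n × ℝ), IsIsometricImmersion g f →
      (∀ p : M, laplacian g (height f) p =
        n * ambientMetric (f p) (meanCurvatureVector f p) (verticalField n)) ∧
      (∀ (Ω : Set M), IsCompactDomain n Ω →
        ∀ ν : (p : M) → TangentSpace (𝓡 n) p,
          (∀ p ∈ frontier Ω, IsInnerUnitNormal g Ω p (ν p)) →
        IntegrableOn (laplacian g (height f)) Ω (riemannianMeasure g) ∧
        IntegrableOn (fun p => (mfderiv (𝓡 n) 𝓘(ℝ, ℝ) (height f) p (ν p) : ℝ)) (frontier Ω)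
          (boundaryMeasure g Ω) ∧
        IntegrableOn (fun p => ambientMetric (f p) (meanCurvatureVector f p) (verticalField n)) Ω
          (riemannianMeasure g) ∧
        ∫ p in Ω, laplacian g (height f) p ∂(riemannianMeasure g) =
          - ∫ p in frontier Ω, (mfderiv (𝓡 n) 𝓘(ℝ, ℝ) (height f) p (ν p) : ℝ)
              ∂(boundaryMeasure g Ω) ∧
        ∫ p in Ω, laplacian g (height f) p ∂(riemannianMeasure g) =
          n * ∫ p in Ω, ambientMetric (f p) (meanCurvatureVector f p) (verticalField n)
              ∂(riemannianMeasure g))) ∧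
    -- rotation hypersurfaces
    (∀ (J : Set ℝ) (lam : ℝ → ℝ), IsOpen J → J.OrdConnected → J ⊆ Set.Ioi 0 →
        ContDiffOn ℝ 2 lam J →
      (∀ ρ ∈ J, ∀ ξ : Euc n, ‖ξ‖ = 1 →
        ∃! N : Euc n × ℝ, IsUpwardUnitNormal (rotationParam lam) (ρ • ξ) N) ∧
      (∀ ρ ∈ J, ∀ ξ : Euc n, ‖ξ‖ = 1 → ∀ N : Euc n × ℝ,
        IsUpwardUnitNormal (rotationParam lam) (ρ • ξ) N →
        HasDerivAt (profileFlux n lam)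
          (n * ambientMetric (rotationParam lam (ρ • ξ))
            (paramMeanCurvatureVector (rotationParam lam) (ρ • ξ)) N * Real.sinh ρ ^ (n - 1)) ρ) ∧
      (∀ H : ℝ, HasConstantMeanCurvature n lam J H →
        ∀ ρ₀ ∈ J, ∀ ρ ∈ J,
          profileFlux n lam ρ =
            n * H * (∫ t in ρ₀..ρ, Real.sinh t ^ (n - 1)) + profileFlux n lam ρ₀) ∧
      (∀ H : ℝ, HasConstantMeanCurvature n lam J H ↔
        ∃ d : ℝ, ∀ ρ ∈ J,
          profileFlux n lam ρ = n * H * (∫ t in (0 : ℝ)..ρ, Real.sinh t ^ (n - 1)) + d)) := by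
  refine ⟨fun M _ _ _ _ _ _ _ g f hf => ⟨laplacian_height hf, fun Ω hΩ ν hν => ?_⟩,
    fun J lam hJ hJc hJ0 hlam => rotation_flux n J lam hJ hJc hJ0 hlam⟩
  obtain ⟨h1, h2, h3⟩ := integral_laplacian hf hΩ (contMDiff_height hf) hν
  obtain ⟨h4, h5⟩ := integral_laplacian_height hf hΩ.isCompact.isClosed.measurableSet h1
  exact ⟨h1, h2, h4, h3, h5⟩
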